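/- **Setting.** Let $\Omega=\biguplus_{l\in[L]}\Omega_l$, let $k_l$ be integer capacities ($k_l\ge 1$ whenever $\Omega_l\neq\varnothing$), write $l(u)$ for the part containing $u$, and call $X\subseteq\Omega$ independent if $|X\cap\Omega_l|\le k_l$ for all $l$. Let $f$ be a non-negative, monotone, submodular function of the finite subsets of $\Omega$. Distinct elements of $\Omega$ arrive one at a time, in an order fixed before the algorithm draws its randomness; the algorithm does not know the future. It holds an independent set, initially empty, and in each round it may drop elements and may insert the arriving one. Its competitive ratio is at least $r$ if after every finite sequence the set $X$ held satisfies $\mathbb E[f(X)]\ge r\, f(O)$ for every independent set $O$ of arrived elements. **Constant.** $\alpha=\alpha_\infty$ is the unique real number $>1$ with $\alpha=e^{\alpha-2}$; $1/\alpha_\infty\approx 0.3178$. **Continuous algorithm.** For finitely supported $S\in\mathbb R_+^\Omega$ let $\hat f(S)=\mathbb E[f(R(S))]$, where $R(S)$ contains each $u$ independently with probability $1-e^{-S_u}$, and let $\hat f(u\mid S)=\lim_{t\to0^+}(\hat f(S+t\mathbf e_u)-\hat f(S))/t$. Identify $S$ with the set of pairs $\{(u,t):0<t\le S_u\}$. The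 algorithm keeps vectors $S,A\in\mathbb R_+^\Omega$, initially $0$, with $\|S|_{\Omega_l}\|:=\sum_{u\in\Omega_l}S_u\le k_l$ for all $l$, and a function $w$ on the pairs ever included; put $w(B)=\int_B w(z)\,dz$. When $u\in\Omega_l$ arrives, $S_u=A_u=t$ is increased continuously from $t=0$, as long as $$w(u,t)>\tfrac1{k_l}\bigl(\alpha\, w(S|_{\Omega_l})-w(A|_{\Omega_l})\bigr),$$ where $w(u,t):=\hat f(u\mid A)$ for the current $A$ (with $A_u=t$); the round ends when this condition fails. While $\|S|_{\Omega_l}\|<k_l$ no other coordinate of $S$ changes. While $\|S|_{\Omega_l}\|=k_l$, let $T$ be the set of $v\in\Omega_l$ with $S_v>0$ for which $(v,S_v)$ minimizes $w$ over $S|_{\Omega_l}$; then $\frac{dS_v}{dt}=-\eta_v^{-1}/\sum_{s\in T}\eta_s^{-1}$ for $v\in T$, where $\eta_v=|w_v'(S_v)|$ and $w_v(\tau)=w(v,\tau)$, and the other coordinates $S_v$, $v\ne u$, do not change. (Derivatives with respect to $t$ are right derivatives.) The coordinates of $A$ other than $A_u$, and the values of $w$ at earlier pairs, do not change. **Rounding.**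 Before any arrival draw, independently, $k_l$ uniform points of $\{l\}\times(0,k_l]$ for each $l$; let $\mathcal Z$ be the set of these points. A knapsack assignment gives each pair $(u,t)$ of $S$ a point $\varphi(u,t)\in\{l(u)\}\times(0,k_{l(u)}]$, depending only on the arrivals so far, such that at the end of every round $\varphi$ is injective and measure preserving on $S$ (images of measurable sets are measurable), and a pair of an earlier element keeps its point as long as it stays in $S$. At the end of each round the rounded algorithm holds $\tilde S=\{u:\exists t,\ (u,t)\in S,\ \varphi(u,t)\in\mathcal Z\}$. **Theorem.** 1. Whenever the continuous algorithm is run on all arrival sequences, then at the end of every finite sequence, $f(O)\le\alpha_\infty\,\hat f(S)$ for every independent set $O$ of arrived elements. Moreover, for every knapsack assignment, $\tilde S$ is a randomized online algorithm for the original problem (it is always independent; in each round only the arriving element can be inserted), $\mathbb E[f(\tilde S)]\ge\hat f(S)$, and its competitive ratio is at least $1/\alpha_\infty$. 2. For every $f$ as above such a run of the continuous algorithm and such a knapsack assignment exist, and they can be chosen so that the state after a sequence of arrivals depends only on that sequence and on the values of $f$ on sets of arrived elements. -/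

import Mathlib

open scoped Classical

noncomputable section

namespace OnlineSubmodular

/-- A non-negative monotone submodular objective `f : 2^Ω → ℝ₊`
(only finite sets of elements ever occur). -/
structure IsMonotoneSubmodular {Ω : Type*} (f : Finset Ω → ℝ) : Prop where
  nonneg : ∀ X, 0 ≤ f X
  mono : ∀ X Y, X ⊆ Y → f X ≤ f Y
  submodular : ∀ X Y, f (X ∪ Y) + f (X ∩ Y) ≤ f X + f Y

/-- Independence in the partition matroid whose parts are the fibres
`Ω_l = {u | part u = l}`, with capacities `k l`. -/
def Indep {Ω ι : Type*} (part : Ω → ι) (k : ι → ℕ) (X : Finset Ω) : Prop :=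
  ∀ l, (X.filter (fun u => part u = l)).card ≤ k l

/-! ### Online algorithms with free disposal -/

/-- `out z h` is the set held, with random seed `z`, after the (distinct) elements of the list `h`
have arrived in this order.  In every round some elements are dropped and the arriving element
is possibly inserted; the set held is always independent. -/
structure IsRandomizedOnlineAlgorithm {Ω ι Z : Type*} [MeasurableSpace Z]
    (part : Ω → ι) (k : ι → ℕ) (out : Z → List Ω → Finset Ω) : Prop where
  init : ∀ z, out z [] = ∅
  step : ∀ z h u, (h ++ [u]).Nodup → out z (h ++ [u]) ⊆ insert u (out z h)
  indep : ∀ z h, h.Nodup → Indep part k (out z h)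
  measurable : ∀ h, h.Nodup → ∀ X, MeasurableSet {z | out z h = X}

/-- Competitive ratio `r` against an arrival sequence that is fixed before the seed is drawn. -/
def HasCompetitiveRatio {Ω ι Z : Type*} [MeasurableSpace Z] (f : Finset Ω → ℝ)
    (part : Ω → ι) (k : ι → ℕ) (μ : MeasureTheory.Measure Z)
    (out : Z → List Ω → Finset Ω) (r : ℝ) : Prop :=
  ∀ h : List Ω, h.Nodup → ∀ O : Finset Ω, O ⊆ h.toFinset → Indep part k O →
    r * f O ≤ ∫ z, f (out z h) ∂μ

/-! ### The continuous relaxation -/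

/-- `f̂(S) = E[f(R(S))]`, where `R(S)` contains each `u` independently
with probability `1 - exp(-S_u)`. -/
def fhat {Ω : Type*} (f : Finset Ω → ℝ) (S : Ω →₀ ℝ) : ℝ :=
  ∑ R ∈ S.support.powerset,
    (∏ u ∈ R, (1 - Real.exp (-S u))) * (∏ u ∈ S.support \ R, Real.exp (-S u)) * f R

/-- `f̂(u | B) = lim_{t → 0⁺} (f̂(B ⊕ (u,[t])) - f̂(B)) / t`. -/
def marginal {Ω : Type*} (f : Finset Ω → ℝ) (u : Ω) (B : Ω →₀ ℝ) : ℝ :=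
  derivWithin (fun t : ℝ => fhat f (B + Finsupp.single u t)) (Set.Ici 0) 0

/-- `‖S|_{Ω_l}‖`, the amount of part `l` in `S`. -/
def mass {Ω ι : Type*} (part : Ω → ι) (l : ι) (S : Ω →₀ ℝ) : ℝ :=
  ∑ u ∈ S.support.filter (fun u => part u = l), S u

/-- `w(B|_{Ω_l}) = ∫_{B|_{Ω_l}} w(z) dz`, where `B` stands for the set of pairs
`{(u,t) | 0 < t ≤ B u}`. -/
def weight {Ω ι : Type*} (part : Ω → ι) (l : ι) (w : Ω → ℝ → ℝ) (B : Ω →₀ ℝ) : ℝ :=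
  ∑ u ∈ B.support.filter (fun u => part u = l), ∫ t in (0 : ℝ)..(B u), w u t

/-- The set `T = {v ∈ Ω_l | (v, S_v) ∈ argmin_{z ∈ S|_{Ω_l}} w(z)}`. -/
def argminSet {Ω ι : Type*} (part : Ω → ι) (l : ι) (w : Ω → ℝ → ℝ) (S : Ω →₀ ℝ) : Finset Ω :=
  S.support.filter (fun v => part v = l ∧ 0 < S v ∧
    ∀ x τ, part x = l → 0 < τ → τ ≤ S x → w v (S v) ≤ w x τ)

/-- `d S_v / d t` for an element `v` other than the arriving one, which belongs to part `l`: zero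
until part `l` is full, and then `-η_v⁻¹ / ∑_{s ∈ T} η_s⁻¹` on `T`, where `η_v = |w_v'(S_v)|`. -/
def rate {Ω ι : Type*} (part : Ω → ι) (k : ι → ℕ) (l : ι) (w : Ω → ℝ → ℝ) (S : Ω →₀ ℝ)
    (v : Ω) : ℝ :=
  if mass part l S = k l ∧ v ∈ argminSet part l w S then
    -(|deriv (w v) (S v)|⁻¹ / ∑ s ∈ argminSet part l w S, |deriv (w s) (S s)|⁻¹)
  else 0

/-- The state of the continuous algorithm: the fractional solution `S`, the vector `A` of all the
pairs ever included, and the values `w v τ` of the pairs `(v, τ) ∈ A`. -/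
structure State (Ω : Type*) where
  S : Ω →₀ ℝ
  A : Ω →₀ ℝ
  w : Ω → ℝ → ℝ

/-- The value function during and after the round of `u`: the pair `(u, τ)` has the marginal
value of `u` at the moment at which `A_u = τ`; the values of earlier pairs are kept. -/
def State.value {Ω : Type*} (f : Finset Ω → ℝ) (σ : State Ω) (u : Ω) : Ω → ℝ → ℝ :=
  Function.update σ.w u (fun τ => marginal f u (σ.A + Finsupp.single u τ))

/-- The condition of the while loop in the round of `u`, when `S_u = A_u = t` and the current
fractional solution is `S`. -/
def Accepts {Ω ι : Type*} (f : Finset Ω → ℝ) (part : Ω → ι) (k : ι → ℕ) (α : ℝ)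
    (σ : State Ω) (u : Ω) (S : Ω →₀ ℝ) (t : ℝ) : Prop :=
  1 / (k (part u) : ℝ) *
      (α * weight part (part u) (σ.value f u) S
        - weight part (part u) (σ.value f u) (σ.A + Finsupp.single u t))
    < σ.value f u u t

/-- The evolution `t ↦ s t` of the fractional solution in the round of `u`, which starts in the
state `σ` and stops when `S_u = d`.  The clock is `t = S_u`. -/
structure RoundPath {Ω ι : Type*} (f : Finset Ω → ℝ) (part : Ω → ι) (k : ι → ℕ) (α : ℝ)
    (σ : State Ω) (u : Ω) (d : ℝ) (s : ℝ → Ω →₀ ℝ) : Prop where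
  length_nonneg : 0 ≤ d
  start : s 0 = σ.S
  clock : ∀ t ∈ Set.Icc 0 d, s t u = t
  nonneg : ∀ t ∈ Set.Icc 0 d, ∀ v, 0 ≤ s t v
  feasible : ∀ t ∈ Set.Icc 0 d, ∀ l, mass part l (s t) ≤ k l
  continuous : ∀ v, ContinuousOn (fun t => s t v) (Set.Icc 0 d)
  accepts : ∀ t ∈ Set.Ico 0 d, Accepts f part k α σ u (s t) t
  stops : ¬ Accepts f part k α σ u (s d) d
  evolves : ∀ t ∈ Set.Ico 0 d, ∀ v, v ≠ u →
    HasDerivWithinAt (fun x => s x v) (rate part k (part u) (σ.value f u) (s t) v) (Set.Ici t) t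

/-- One round of the continuous algorithm: `u` arrives in state `σ`, and `σ'` is the state at the
end of the round. -/
def Round {Ω ι : Type*} (f : Finset Ω → ℝ) (part : Ω → ι) (k : ι → ℕ) (α : ℝ)
    (σ : State Ω) (u : Ω) (σ' : State Ω) : Prop :=
  ∃ d s, RoundPath f part k α σ u d s ∧
    σ' = ⟨s d, σ.A + Finsupp.single u d, σ.value f u⟩

/-- `C h` is the state of the continuous algorithm after the elements of `h` have arrived. -/
structure IsContinuousRun {Ω ι : Type*} (f : Finset Ω → ℝ) (part : Ω → ι) (k : ι → ℕ) (α : ℝ)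
    (C : List Ω → State Ω) : Prop where
  init : C [] = ⟨0, 0, fun _ _ => 0⟩
  round : ∀ h u, (h ++ [u]).Nodup → Round f part k α (C h) u (C (h ++ [u]))

/-! ### Online rounding -/

/-- The pairs `(u,t)` of `S` (that is, `0 < t ≤ S u`) are stored in the knapsack
`⋃_l {l} × (0, k_l]`, the pair `(u,t)` at the point `φ(u,t) = (part u, pos u t)`: the map `φ` is
injective on `S` and preserves measure.  (`S` has finite support and `φ` is injective, so it
is enough to measure the subsets of each `{u} × (0, S u]`.) -/
structure IsStored {Ω ι : Type*} (part : Ω → ι) (k : ι → ℕ) (S : Ω →₀ ℝ)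
    (pos : Ω → ℝ → ℝ) : Prop where
  mem : ∀ u, ∀ t ∈ Set.Ioc 0 (S u), pos u t ∈ Set.Ioc 0 (k (part u) : ℝ)
  injective : ∀ u v, part u = part v → ∀ t ∈ Set.Ioc 0 (S u), ∀ τ ∈ Set.Ioc 0 (S v),
    pos u t = pos v τ → u = v ∧ t = τ
  measure : ∀ u, ∀ B ⊆ Set.Ioc 0 (S u), MeasurableSet B →
    MeasurableSet (pos u '' B) ∧ MeasureTheory.volume (pos u '' B) = MeasureTheory.volume B

/-- `pos h` describes the knapsack at the end of the last round of the history `h`; a pair that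
stays in the fractional solution keeps its point. -/
structure IsKnapsackRun {Ω ι : Type*} (part : Ω → ι) (k : ι → ℕ) (C : List Ω → State Ω)
    (pos : List Ω → Ω → ℝ → ℝ) : Prop where
  stored : ∀ h, h.Nodup → IsStored part k (C h).S (pos h)
  keep : ∀ h u, (h ++ [u]).Nodup → ∀ v, v ≠ u → ∀ t ∈ Set.Ioc 0 ((C (h ++ [u])).S v),
    pos (h ++ [u]) v t = pos h v t

/-- The seed: for each part `l`, `k l` independent uniformly random points of `(0, k l]`. -/
def seedMeasure {ι : Type*} [Fintype ι] (k : ι → ℕ) :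
    MeasureTheory.Measure ((Σ l, Fin (k l)) → ℝ) :=
  MeasureTheory.Measure.pi (fun p : Σ l, Fin (k l) =>
    ProbabilityTheory.cond MeasureTheory.volume (Set.Ioc 0 (k p.1 : ℝ)))

/-- The rounded set `S̃ = {u | ∃ t, (u,t) ∈ S ∧ φ(u,t) ∈ 𝒵}`, where `𝒵` is the set of the points
`(l, z ⟨l, i⟩)`. -/
def rounded {Ω ι : Type*} (part : Ω → ι) (k : ι → ℕ) (S : Ω →₀ ℝ) (pos : Ω → ℝ → ℝ)
    (z : (Σ l, Fin (k l)) → ℝ) : Finset Ω :=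
  S.support.filter (fun u => ∃ t ∈ Set.Ioc 0 (S u), ∃ i : Fin (k (part u)),
    pos u t = z ⟨part u, i⟩)

end OnlineSubmodular

end

noncomputable section

namespace OnlineSubmodular

/-! ### The constant -/

/-! Adding a rate t at u multiplies the expected gain of u by exp (-t), so the values created in a
round are w(u,τ) = c_u exp (-τ), where c_u is the marginal of u at the start of the round. All
weights are therefore explicit.

The analysis of one part of capacity κ rests on a potential. Let a = α - 2, let N(θ) be the fraction
of the capacity occupied by pairs of S of value more than θ, and put Φ = ∫ (exp (a N(θ)) - 1) / a
dθ. The claim is Φ ≤ (α w(S) - w(A)) / κ at all times; the right side is the acceptance threshold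
(`Flow.potential_le`). It suffices to compare derivatives when the two sides touch. Acceptance then
gives Φ < w_u, with w_u the value of the pair being inserted. Inserting raises κΦ at rate at most
∫₀^{w_u} exp (a N) ≤ w_u + aΦ, which is less than (α - 1) w_u, the rate at which α w(S) - w(A) grows
while nothing is dropped. In a full part N = 1 below the smallest value m, so dropping lowers the
bound on the rate of κΦ by m exp a and the rate of α w(S) by α m. These cancel because α = exp (α -
2) (`IsVelocity.bounds`). The same estimates show that the threshold never decreases
(`Flow.worth_mono`), so the stopping condition of an old element persists.

The ratio follows by charging (`Invariant.le_mul_fhat`). Submodularity bounds f(O) by f̂(A) plus the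
marginals of O at A. Each marginal is at most the threshold of its part, and a part contains at most
k_l elements of O, so these sum to at most α w(S) - w(A). Since f̂(A) = f(∅) + w(A) and f̂(S) ≥ f(∅)
+ w(S), the weight of A cancels and α f̂(S) remains.

For the rounding, each of the k_l random points selects at most one element, u with probability S_u
/ k_l. One such disjoint draw is worth at least an independent draw with the same rates
(`IsMonotoneSubmodular.mean_le_sum`), and replacing the draws one point at a time gives f̂(S)
(`mean_le_integral_hits`).

A run exists because the prescribed drops amount to raising a water level: all pairs of smallest
value have the same η, so they shrink equally fast (`exists_drain_path`). The round ends before u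
alone exceeds the part. The knapsack is filled through a generalized inverse of the length function
of the free region (`exists_packing`). -/

lemma ratio_root_unique {x y : ℝ} (hx : 1 < x) (hxe : x = Real.exp (x - 2)) (hxy : x < y)
    (hye : y = Real.exp (y - 2)) : False := by
  have hy0 : y - 1 ≠ 0 := by linarith
  -- The graph of exp (· - 2) is strictly below the diagonal at 1 and on it at y. Strict convexity
  -- puts it strictly below the diagonal at x, which lies between them.
  have h := strictConvexOn_exp.2 (Set.mem_univ (1 - 2 : ℝ)) (Set.mem_univ (y - 2))
    (fun e => by linarith) (show 0 < (y - x) / (y - 1) from div_pos (by linarith) (by linarith))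
    (show 0 < (x - 1) / (y - 1) from div_pos (by linarith) (by linarith))
    (by field_simp; ring)
  have h0 : Real.exp (1 - 2) < 1 := by rw [Real.exp_lt_one_iff]; norm_num
  simp only [smul_eq_mul, ← hye] at h
  have e : (y - x) / (y - 1) * (1 - 2) + (x - 1) / (y - 1) * (y - 2) = x - 2 := by
    field_simp; ring
  rw [e, ← hxe] at h
  have h2 : (y - x) / (y - 1) * Real.exp (1 - 2) ≤ (y - x) / (y - 1) * 1 :=
    mul_le_mul_of_nonneg_left h0.le (div_nonneg (by linarith) (by linarith))
  have e2 : (y - x) / (y - 1) * 1 + (x - 1) / (y - 1) * y = x := by field_simp; ring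
  linarith

/-- The ends are dictated by the accuracy claimed for 1/α: 1/3.14614 < 0.31785 and 1/3.147 >
0.31775. A factor exp 1 is split off so that the Taylor bounds are applied at a small argument. -/
lemma exists_ratio_root :
    ∃ α : ℝ, 3.14614 < α ∧ α < 3.147 ∧ α = Real.exp (α - 2) := by
  have hlow : Real.exp (3.14614 - 2) < 3.14614 := by
    have h1 := Real.exp_bound' (x := 0.14614) (by norm_num) (by norm_num) (n := 6) (by norm_num)
    have h2 := Real.exp_one_lt_d9
    have h3 : Real.exp (3.14614 - 2) = Real.exp 1 * Real.exp 0.14614 := by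
      rw [← Real.exp_add]; norm_num
    have h4 : Real.exp 0.14614 < 1.15736 := by
      refine h1.trans_lt ?_
      norm_num [Finset.sum_range_succ, Nat.factorial]
    rw [h3]
    nlinarith [Real.exp_pos 1, Real.exp_pos 0.14614]
  have hhigh : 3.147 < Real.exp (3.147 - 2) := by
    have h1 := Real.sum_le_exp_of_nonneg (x := 0.147) (by norm_num) 6
    have h2 := Real.exp_one_gt_d9
    have h3 : Real.exp (3.147 - 2) = Real.exp 1 * Real.exp 0.147 := by
      rw [← Real.exp_add]; norm_num
    have h4 : 1.15834 < Real.exp 0.147 := by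
      refine lt_of_lt_of_le ?_ h1
      norm_num [Finset.sum_range_succ, Nat.factorial]
    rw [h3]
    nlinarith [Real.exp_pos 1, Real.exp_pos 0.147]
  have hc : ContinuousOn (fun x : ℝ => Real.exp (x - 2) - x) (Set.Icc 3.14614 3.147) := by fun_prop
  obtain ⟨α, ⟨h1, h2⟩, h3⟩ := intermediate_value_Ioo (by norm_num) hc
    (show (0 : ℝ) ∈ Set.Ioo _ _ from ⟨by linarith, by linarith⟩)
  exact ⟨α, h1, h2, by simp only at h3; linarith⟩

end OnlineSubmodular

end

noncomputable section

namespace OnlineSubmodular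

/-! ### The multilinear extension -/

variable {Ω : Type*}

/-- `E[g(R)]`, where `R` contains each `u ∈ U` independently with probability `1 - exp(-x u)`. -/
def mean (U : Finset Ω) (x : Ω → ℝ) (g : Finset Ω → ℝ) : ℝ :=
  ∑ R ∈ U.powerset,
    (∏ u ∈ R, (1 - Real.exp (-x u))) * (∏ u ∈ U \ R, Real.exp (-x u)) * g R

/-- The marginal value of `u` as a set function. -/
def gain (g : Finset Ω → ℝ) (u : Ω) (R : Finset Ω) : ℝ := g (insert u R) - g R

lemma mean_insert {U : Finset Ω} {a : Ω} (ha : a ∉ U) (x : Ω → ℝ) (g : Finset Ω → ℝ) :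
    mean (insert a U) x g = Real.exp (-x a) * mean U x g
      + (1 - Real.exp (-x a)) * mean U x (fun R => g (insert a R)) := by
  unfold mean
  rw [Finset.sum_powerset_insert ha, Finset.mul_sum, Finset.mul_sum]
  congr 1
  · refine Finset.sum_congr rfl fun R hR => ?_
    have haR : a ∉ R := fun h => ha (Finset.mem_powerset.1 hR h)
    rw [Finset.insert_sdiff_of_notMem _ haR, Finset.prod_insert (by simp [ha])]
    ring
  · refine Finset.sum_congr rfl fun R hR => ?_
    have haR : a ∉ R := fun h => ha (Finset.mem_powerset.1 hR h)
    rw [Finset.insert_sdiff_insert, Finset.prod_insert haR, Finset.sdiff_insert_of_notMem ha]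
    ring

lemma mean_congr {U : Finset Ω} {x y : Ω → ℝ} {g g' : Finset Ω → ℝ} (h : ∀ u ∈ U, x u = y u)
    (hg : ∀ R ⊆ U, g R = g' R) : mean U x g = mean U y g' := by
  refine Finset.sum_congr rfl fun R hR => ?_
  have hR' := Finset.mem_powerset.1 hR
  have e1 : ∏ u ∈ R, (1 - Real.exp (-x u)) = ∏ u ∈ R, (1 - Real.exp (-y u)) :=
    Finset.prod_congr rfl fun u hu => by rw [h u (hR' hu)]
  have e2 : ∏ u ∈ U \ R, Real.exp (-x u) = ∏ u ∈ U \ R, Real.exp (-y u) :=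
    Finset.prod_congr rfl fun u hu => by rw [h u (Finset.sdiff_subset hu)]
  rw [hg R hR', e1, e2]

lemma mean_add (U : Finset Ω) (x : Ω → ℝ) (g g' : Finset Ω → ℝ) :
    mean U x (fun R => g R + g' R) = mean U x g + mean U x g' := by
  simp only [mean, mul_add, Finset.sum_add_distrib]

lemma mean_sub (U : Finset Ω) (x : Ω → ℝ) (g g' : Finset Ω → ℝ) :
    mean U x (fun R => g R - g' R) = mean U x g - mean U x g' := by
  simp only [mean, mul_sub, Finset.sum_sub_distrib]

lemma mean_mul_left (U : Finset Ω) (x : Ω → ℝ) (a : ℝ) (g : Finset Ω → ℝ) :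
    mean U x (fun R => a * g R) = a * mean U x g := by
  simp only [mean, Finset.mul_sum]
  exact Finset.sum_congr rfl fun R _ => by ring

lemma mean_sum {κ : Type*} (U : Finset Ω) (x : Ω → ℝ) (s : Finset κ) (g : κ → Finset Ω → ℝ) :
    mean U x (fun R => ∑ i ∈ s, g i R) = ∑ i ∈ s, mean U x (g i) := by
  simp only [mean, Finset.mul_sum]
  exact Finset.sum_comm

lemma mean_const (U : Finset Ω) (x : Ω → ℝ) (a : ℝ) : mean U x (fun _ => a) = a := by
  induction U using Finset.induction_on with
  | empty => simp [mean]
  | insert b U hb ih => rw [mean_insert hb, ih]; ring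

lemma mean_mono {U : Finset Ω} {x : Ω → ℝ} (hx : ∀ u ∈ U, 0 ≤ x u) {g g' : Finset Ω → ℝ}
    (hg : ∀ R ⊆ U, g R ≤ g' R) : mean U x g ≤ mean U x g' := by
  refine Finset.sum_le_sum fun R hR => ?_
  have hR' := Finset.mem_powerset.1 hR
  refine mul_le_mul_of_nonneg_left (hg R hR') (mul_nonneg (Finset.prod_nonneg fun u hu => ?_)
    (Finset.prod_nonneg fun u _ => (Real.exp_pos _).le))
  have := hx u (hR' hu)
  rw [sub_nonneg, Real.exp_le_one_iff]
  linarith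

/-- Raising the rate of `a` moves probability from g to R ↦ g (insert a R), which is smaller. -/
lemma mean_anti {U : Finset Ω} {x y : Ω → ℝ} (hx : ∀ u ∈ U, 0 ≤ x u) (hxy : ∀ u ∈ U, x u ≤ y u)
    {g : Finset Ω → ℝ} (hg : Antitone g) : mean U y g ≤ mean U x g := by
  induction U using Finset.induction_on generalizing g with
  | empty => simp [mean]
  | insert a U ha ih =>
    have hx' : ∀ u ∈ U, 0 ≤ x u := fun u hu => hx u (Finset.mem_insert_of_mem hu)
    have hxy' : ∀ u ∈ U, x u ≤ y u := fun u hu => hxy u (Finset.mem_insert_of_mem hu)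
    rw [mean_insert ha, mean_insert ha]
    have h1 := ih hx' hxy' hg
    have hga : Antitone fun R => g (insert a R) := fun R R' h => hg (Finset.insert_subset_insert a h)
    have h2 := ih hx' hxy' hga
    have h3 : mean U x (fun R => g (insert a R)) ≤ mean U x g :=
      mean_mono hx' fun R _ => hg (Finset.subset_insert a R)
    have hxa := hx a (Finset.mem_insert_self a U)
    have hxya := hxy a (Finset.mem_insert_self a U)
    have e1 : Real.exp (-y a) ≤ Real.exp (-x a) := Real.exp_le_exp.2 (by linarith)
    have e2 : Real.exp (-x a) ≤ 1 := Real.exp_le_one_iff.2 (by linarith)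
    have e3 := Real.exp_pos (-y a)
    nlinarith [mul_le_mul_of_nonneg_left h1 e3.le,
      mul_le_mul_of_nonneg_left h2 (show 0 ≤ 1 - Real.exp (-y a) by linarith),
      mul_nonneg (sub_nonneg.2 e1) (sub_nonneg.2 h3)]

/-- Sampling twice is sampling with the sum of the rates. -/
lemma mean_mean_union (U : Finset Ω) (x y : Ω → ℝ) (g : Finset Ω → ℝ) :
    mean U x (fun B => mean U y (fun R => g (B ∪ R))) = mean U (fun u => x u + y u) g := by
  induction U using Finset.induction_on generalizing g with
  | empty => simp [mean]
  | insert a U ha ih =>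
    simp only [mean_insert ha, mean_add, mean_mul_left, Finset.insert_union, Finset.union_insert,
      Finset.insert_idem]
    rw [ih g, ih (fun R => g (insert a R)), neg_add, Real.exp_add]
    ring

/-- Elements of rate zero are never sampled, so the ground set may be enlarged at will. This lets
vectors with different supports be compared over a common set. -/
lemma fhat_eq_mean {f : Finset Ω → ℝ} {S : Ω →₀ ℝ} {U : Finset Ω} (h : S.support ⊆ U) :
    fhat f S = mean U S f := by
  have key : ∀ W : Finset Ω, Disjoint W S.support → mean (W ∪ S.support) S f = fhat f S := by
    intro W
    induction W using Finset.induction_on with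
    | empty => intro _; simp [mean, fhat]
    | insert a W ha ih =>
      intro hW
      rw [Finset.disjoint_insert_left] at hW
      rw [Finset.insert_union, mean_insert (by simp [ha, hW.1]), ih hW.2,
        Finsupp.notMem_support_iff.1 hW.1]
      simp
  rw [← key (U \ S.support) Finset.sdiff_disjoint, Finset.sdiff_union_of_subset h]

/-- The extra rate t acts as an additional independent trial that includes u with probability 1 -
exp (-t). -/
lemma fhat_add_single (g : Finset Ω → ℝ) (B : Ω →₀ ℝ) (u : Ω) (t : ℝ) :
    fhat g (B + Finsupp.single u t) = Real.exp (-t) * fhat g B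
      + (1 - Real.exp (-t)) * fhat (fun R => g (insert u R)) B := by
  set U := B.support.erase u
  have hu : u ∉ U := Finset.notMem_erase u _
  have hB : B.support ⊆ insert u U := fun v hv => by
    by_cases h : v = u <;> simp [U, h, Finsupp.mem_support_iff.1 hv]
  have hB' : (B + Finsupp.single u t).support ⊆ insert u U :=
    Finsupp.support_add.trans (Finset.union_subset hB
      (Finsupp.support_single_subset.trans (by simp)))
  have hcg : ∀ g' : Finset Ω → ℝ, mean U ⇑(B + Finsupp.single u t) g' = mean U B g' := fun g' =>
    mean_congr (fun v hv => by
      have : u ≠ v := fun h => hu (h ▸ hv)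
      simp [this]) fun _ _ => rfl
  rw [fhat_eq_mean hB', fhat_eq_mean hB, fhat_eq_mean hB, mean_insert hu, mean_insert hu,
    mean_insert hu, hcg, hcg]
  simp only [Finset.insert_idem, Finsupp.add_apply, Finsupp.single_eq_same, neg_add, Real.exp_add]
  ring

lemma fhat_sub (g g' : Finset Ω → ℝ) (B : Ω →₀ ℝ) :
    fhat (fun R => g R - g' R) B = fhat g B - fhat g' B :=
  mean_sub _ _ g g'

lemma fhat_add_single_gain (g : Finset Ω → ℝ) (B : Ω →₀ ℝ) (u : Ω) (t : ℝ) :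
    fhat g (B + Finsupp.single u t) = fhat g B + (1 - Real.exp (-t)) * fhat (gain g u) B := by
  rw [fhat_add_single]
  unfold gain
  rw [fhat_sub]
  ring

/-- The gain of u vanishes once u is present, so only the event that the extra trial fails
contributes. -/
lemma fhat_gain_add_single (g : Finset Ω → ℝ) (B : Ω →₀ ℝ) (u : Ω) (t : ℝ) :
    fhat (gain g u) (B + Finsupp.single u t) = Real.exp (-t) * fhat (gain g u) B := by
  rw [fhat_add_single]
  have : (fun R => gain g u (insert u R)) = fun _ => 0 := by
    funext R; simp [gain]
  rw [this]
  simp [fhat]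

lemma marginal_eq (f : Finset Ω → ℝ) (u : Ω) (B : Ω →₀ ℝ) :
    marginal f u B = fhat (gain f u) B := by
  unfold marginal
  have h : HasDerivAt (fun t : ℝ => fhat f (B + Finsupp.single u t)) (fhat (gain f u) B) 0 := by
    simp only [fhat_add_single_gain]
    have := ((((hasDerivAt_neg (0 : ℝ)).exp).const_sub 1).mul_const
      (fhat (gain f u) B)).const_add (fhat f B)
    simpa using this
  exact h.hasDerivWithinAt.derivWithin (uniqueDiffOn_Ici 0 0 Set.self_mem_Ici)

/-- This is the explicit form c · exp (-τ) of all values, on which the potential and the draining of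
a part are built. -/
lemma marginal_add_single (f : Finset Ω → ℝ) (u : Ω) (B : Ω →₀ ℝ) (t : ℝ) :
    marginal f u (B + Finsupp.single u t) = fhat (gain f u) B * Real.exp (-t) := by
  rw [marginal_eq, fhat_gain_add_single, mul_comm]

lemma fhat_congr {f g : Finset Ω → ℝ} {S : Ω →₀ ℝ} (h : ∀ R ⊆ S.support, f R = g R) :
    fhat f S = fhat g S :=
  mean_congr (fun _ _ => rfl) h

lemma fhat_zero (f : Finset Ω → ℝ) : fhat f 0 = f ∅ := by simp [fhat]

lemma fhat_anti {g : Finset Ω → ℝ} (hg : Antitone g) {S A : Ω →₀ ℝ} (h0 : ∀ v, 0 ≤ S v)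
    (h : ∀ v, S v ≤ A v) : fhat g A ≤ fhat g S := by
  rw [fhat_eq_mean (U := S.support ∪ A.support) Finset.subset_union_left,
    fhat_eq_mean (U := S.support ∪ A.support) Finset.subset_union_right]
  exact mean_anti (fun u _ => h0 u) (fun u _ => h u) hg

/-! ### Consequences of submodularity for sampled sets -/

namespace IsMonotoneSubmodular

variable {f : Finset Ω → ℝ}

lemma gain_nonneg (hf : IsMonotoneSubmodular f) (u : Ω) (R : Finset Ω) : 0 ≤ gain f u R :=
  sub_nonneg.2 (hf.mono _ _ (Finset.subset_insert u R))

lemma gain_antitone (hf : IsMonotoneSubmodular f) (u : Ω) : Antitone (gain f u) := by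
  intro R R' h
  by_cases hu : u ∈ R'
  · rw [gain, Finset.insert_eq_self.2 hu, sub_self]
    exact hf.gain_nonneg u R
  · have := hf.submodular (insert u R) R'
    have e1 : insert u R ∪ R' = insert u R' := by
      rw [Finset.insert_union, Finset.union_eq_right.2 h]
    have e2 : insert u R ∩ R' = R := by
      rw [Finset.insert_inter_of_notMem hu, Finset.inter_eq_left.2 h]
    rw [e1, e2] at this
    unfold gain
    linarith

lemma union_le (hf : IsMonotoneSubmodular f) (R O : Finset Ω) :
    f (R ∪ O) ≤ f R + ∑ u ∈ O, gain f u R := by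
  induction O using Finset.induction_on with
  | empty => simp
  | insert a O ha ih =>
    rw [Finset.sum_insert ha, Finset.union_insert]
    have := hf.gain_antitone a (Finset.subset_union_left : R ⊆ R ∪ O)
    simp only [gain] at this ih ⊢
    linarith

lemma fhat_gain_nonneg (hf : IsMonotoneSubmodular f) (u : Ω) {B : Ω →₀ ℝ} (hB : ∀ v, 0 ≤ B v) :
    0 ≤ fhat (gain f u) B := by
  have := mean_mono (U := B.support) (x := B) (g := fun _ => 0) (fun v _ => hB v)
    (fun R _ => hf.gain_nonneg u R)
  rwa [mean_const] at this

/-- The value of any set is bounded by the value of a fractional solution and the marginals. -/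
lemma le_fhat_add (hf : IsMonotoneSubmodular f) {B : Ω →₀ ℝ} (hB : ∀ v, 0 ≤ B v) (O : Finset Ω) :
    f O ≤ fhat f B + ∑ u ∈ O, fhat (gain f u) B := by
  have h1 : mean B.support B (fun _ => f O)
      ≤ mean B.support B (fun R => f R + ∑ u ∈ O, gain f u R) :=
    mean_mono (fun v _ => hB v) fun R _ =>
      (hf.mono _ _ Finset.subset_union_right).trans (hf.union_le R O)
  rw [mean_const, mean_add, mean_sum] at h1
  exact h1

/-- In `mean_le_integral_hits` the induction hypothesis is applied to these functions, and the
averaged ones of `mean_union` are compared with disjoint sampling. Both must stay in the class. -/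
lemma union_left (hf : IsMonotoneSubmodular f) (B : Finset Ω) :
    IsMonotoneSubmodular fun R => f (B ∪ R) where
  nonneg X := hf.nonneg _
  mono X Y h := hf.mono _ _ (Finset.union_subset_union_right h)
  submodular X Y := by
    have := hf.submodular (B ∪ X) (B ∪ Y)
    rwa [← Finset.union_union_distrib_left, ← Finset.union_inter_distrib_left] at this

lemma mean_union (hf : IsMonotoneSubmodular f) (U : Finset Ω) {y : Ω → ℝ} (hy : ∀ u ∈ U, 0 ≤ y u) :
    IsMonotoneSubmodular fun B => mean U y (fun R => f (B ∪ R)) where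
  nonneg X := by
    rw [← mean_const U y 0]
    exact mean_mono hy fun R _ => hf.nonneg _
  mono X Y h := mean_mono hy fun R _ => hf.mono _ _ (Finset.union_subset_union_left h)
  submodular X Y := by
    rw [← mean_add, ← mean_add]
    refine mean_mono hy fun R _ => ?_
    have := hf.submodular (X ∪ R) (Y ∪ R)
    rwa [← Finset.union_union_distrib_right, ← Finset.inter_union_distrib_right] at this

/-- Independent sampling is worth at most what disjoint sampling with the same rates is. -/
lemma mean_le_sum (hf : IsMonotoneSubmodular f) {U : Finset Ω} {x : Ω → ℝ}
    (hx : ∀ u ∈ U, 0 ≤ x u) : mean U x f ≤ f ∅ + ∑ u ∈ U, x u * (f {u} - f ∅) := by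
  induction U using Finset.induction_on with
  | empty => simp [mean]
  | insert a U ha ih =>
    have hx' : ∀ u ∈ U, 0 ≤ x u := fun u hu => hx u (Finset.mem_insert_of_mem hu)
    rw [mean_insert ha, Finset.sum_insert ha]
    have h1 := ih hx'
    have h2 : mean U x (fun R => f (insert a R)) - mean U x f ≤ f {a} - f ∅ := by
      rw [← mean_sub]
      refine (mean_mono hx' (g' := fun _ => f {a} - f ∅) fun R _ => ?_).trans_eq (mean_const U x _)
      simpa [gain] using hf.gain_antitone a (Finset.empty_subset R)
    have h3 : 0 ≤ f {a} - f ∅ := sub_nonneg.2 (hf.mono _ _ (Finset.empty_subset _))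
    -- That is, 1 - exp (-x a) ≤ x a.
    have h4 := Real.add_one_le_exp (-x a)
    have h5 : Real.exp (-x a) ≤ 1 :=
      Real.exp_le_one_iff.2 (by linarith [hx a (Finset.mem_insert_self a U)])
    nlinarith [mul_le_mul_of_nonneg_left h2 (sub_nonneg.2 h5)]

end IsMonotoneSubmodular

end OnlineSubmodular

end

noncomputable section

namespace OnlineSubmodular

/-! ### The potential of a part

For `w v τ = c v * exp (-τ)`, the number `layer (c v) (x v) θ` is the length of
`{τ ∈ (0, x v] | θ < w v τ}`, and `potential` is a Choquet integral of `w` over the pairs of `x`. -/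

variable {Ω : Type*}

/-- The length of `{τ ∈ (0, x] | θ < c * exp (-τ)}`. -/
def layer (c x θ : ℝ) : ℝ := Real.log c - Real.log (min c (max θ (c * Real.exp (-x))))

/-- Both logarithms are taken at 0 and cancel, so elements of value zero contribute nothing,
whatever their amount. -/
lemma layer_of_zero (x θ : ℝ) : layer 0 x θ = 0 := by
  simp only [layer, zero_mul]
  rw [min_eq_left (le_max_right _ _), sub_self]

lemma layer_zero (c θ : ℝ) : layer c 0 θ = 0 := by
  simp only [layer, neg_zero, Real.exp_zero, mul_one]
  rw [min_eq_left (le_max_right _ _), sub_self]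

lemma layer_of_le {c x θ : ℝ} (hc : 0 < c) (hx : 0 ≤ x) (h : θ ≤ c * Real.exp (-x)) :
    layer c x θ = x := by
  have h1 : c * Real.exp (-x) ≤ c :=
    mul_le_of_le_one_right hc.le (Real.exp_le_one_iff.2 (by linarith))
  rw [layer, max_eq_right h, min_eq_right h1, Real.log_mul hc.ne' (Real.exp_pos _).ne',
    Real.log_exp]
  ring

lemma layer_arg_pos {c x : ℝ} (hc : 0 < c) (θ : ℝ) :
    0 < min c (max θ (c * Real.exp (-x))) :=
  lt_min hc (lt_max_of_lt_right (by positivity))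

lemma layer_nonneg {c : ℝ} (hc : 0 ≤ c) (x θ : ℝ) : 0 ≤ layer c x θ := by
  rcases hc.eq_or_lt with rfl | hc
  · rw [layer_of_zero]
  · exact sub_nonneg.2 (Real.log_le_log (layer_arg_pos hc θ) (min_le_left _ _))

lemma layer_le {c x : ℝ} (hc : 0 ≤ c) (hx : 0 ≤ x) (θ : ℝ) : layer c x θ ≤ x := by
  rcases hc.eq_or_lt with rfl | hc
  · rwa [layer_of_zero]
  · have h : layer c x θ ≤ layer c x (c * Real.exp (-x)) := by
      refine sub_le_sub_left (Real.log_le_log (layer_arg_pos hc _) (min_le_min_left c ?_)) _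
      rw [max_self]
      exact le_max_right _ _
    rwa [layer_of_le hc hx le_rfl] at h

/-- `layer c x θ` is concave in `x`. -/
lemma layer_sub_le {c x x' θ : ℝ} (hc : 0 ≤ c) (hx : 0 ≤ x) (hx' : 0 ≤ x') (hθ : 0 < θ) :
    layer c x' θ - layer c x θ
      ≤ (x' - x) * Set.indicator {y | y ≤ c * Real.exp (-x)} (fun _ => 1) θ := by
  rcases hc.eq_or_lt with rfl | hc
  · simp [layer_of_zero, hθ]
  · by_cases h : θ ≤ c * Real.exp (-x)
    · rw [layer_of_le hc hx h, Set.indicator_of_mem (by exact h), mul_one]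
      linarith [layer_le hc.le hx' θ]
    · rw [Set.indicator_of_notMem (by exact h), mul_zero, sub_nonpos]
      push Not at h
      refine sub_le_sub_left (Real.log_le_log (layer_arg_pos hc _) ?_) _
      exact min_le_min_left _ (by rw [max_eq_left h.le]; exact le_max_left _ _)

/-- The maximum with c · exp (-x) keeps the argument of the second logarithm positive, also for θ ≤
0. This gives joint continuity. -/
lemma continuous_layer {c : ℝ} (hc : 0 ≤ c) : Continuous fun p : ℝ × ℝ => layer c p.1 p.2 := by
  rcases hc.eq_or_lt with rfl | hc
  · simp only [layer_of_zero]
    exact continuous_const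
  · refine continuous_const.sub (Continuous.log (by fun_prop) fun p => ?_)
    exact (layer_arg_pos hc _).ne'

/-- The fraction of the capacity `κ` that the pairs of value more than `θ` occupy. -/
def level (κ : ℝ) (V : Finset Ω) (c x : Ω → ℝ) (θ : ℝ) : ℝ :=
  1 / κ * ∑ v ∈ V, layer (c v) (x v) θ

/-- `∫₀ᴹ (exp (a N(θ)) - 1) / a dθ`, where `N = level`. -/
def potential (a κ M : ℝ) (V : Finset Ω) (c x : Ω → ℝ) : ℝ :=
  ∫ θ in (0 : ℝ)..M, (Real.exp (a * level κ V c x θ) - 1) / a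

/-- `∫₀ʸ exp (a N(θ)) dθ`, where `N = level`. -/
def density (a κ : ℝ) (V : Finset Ω) (c x : Ω → ℝ) (y : ℝ) : ℝ :=
  ∫ θ in (0 : ℝ)..y, Real.exp (a * level κ V c x θ)

section

variable {a κ M : ℝ} {V : Finset Ω} {c x : Ω → ℝ}

lemma continuous_level_uncurry (hc : ∀ v ∈ V, 0 ≤ c v) :
    Continuous fun p : (Ω → ℝ) × ℝ => level κ V c p.1 p.2 := by
  refine continuous_const.mul (continuous_finsetSum _ fun v hv => ?_)
  exact (continuous_layer (hc v hv)).comp (f := fun p : (Ω → ℝ) × ℝ => (p.1 v, p.2))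
    (((continuous_apply v).comp continuous_fst).prodMk continuous_snd)

lemma continuous_level (hc : ∀ v ∈ V, 0 ≤ c v) : Continuous (level κ V c x) :=
  (continuous_level_uncurry hc).comp (continuous_const.prodMk continuous_id)

lemma continuous_potential (hc : ∀ v ∈ V, 0 ≤ c v) : Continuous (potential a κ M V c) := by
  refine intervalIntegral.continuous_parametric_intervalIntegral_of_continuous' ?_ 0 M
  have := continuous_level_uncurry (κ := κ) hc
  show Continuous fun p : (Ω → ℝ) × ℝ => (Real.exp (a * level κ V c p.1 p.2) - 1) / a
  fun_prop

lemma level_nonneg (hκ : 0 < κ) (hc : ∀ v ∈ V, 0 ≤ c v) (θ : ℝ) : 0 ≤ level κ V c x θ :=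
  mul_nonneg (by positivity) (Finset.sum_nonneg fun v hv => layer_nonneg (hc v hv) _ _)

lemma integrand_nonneg (ha : 0 < a) (hκ : 0 < κ) (hc : ∀ v ∈ V, 0 ≤ c v) (θ : ℝ) :
    0 ≤ (Real.exp (a * level κ V c x θ) - 1) / a := by
  have := level_nonneg (x := x) hκ hc θ
  exact div_nonneg (sub_nonneg.2 (Real.one_le_exp (by positivity))) ha.le

lemma continuous_integrand (hc : ∀ v ∈ V, 0 ≤ c v) :
    Continuous fun θ => (Real.exp (a * level κ V c x θ) - 1) / a := by
  have := continuous_level (κ := κ) (x := x) hc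
  fun_prop

lemma continuous_exp_level (hc : ∀ v ∈ V, 0 ≤ c v) :
    Continuous fun θ => Real.exp (a * level κ V c x θ) := by
  have := continuous_level (κ := κ) (x := x) hc
  fun_prop

lemma integral_le_potential (ha : 0 < a) (hκ : 0 < κ) (hc : ∀ v ∈ V, 0 ≤ c v) {y : ℝ}
    (hyM : y ≤ M) :
    ∫ θ in (0 : ℝ)..y, (Real.exp (a * level κ V c x θ) - 1) / a ≤ potential a κ M V c x := by
  have hcont := continuous_integrand (a := a) (κ := κ) (x := x) hc
  have := intervalIntegral.integral_add_adjacent_intervals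
    (hcont.intervalIntegrable (μ := MeasureTheory.volume) 0 y) (hcont.intervalIntegrable y M)
  rw [potential, ← this]
  linarith [intervalIntegral.integral_nonneg (μ := MeasureTheory.volume) hyM
    fun θ _ => integrand_nonneg (x := x) ha hκ hc θ]

/-- The integrand is 1 plus a times the nonnegative integrand of the potential. With a = α - 2 and
the potential less than y, the density at y is less than (α - 1) y. -/
lemma density_le (ha : 0 < a) (hκ : 0 < κ) (hc : ∀ v ∈ V, 0 ≤ c v) {y : ℝ}
    (hyM : y ≤ M) : density a κ V c x y ≤ y + a * potential a κ M V c x := by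
  have hcont := continuous_integrand (a := a) (κ := κ) (x := x) hc
  have e : density a κ V c x y
      = y + a * ∫ θ in (0 : ℝ)..y, (Real.exp (a * level κ V c x θ) - 1) / a := by
    rw [← intervalIntegral.integral_const_mul, density]
    have : ∀ θ, Real.exp (a * level κ V c x θ)
        = 1 + a * ((Real.exp (a * level κ V c x θ) - 1) / a) := fun θ => by field_simp; ring
    have hi : IntervalIntegrable (fun θ => a * ((Real.exp (a * level κ V c x θ) - 1) / a))
        MeasureTheory.volume 0 y := (hcont.intervalIntegrable 0 y).const_mul a
    rw [intervalIntegral.integral_congr fun θ _ => this θ, intervalIntegral.integral_add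
      (continuous_const.intervalIntegrable _ _) hi]
    simp
  rw [e]
  have := integral_le_potential (x := x) ha hκ hc hyM
  nlinarith

/-- Below the smallest value of a full part the level is `1`. -/
lemma level_eq_one (hκ : 0 < κ) (hc : ∀ v ∈ V, 0 ≤ c v) (hx : ∀ v ∈ V, 0 ≤ x v)
    (hfull : ∑ v ∈ V, x v = κ) {m θ : ℝ} (hm : ∀ v ∈ V, 0 < x v → m ≤ c v * Real.exp (-x v))
    (hθ : 0 < θ) (hθm : θ ≤ m) : level κ V c x θ = 1 := by
  have : ∑ v ∈ V, layer (c v) (x v) θ = κ := by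
    rw [← hfull]
    refine Finset.sum_congr rfl fun v hv => ?_
    rcases (hx v hv).eq_or_lt with h | h
    · rw [← h, layer_zero]
    · have h1 := hθm.trans (hm v hv h)
      have hcv : 0 < c v := by
        by_contra hn
        have : c v = 0 := le_antisymm (not_lt.1 hn) (hc v hv)
        rw [this, zero_mul] at h1
        linarith
      exact layer_of_le hcv h.le h1
  rw [level, this]
  field_simp

/-- With a = α - 2 and α = exp a the right side is α m, exactly the rate at which α w(S) falls when
pairs of value m are dropped. -/
lemma density_full (hκ : 0 < κ) (hc : ∀ v ∈ V, 0 ≤ c v) (hx : ∀ v ∈ V, 0 ≤ x v)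
    (hfull : ∑ v ∈ V, x v = κ) {m : ℝ} (hm0 : 0 ≤ m)
    (hm : ∀ v ∈ V, 0 < x v → m ≤ c v * Real.exp (-x v)) :
    density a κ V c x m = m * Real.exp a := by
  rw [density, intervalIntegral.integral_congr_Ioo_of_le (g := fun _ => Real.exp a) hm0
    fun θ hθ => by rw [level_eq_one hκ hc hx hfull hm hθ.1 hθ.2.le, mul_one]]
  simp

lemma le_potential_full (ha : 0 < a) (hκ : 0 < κ) (hc : ∀ v ∈ V, 0 ≤ c v)
    (hx : ∀ v ∈ V, 0 ≤ x v) (hfull : ∑ v ∈ V, x v = κ) {m : ℝ} (hm0 : 0 ≤ m) (hmM : m ≤ M)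
    (hm : ∀ v ∈ V, 0 < x v → m ≤ c v * Real.exp (-x v)) :
    m * ((Real.exp a - 1) / a) ≤ potential a κ M V c x := by
  refine le_trans (le_of_eq ?_) (integral_le_potential (x := x) ha hκ hc hmM)
  rw [intervalIntegral.integral_congr_Ioo_of_le (g := fun _ => (Real.exp a - 1) / a) hm0
    fun θ hθ => by
      beta_reduce
      rw [level_eq_one hκ hc hx hfull hm hθ.1 hθ.2.le, mul_one]]
  rw [intervalIntegral.integral_const, sub_zero, smul_eq_mul]

/-- The directional upper bound of the potential, with a quadratic error. -/
lemma potential_sub_le (ha : 0 < a) (hκ : 0 < κ) (hM0 : 0 ≤ M) (hc : ∀ v ∈ V, 0 ≤ c v)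
    (hM : ∀ v ∈ V, c v ≤ M) (hx : ∀ v ∈ V, 0 ≤ x v) {x' : Ω → ℝ} (hx' : ∀ v ∈ V, 0 ≤ x' v)
    (hsmall : a * (1 / κ * ∑ v ∈ V, |x' v - x v|) ≤ 1) :
    potential a κ M V c x' - potential a κ M V c x
      ≤ 1 / κ * ∑ v ∈ V, (x' v - x v) * density a κ V c x (c v * Real.exp (-x v))
        + a * (1 / κ * ∑ v ∈ V, |x' v - x v|) ^ 2 * density a κ V c x M := by
  set D := 1 / κ * ∑ v ∈ V, |x' v - x v| with hD
  have hD0 : 0 ≤ D := mul_nonneg (by positivity) (Finset.sum_nonneg fun _ _ => abs_nonneg _)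
  set ind : Ω → ℝ → ℝ := fun v => Set.indicator {y | y ≤ c v * Real.exp (-x v)} (fun _ => 1)
    with hind
  set E : ℝ → ℝ := fun θ => Real.exp (a * level κ V c x θ) with hE
  have hEc : Continuous E := continuous_exp_level hc
  have hEi : ∀ p q, IntervalIntegrable E MeasureTheory.volume p q :=
    fun p q => hEc.intervalIntegrable p q
  have hI : ∀ v ∈ V, ∫ θ in (0 : ℝ)..M, E θ * ind v θ
      = density a κ V c x (c v * Real.exp (-x v)) := by
    intro v hv
    have hb : c v * Real.exp (-x v) ∈ Set.Icc 0 M :=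
      ⟨mul_nonneg (hc v hv) (Real.exp_pos _).le, (mul_le_of_le_one_right (hc v hv)
        (Real.exp_le_one_iff.2 (by linarith [hx v hv]))).trans (hM v hv)⟩
    rw [density, ← intervalIntegral.integral_indicator hb]
    refine intervalIntegral.integral_congr fun θ _ => ?_
    simp only [hind, Set.indicator_apply, mul_ite, mul_one, mul_zero, hE]
  have hii : ∀ v, IntervalIntegrable (fun θ => E θ * ind v θ) MeasureTheory.volume 0 M := by
    intro v
    have : (fun θ => E θ * ind v θ) = Set.indicator {y | y ≤ c v * Real.exp (-x v)} E := by
      funext θ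
      simp only [hind, Set.indicator_apply, mul_ite, mul_one, mul_zero]
    rw [this]
    exact ⟨(hEi 0 M).1.indicator measurableSet_Iic, (hEi 0 M).2.indicator measurableSet_Iic⟩
  -- Concavity of the layers bounds the change of the level by δ, and exp y ≤ 1 + y + y² for |y| ≤ 1
  -- bounds the exponential. Only an upper bound is sought, so the corners of the layers do no harm.
  have hpt : ∀ θ ∈ Set.Ioo 0 M, (Real.exp (a * level κ V c x' θ) - 1) / a
      - (Real.exp (a * level κ V c x θ) - 1) / a
      ≤ 1 / κ * ∑ v ∈ V, (x' v - x v) * (E θ * ind v θ) + a * D ^ 2 * E θ := by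
    intro θ hθ
    set δ := 1 / κ * ∑ v ∈ V, (x' v - x v) * ind v θ with hδ
    have h1 : level κ V c x' θ ≤ level κ V c x θ + δ := by
      rw [level, level, hδ, ← mul_add, ← Finset.sum_add_distrib]
      refine mul_le_mul_of_nonneg_left (Finset.sum_le_sum fun v hv => ?_) (by positivity)
      linarith [layer_sub_le (θ := θ) (hc v hv) (hx v hv) (hx' v hv) hθ.1]
    have h2 : |δ| ≤ D := by
      rw [hδ, abs_mul, abs_of_pos (by positivity : 0 < 1 / κ)]
      refine mul_le_mul_of_nonneg_left ((Finset.abs_sum_le_sum_abs _ _).trans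
        (Finset.sum_le_sum fun v _ => ?_)) (by positivity)
      rw [abs_mul]
      refine mul_le_of_le_one_right (abs_nonneg _) ?_
      simp only [hind, Set.indicator_apply]
      split_ifs <;> simp
    have h3 : Real.exp (a * δ) ≤ 1 + a * δ + (a * D) ^ 2 := by
      have hab : |a * δ| ≤ a * D := by
        rw [abs_mul, abs_of_pos ha]
        exact mul_le_mul_of_nonneg_left h2 ha.le
      have := Real.abs_exp_sub_one_sub_id_le (hab.trans hsmall)
      have h5 := (abs_le.1 this).2
      have h6 : (a * δ) ^ 2 ≤ (a * D) ^ 2 := sq_le_sq' (abs_le.1 hab).1 (abs_le.1 hab).2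
      linarith
    have h4 : Real.exp (a * level κ V c x' θ) ≤ E θ * Real.exp (a * δ) := by
      rw [hE, ← Real.exp_add, Real.exp_le_exp]
      nlinarith
    have h5 : E θ * Real.exp (a * δ) ≤ E θ * (1 + a * δ + (a * D) ^ 2) :=
      mul_le_mul_of_nonneg_left h3 (Real.exp_pos _).le
    have h6 : 1 / κ * ∑ v ∈ V, (x' v - x v) * (E θ * ind v θ) = E θ * δ := by
      rw [hδ, Finset.mul_sum, Finset.mul_sum, Finset.mul_sum]
      exact Finset.sum_congr rfl fun v _ => by ring
    rw [h6, ← sub_div, div_le_iff₀ ha]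
    have h7 : Real.exp (a * level κ V c x θ) = E θ := rfl
    rw [h7]
    linarith
  have hsi : IntervalIntegrable (fun θ => ∑ v ∈ V, (x' v - x v) * (E θ * ind v θ))
      MeasureTheory.volume 0 M := by
    have := IntervalIntegrable.sum V fun v _ => (hii v).const_mul (x' v - x v)
    rwa [show (∑ v ∈ V, fun θ => (x' v - x v) * (E θ * ind v θ))
      = fun θ => ∑ v ∈ V, (x' v - x v) * (E θ * ind v θ) by ext; simp] at this
  have hi' : ∀ y : Ω → ℝ, IntervalIntegrable
      (fun θ => (Real.exp (a * level κ V c y θ) - 1) / a) MeasureTheory.volume 0 M :=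
    fun y => (continuous_integrand hc).intervalIntegrable _ _
  have hmono : ∫ θ in (0 : ℝ)..M, ((Real.exp (a * level κ V c x' θ) - 1) / a
      - (Real.exp (a * level κ V c x θ) - 1) / a)
      ≤ ∫ θ in (0 : ℝ)..M, (1 / κ * ∑ v ∈ V, (x' v - x v) * (E θ * ind v θ) + a * D ^ 2 * E θ) :=
    intervalIntegral.integral_mono_on_of_le_Ioo hM0 ((hi' x').sub (hi' x))
      ((hsi.const_mul (1 / κ)).add ((hEi 0 M).const_mul (a * D ^ 2))) hpt
  rw [intervalIntegral.integral_sub (hi' x') (hi' x), intervalIntegral.integral_add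
    (hsi.const_mul (1 / κ)) ((hEi 0 M).const_mul (a * D ^ 2)), intervalIntegral.integral_const_mul,
    intervalIntegral.integral_const_mul] at hmono
  refine hmono.trans (le_of_eq ?_)
  congr 2
  rw [intervalIntegral.integral_finsetSum fun v _ => (hii v).const_mul (x' v - x v)]
  exact Finset.sum_congr rfl fun v hv => by rw [intervalIntegral.integral_const_mul, hI v hv]

end

end OnlineSubmodular

end

/-! ### The potential and the acceptance threshold during a round -/

noncomputable section

namespace OnlineSubmodular

variable {Ω : Type*}

/-- `α w(S) - w(A)` on one part, when `w v τ = c v * exp (-τ)`, `S_v = x v`, `A_u = t` and the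
other pairs of `A` have the weight `B`. -/
def worth (α B : ℝ) (V : Finset Ω) (c : Ω → ℝ) (u : Ω) (x : Ω → ℝ) (t : ℝ) : ℝ :=
  α * ∑ v ∈ V, c v * (1 - Real.exp (-x v)) - (B + c u * (1 - Real.exp (-t)))

/-- Admissible velocities: `u` grows at unit speed and, if the part is full, the pairs of smallest
value shrink. -/
structure IsVelocity (κ : ℝ) (V : Finset Ω) (u : Ω) (c x r : Ω → ℝ) : Prop where
  unit : r u = 1
  rest : (∀ v ∈ V.erase u, r v = 0) ∨ ∃ m, 0 ≤ m ∧ ∑ v ∈ V, x v = κ ∧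
    (∀ v ∈ V.erase u, r v ≠ 0 → c v * Real.exp (-x v) = m) ∧
    (∀ v ∈ V.erase u, 0 < x v → m ≤ c v * Real.exp (-x v)) ∧
    ∑ v ∈ V.erase u, r v = -1

/-- The evolution of one part during a round. -/
structure Flow (α κ B d : ℝ) (V : Finset Ω) (u : Ω) (c : Ω → ℝ) (x : ℝ → Ω → ℝ) : Prop where
  mem : u ∈ V
  c_nonneg : ∀ v ∈ V, 0 ≤ c v
  clock : ∀ t ∈ Set.Icc 0 d, x t u = t
  nonneg : ∀ t ∈ Set.Icc 0 d, ∀ v ∈ V, 0 ≤ x t v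
  continuousOn : ∀ v, ContinuousOn (fun t => x t v) (Set.Icc 0 d)
  accepts : ∀ t ∈ Set.Ico 0 d, 1 / κ * worth α B V c u (x t) t < c u * Real.exp (-t)
  evolves : ∀ t ∈ Set.Ico 0 d, ∃ r : Ω → ℝ, IsVelocity κ V u c (x t) r ∧
    ∀ v ∈ V, HasDerivWithinAt (fun s => x s v) (r v) (Set.Ici t) t

section

variable {α κ M : ℝ} {V : Finset Ω} {u : Ω} {c x r : Ω → ℝ}

/-- This is the integrand of the potential at level 1: a full part all of whose values are at least
y has potential at least y. -/
lemma one_le_profile_one (hα : 2 < α) (he : α = Real.exp (α - 2)) :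
    1 ≤ (Real.exp (α - 2) - 1) / (α - 2) := by
  rw [← he, le_div_iff₀ (by linarith)]
  linarith

/-- In a full part, the smallest value is less than any value above the potential. -/
lemma min_lt_of_potential_lt (hα : 2 < α) (he : α = Real.exp (α - 2)) (hκ : 0 < κ) (hu : u ∈ V)
    (hc : ∀ v ∈ V, 0 ≤ c v) (hM : ∀ v ∈ V, c v ≤ M) (hx : ∀ v ∈ V, 0 ≤ x v)
    (hfull : ∑ v ∈ V, x v = κ) {m : ℝ}
    (hm : ∀ v ∈ V.erase u, 0 < x v → m ≤ c v * Real.exp (-x v))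
    (hlt : potential (α - 2) κ M V c x < c u * Real.exp (-x u)) :
    m < c u * Real.exp (-x u) := by
  by_contra hn
  have hw0 : 0 ≤ c u * Real.exp (-x u) := mul_nonneg (hc u hu) (Real.exp_pos _).le
  have hwM : c u * Real.exp (-x u) ≤ M := (mul_le_of_le_one_right (hc u hu)
    (Real.exp_le_one_iff.2 (by linarith [hx u hu]))).trans (hM u hu)
  -- If the value of u were at most m, every pair of the full part would have at least that value,
  -- and the potential would reach it.
  have := le_potential_full (a := α - 2) (by linarith) hκ hc hx hfull hw0 hwM fun v hv h => by
    by_cases e : v = u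
    · rw [e]
    · exact (not_lt.1 hn).trans (hm v (Finset.mem_erase.2 ⟨e, hv⟩) h)
  have h1 := le_mul_of_one_le_right hw0 (one_le_profile_one hα he)
  linarith

/-- The sum of densities bounds κ times the right derivative of the potential, and the other
expression is the derivative of α w(S) - w(A). While nothing is dropped, the former is less than (α
- 1) w_u and the latter equals it. In a full part both lose the same amount α m. The second claim
says that the gain (α - 1) w_u still covers that loss. -/
lemma IsVelocity.bounds (hα : 3 < α) (he : α = Real.exp (α - 2)) (hκ : 0 < κ) (hu : u ∈ V)
    (hc : ∀ v ∈ V, 0 ≤ c v) (hM : ∀ v ∈ V, c v ≤ M) (hx : ∀ v ∈ V, 0 ≤ x v)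
    (hr : IsVelocity κ V u c x r)
    (hlt : potential (α - 2) κ M V c x < c u * Real.exp (-x u)) :
    ∑ v ∈ V, r v * density (α - 2) κ V c x (c v * Real.exp (-x v))
        < α * ∑ v ∈ V, c v * (Real.exp (-x v) * r v) - c u * Real.exp (-x u) ∧
      0 ≤ α * ∑ v ∈ V, c v * (Real.exp (-x v) * r v) - c u * Real.exp (-x u) := by
  have ha : 0 < α - 2 := by linarith
  have hw0 : 0 ≤ c u * Real.exp (-x u) := mul_nonneg (hc u hu) (Real.exp_pos _).le
  have hwM : c u * Real.exp (-x u) ≤ M := (mul_le_of_le_one_right (hc u hu)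
    (Real.exp_le_one_iff.2 (by linarith [hx u hu]))).trans (hM u hu)
  have hd := density_le (x := x) ha hκ hc hwM
  rw [← Finset.add_sum_erase _ _ hu, ← Finset.add_sum_erase _ _ hu, hr.unit]
  rcases hr.rest with h0 | ⟨m, hm0, hfull, hm1, hm2, hsum⟩
  · rw [Finset.sum_eq_zero fun v hv => by rw [h0 v hv, zero_mul],
      Finset.sum_eq_zero fun v hv => by rw [h0 v hv, mul_zero, mul_zero]]
    constructor <;> nlinarith
  · have e1 : ∑ v ∈ V.erase u, r v * density (α - 2) κ V c x (c v * Real.exp (-x v))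
        = -density (α - 2) κ V c x m := by
      rw [Finset.sum_congr rfl (g := fun v => r v * density (α - 2) κ V c x m) fun v hv => ?_,
        ← Finset.sum_mul, hsum, neg_one_mul]
      by_cases h : r v = 0
      · rw [h, zero_mul, zero_mul]
      · rw [hm1 v hv h]
    have e2 : ∑ v ∈ V.erase u, c v * (Real.exp (-x v) * r v) = -m := by
      rw [Finset.sum_congr rfl (g := fun v => r v * m) fun v hv => ?_, ← Finset.sum_mul, hsum,
        neg_one_mul]
      by_cases h : r v = 0
      · rw [h, mul_zero, mul_zero, zero_mul]
      · rw [← hm1 v hv h]; ring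
    have hmw := min_lt_of_potential_lt (by linarith) he hκ hu hc hM hx hfull hm2 hlt
    have hm3 : ∀ v ∈ V, 0 < x v → m ≤ c v * Real.exp (-x v) := fun v hv h => by
      by_cases e : v = u
      · rw [e]; exact hmw.le
      · exact hm2 v (Finset.mem_erase.2 ⟨e, hv⟩) h
    have h1 := density_full (a := α - 2) hκ hc hx hfull hm0 hm3
    have h2 := le_potential_full (a := α - 2) ha hκ hc hx hfull hm0 (hmw.le.trans hwM) hm3
    -- Here the equation for α enters: the density at m becomes m α, and the potential is at least m
    -- (α - 1) / (α - 2).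
    rw [← he] at h1 h2
    rw [e1, e2, h1]
    refine ⟨by nlinarith, ?_⟩
    have h3 : m * ((α - 1) / (α - 2)) ≤ c u * Real.exp (-x u) := by linarith
    -- This is (α - 1)² ≥ α (α - 2).
    have h4 : m * α ≤ (α - 1) * (m * ((α - 1) / (α - 2))) := by
      rw [show (α - 1) * (m * ((α - 1) / (α - 2))) = m * ((α - 1) ^ 2 / (α - 2)) by ring]
      refine mul_le_mul_of_nonneg_left ?_ hm0
      rw [le_div_iff₀ ha]
      nlinarith
    nlinarith

end

namespace Flow

variable {α κ B d M : ℝ} {V : Finset Ω} {u : Ω} {c : Ω → ℝ} {x : ℝ → Ω → ℝ}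

lemma continuousOn_worth (h : Flow α κ B d V u c x) :
    ContinuousOn (fun t => worth α B V c u (x t) t) (Set.Icc 0 d) := by
  unfold worth
  refine (continuousOn_const.mul (continuousOn_finsetSum _ fun v _ => ?_)).sub (by fun_prop)
  exact continuousOn_const.mul (continuousOn_const.sub (h.continuousOn v).neg.rexp)

lemma continuousOn_potential (h : Flow α κ B d V u c x) :
    ContinuousOn (fun t => potential (α - 2) κ M V c (x t)) (Set.Icc 0 d) :=
  (continuous_potential h.c_nonneg).comp_continuousOn
    (continuousOn_pi.2 fun v => h.continuousOn v)

lemma hasDerivWithinAt_worth {t : ℝ} {r : Ω → ℝ}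
    (hr : ∀ v ∈ V, HasDerivWithinAt (fun s => x s v) (r v) (Set.Ici t) t) :
    HasDerivWithinAt (fun s => worth α B V c u (x s) s)
      (α * ∑ v ∈ V, c v * (Real.exp (-x t v) * r v) - c u * Real.exp (-t)) (Set.Ici t) t := by
  have h1 : HasDerivWithinAt (fun s => ∑ v ∈ V, c v * (1 - Real.exp (-x s v)))
      (∑ v ∈ V, c v * (Real.exp (-x t v) * r v)) (Set.Ici t) t := by
    refine HasDerivWithinAt.fun_sum fun v hv => ?_
    have := ((((hr v hv).neg).exp).const_sub 1).const_mul (c v)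
    simpa using this
  have h2 : HasDerivWithinAt (fun s => B + c u * (1 - Real.exp (-s)))
      (c u * Real.exp (-t)) (Set.Ici t) t := by
    have := ((((hasDerivWithinAt_neg t (Set.Ici t)).exp).const_sub 1).const_mul (c u)).const_add B
    simpa using this
  exact (h1.const_mul α).sub h2

/-- The potential need not be differentiable along the path, but near t its increment is bounded by
that of a function U that is differentiable from the right. Cauchy-Schwarz turns the quadratic error
of `potential_sub_le` into a sum of squares, whose derivative at t is zero. -/
lemma frequently_slope_potential_lt (h : Flow α κ B d V u c x) (hα : 2 < α) (hκ : 0 < κ)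
    (hM0 : 0 ≤ M) (hM : ∀ v ∈ V, c v ≤ M) {t : ℝ} (ht : t ∈ Set.Ico 0 d) {r : Ω → ℝ}
    (hr : ∀ v ∈ V, HasDerivWithinAt (fun s => x s v) (r v) (Set.Ici t) t) {ρ : ℝ}
    (hρ : 1 / κ * ∑ v ∈ V, r v * density (α - 2) κ V c (x t) (c v * Real.exp (-x t v)) < ρ) :
    ∃ᶠ z in nhdsWithin t (Set.Ioi t),
      slope (fun s => potential (α - 2) κ M V c (x s)) t z < ρ := by
  set D : Ω → ℝ := fun v => density (α - 2) κ V c (x t) (c v * Real.exp (-x t v))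
  set E := density (α - 2) κ V c (x t) M with hE
  have hE0 : 0 ≤ E := intervalIntegral.integral_nonneg hM0 fun _ _ => (Real.exp_pos _).le
  set U : ℝ → ℝ := fun z => 1 / κ * ∑ v ∈ V, (x z v - x t v) * D v
    + (α - 2) * (1 / κ) ^ 2 * V.card * E * ∑ v ∈ V, (x z v - x t v) ^ 2 with hU
  have hUd : HasDerivWithinAt U (1 / κ * ∑ v ∈ V, r v * D v) (Set.Ici t) t := by
    have h1 : HasDerivWithinAt (fun z => ∑ v ∈ V, (x z v - x t v) * D v)
        (∑ v ∈ V, r v * D v) (Set.Ici t) t :=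
      HasDerivWithinAt.fun_sum fun v hv => ((hr v hv).sub_const _).mul_const _
    have h2 : HasDerivWithinAt (fun z => ∑ v ∈ V, (x z v - x t v) ^ 2) (∑ v ∈ V, 0)
        (Set.Ici t) t := by
      refine HasDerivWithinAt.fun_sum fun v hv => ?_
      have := ((hr v hv).sub_const (x t v)).fun_pow 2
      simpa using this
    have := (h1.const_mul (1 / κ)).fun_add (h2.const_mul ((α - 2) * (1 / κ) ^ 2 * V.card * E))
    rwa [Finset.sum_const_zero, mul_zero, add_zero] at this
  have hslope := (hasDerivWithinAt_iff_tendsto_slope' (s := Set.Ioi t) (by simp)).1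
    (hUd.mono Set.Ioi_subset_Ici_self)
  have hev := hslope.eventually_lt_const hρ
  have hIcc : ∀ᶠ z in nhdsWithin t (Set.Ioi t), z ∈ Set.Ioo t d := Ioo_mem_nhdsGT ht.2
  have hsmall : ∀ᶠ z in nhdsWithin t (Set.Ioi t),
      (α - 2) * (1 / κ * ∑ v ∈ V, |x z v - x t v|) < 1 := by
    have hc : Filter.Tendsto (fun z => (α - 2) * (1 / κ * ∑ v ∈ V, |x z v - x t v|))
        (nhdsWithin t (Set.Ioi t)) (nhds ((α - 2) * (1 / κ * ∑ v ∈ V, |x t v - x t v|))) := by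
      refine ((tendsto_finsetSum _ fun v hv => ?_).const_mul _).const_mul _
      exact (((hr v hv).continuousWithinAt.mono Set.Ioi_subset_Ici_self).tendsto.sub_const _).abs
    exact hc.eventually_lt_const (by simp)
  refine Filter.Eventually.frequently ?_
  filter_upwards [hev, hIcc, hsmall] with z hz1 hz2 hz3
  refine lt_of_le_of_lt ?_ hz1
  have ht0 : t ∈ Set.Icc 0 d := ⟨ht.1, ht.2.le⟩
  have hz0 : z ∈ Set.Icc 0 d := ⟨ht.1.trans hz2.1.le, hz2.2.le⟩
  have key := potential_sub_le (a := α - 2) (by linarith) hκ hM0 h.c_nonneg hM (h.nonneg t ht0)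
    (h.nonneg z hz0) hz3.le
  have hUt : U t = 0 := by simp [hU]
  rw [slope_def_field, slope_def_field, hUt, sub_zero]
  refine div_le_div_of_nonneg_right (key.trans ?_) (by linarith [hz2.1])
  refine add_le_add_right ?_ _
  have hcs : (∑ v ∈ V, |x z v - x t v|) ^ 2 ≤ V.card * ∑ v ∈ V, (x z v - x t v) ^ 2 := by
    refine sq_sum_le_card_mul_sum_sq.trans_eq ?_
    simp only [sq_abs]
  rw [mul_pow, ← hE]
  have := mul_le_mul_of_nonneg_left hcs (show 0 ≤ (α - 2) * (1 / κ) ^ 2 * E from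
    mul_nonneg (mul_nonneg (by linarith) (by positivity)) hE0)
  linarith

/-- The potential never exceeds the acceptance threshold. -/
theorem potential_le (h : Flow α κ B d V u c x) (hα : 3 < α) (he : α = Real.exp (α - 2))
    (hκ : 0 < κ) (hM : ∀ v ∈ V, c v ≤ M)
    (h0 : potential (α - 2) κ M V c (x 0) ≤ 1 / κ * worth α B V c u (x 0) 0) :
    ∀ t ∈ Set.Icc 0 d,
      potential (α - 2) κ M V c (x t) ≤ 1 / κ * worth α B V c u (x t) t := by
  have hM0 : 0 ≤ M := (h.c_nonneg u h.mem).trans (hM u h.mem)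
  choose! r hr hd using h.evolves
  -- The strict inequality of derivatives is required only at times of equality. There acceptance
  -- says that the potential is less than the current value of u, which is the hypothesis of
  -- `IsVelocity.bounds`.
  refine image_le_of_liminf_slope_right_lt_deriv_boundary' h.continuousOn_potential
    (f' := fun t => 1 / κ * ∑ v ∈ V, r t v *
      density (α - 2) κ V c (x t) (c v * Real.exp (-x t v)))
    (fun t ht ρ hρ => h.frequently_slope_potential_lt (by linarith) hκ hM0 hM ht (hd t ht) hρ)
    h0 (continuousOn_const.mul h.continuousOn_worth)
    (fun t ht => (hasDerivWithinAt_worth (hd t ht)).const_mul (1 / κ)) fun t ht hEq => ?_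
  have ht' : t ∈ Set.Icc 0 d := ⟨ht.1, ht.2.le⟩
  have hlt := h.accepts t ht
  have hcl := h.clock t ht'
  have := ((hr t ht).bounds hα he hκ h.mem h.c_nonneg hM (h.nonneg t ht')
    (by rw [hEq, hcl]; exact hlt)).1
  rw [hcl] at this
  exact mul_lt_mul_of_pos_left this (by positivity)

/-- Because the threshold does not fall, elements of the part that were refused earlier remain below
it. -/
theorem worth_mono (h : Flow α κ B d V u c x) (hα : 3 < α) (he : α = Real.exp (α - 2))
    (hκ : 0 < κ) (hM : ∀ v ∈ V, c v ≤ M)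
    (h0 : potential (α - 2) κ M V c (x 0) ≤ 1 / κ * worth α B V c u (x 0) 0) :
    ∀ t ∈ Set.Icc 0 d, worth α B V c u (x 0) 0 ≤ worth α B V c u (x t) t := by
  choose! r hr hd using h.evolves
  refine image_le_of_deriv_right_le_deriv_boundary continuousOn_const
    (fun t _ => hasDerivWithinAt_const t _ _) le_rfl h.continuousOn_worth
    (fun t ht => hasDerivWithinAt_worth (hd t ht)) fun t ht => ?_
  have ht' : t ∈ Set.Icc 0 d := ⟨ht.1, ht.2.le⟩
  have hcl := h.clock t ht'
  have := ((hr t ht).bounds hα he hκ h.mem h.c_nonneg hM (h.nonneg t ht') (by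
    rw [hcl]
    exact (h.potential_le hα he hκ hM h0 t ht').trans_lt (h.accepts t ht))).2
  rwa [hcl] at this

end Flow

end OnlineSubmodular

end

noncomputable section

namespace OnlineSubmodular

/-! ### Packing the knapsack -/

open MeasureTheory Set Filter Topology

/-- `E` is clopen in the topology generated by the intervals `(a, b]`. -/
def LeftClopen (E : Set ℝ) : Prop := ∀ x, ∀ᶠ y in 𝓝[≤] x, (y ∈ E ↔ x ∈ E)

namespace LeftClopen

variable {E F : Set ℝ}

lemma empty : LeftClopen ∅ := fun _ => by simp

lemma diff (hE : LeftClopen E) (hF : LeftClopen F) : LeftClopen (E \ F) := fun x => by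
  filter_upwards [hE x, hF x] with y h1 h2
  rw [Set.mem_sdiff, Set.mem_sdiff, h1, h2]

lemma union (hE : LeftClopen E) (hF : LeftClopen F) : LeftClopen (E ∪ F) := fun x => by
  filter_upwards [hE x, hF x] with y h1 h2
  rw [mem_union, mem_union, h1, h2]

lemma biUnion {κ : Type*} (s : Finset κ) {G : κ → Set ℝ} (h : ∀ i ∈ s, LeftClopen (G i)) :
    LeftClopen (⋃ i ∈ s, G i) := by
  induction s using Finset.induction_on with
  | empty => simpa using empty
  | insert a s _ ih =>
    rw [Finset.set_biUnion_insert]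
    exact (h a (by simp)).union (ih fun i hi => h i (by simp [hi]))

lemma Ioc (a b : ℝ) : LeftClopen (Ioc a b) := fun x => by
  by_cases hax : a < x
  · have h1 : ∀ᶠ y in 𝓝[≤] x, a < y := (lt_mem_nhds hax).filter_mono nhdsWithin_le_nhds
    by_cases hxb : x ≤ b
    · filter_upwards [h1, self_mem_nhdsWithin] with y hy hyx
      exact ⟨fun _ => ⟨hax, hxb⟩, fun _ => ⟨hy, le_trans hyx hxb⟩⟩
    · have h2 : ∀ᶠ y in 𝓝[≤] x, b < y :=
        (lt_mem_nhds (not_le.1 hxb)).filter_mono nhdsWithin_le_nhds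
      filter_upwards [h2] with y hy
      exact ⟨fun h => absurd h.2 hy.not_ge, fun h => absurd h.2 hxb⟩
  · filter_upwards [self_mem_nhdsWithin] with y hyx
    exact ⟨fun h => absurd (h.1.trans_le hyx) hax, fun h => absurd h.1 hax⟩

lemma exists_Ioc (hE : LeftClopen E) (x : ℝ) : ∃ z < x, ∀ y ∈ Set.Ioc z x, (y ∈ E ↔ x ∈ E) := by
  obtain ⟨z, hz, h⟩ := (mem_nhdsLE_iff_exists_Ioc_subset).1 (hE x)
  exact ⟨z, hz, fun y hy => h hy⟩

end LeftClopen

/-- The length of `E` up to `x`. -/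
def lengthUpTo (E : Set ℝ) (x : ℝ) : ℝ := volume.real (E ∩ Iic x)

section

variable {E : Set ℝ} {K d : ℝ}

lemma volume_ne_top_of_subset_Ioc (hsub : E ⊆ Ioc 0 K) : volume E ≠ ⊤ :=
  measure_ne_top_of_subset hsub measure_Ioc_lt_top.ne

lemma lengthUpTo_mono (hsub : E ⊆ Ioc 0 K) : Monotone (lengthUpTo E) := fun _ _ h =>
  measureReal_mono (inter_subset_inter_right E (Iic_subset_Iic.2 h))
    (measure_ne_top_of_subset inter_subset_left (volume_ne_top_of_subset_Ioc hsub))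

lemma lengthUpTo_sub_le (hsub : E ⊆ Ioc 0 K) {x y : ℝ} (h : x ≤ y) :
    lengthUpTo E y - lengthUpTo E x ≤ y - x := by
  have h1 : E ∩ Iic y ⊆ (E ∩ Iic x) ∪ Ioc x y := fun z hz => by
    by_cases hzx : z ≤ x
    · exact Or.inl ⟨hz.1, hzx⟩
    · exact Or.inr ⟨not_le.1 hzx, hz.2⟩
  have h2 := (measureReal_mono (μ := volume) h1 (measure_union_ne_top
    (measure_ne_top_of_subset inter_subset_left (volume_ne_top_of_subset_Ioc hsub))
    measure_Ioc_lt_top.ne)).trans (measureReal_union_le _ _)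
  rw [Real.volume_real_Ioc_of_le h] at h2
  unfold lengthUpTo
  linarith

lemma continuous_lengthUpTo (hsub : E ⊆ Ioc 0 K) : Continuous (lengthUpTo E) := by
  refine LipschitzWith.continuous (K := 1) (LipschitzWith.of_le_add fun x y => ?_)
  rcases le_total x y with h | h
  · linarith [lengthUpTo_mono hsub h, dist_nonneg (x := x) (y := y)]
  · rw [Real.dist_eq, abs_of_nonneg (sub_nonneg.2 h)]
    linarith [lengthUpTo_sub_le hsub h]

lemma lengthUpTo_of_nonpos (hsub : E ⊆ Ioc 0 K) {x : ℝ} (hx : x ≤ 0) : lengthUpTo E x = 0 := by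
  have : E ∩ Iic x = ∅ := by
    ext z
    simp only [mem_inter_iff, mem_Iic, mem_empty_iff_false, iff_false, not_and, not_le]
    exact fun hz => hx.trans_lt (hsub hz).1
  rw [lengthUpTo, this, measureReal_empty]

lemma lengthUpTo_top (hsub : E ⊆ Ioc 0 K) : lengthUpTo E K = volume.real E := by
  rw [lengthUpTo, inter_eq_left.2 (show E ⊆ Iic K from fun z hz => (hsub hz).2)]

/-- A point x of a left-clopen set carries an interval (w, x] inside the set, so length is gained
just before x. For general measurable sets this fails on null sets, and the packing below would not
be injective everywhere. -/
lemma lengthUpTo_lt (hLC : LeftClopen E) (hsub : E ⊆ Ioc 0 K) {x y : ℝ} (hx : x ∈ E)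
    (hyx : y < x) : lengthUpTo E y < lengthUpTo E x := by
  obtain ⟨z, hz, h⟩ := hLC.exists_Ioc x
  set w := max y z
  have hw : w < x := max_lt hyx hz
  have h1 : (E ∩ Iic y) ∪ Ioc w x ⊆ E ∩ Iic x := by
    rintro v (hv | hv)
    · exact ⟨hv.1, le_trans hv.2 hyx.le⟩
    · exact ⟨(h v ⟨(le_max_right y z).trans_lt hv.1, hv.2⟩).2 hx, hv.2⟩
  have hdisj : Disjoint (E ∩ Iic y) (Ioc w x) :=
    Set.disjoint_left.2 fun v hv hv' => absurd ((le_max_left y z).trans_lt hv'.1) (not_lt.2 hv.2)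
  have hfin : ∀ s, volume (E ∩ s) ≠ ⊤ := fun s =>
    measure_ne_top_of_subset inter_subset_left (volume_ne_top_of_subset_Ioc hsub)
  have h2 := measureReal_mono (μ := volume) h1 (hfin _)
  rw [measureReal_union hdisj measurableSet_Ioc (hfin _) measure_Ioc_lt_top.ne,
    Real.volume_real_Ioc_of_le hw.le] at h2
  unfold lengthUpTo
  linarith

/-- The length function pushes Lebesgue measure on E forward to Lebesgue measure on (0, |E|]. It is
enough to compare the two on half-lines. -/
lemma volume_inter_preimage_lengthUpTo (hLC : LeftClopen E)
    (hsub : E ⊆ Ioc 0 K) {B : Set ℝ} (hB : MeasurableSet B) (hBE : B ⊆ Ioc 0 (volume.real E)) :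
    volume (E ∩ lengthUpTo E ⁻¹' B) = volume B := by
  have hfin := volume_ne_top_of_subset_Ioc hsub
  have hm := (continuous_lengthUpTo hsub).measurable
  have : IsFiniteMeasure (volume.restrict E) := ⟨by simpa using hfin.lt_top⟩
  set D := volume.real E with hD
  have hD0 : 0 ≤ D := measureReal_nonneg
  have key : (volume.restrict E).map (lengthUpTo E) = volume.restrict (Ioc 0 D) := by
    refine Measure.ext_of_Iic _ _ fun r => ?_
    rw [Measure.map_apply hm measurableSet_Iic, Measure.restrict_apply measurableSet_Iic,
      Measure.restrict_apply (hm measurableSet_Iic)]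
    have e1 : Iic r ∩ Ioc 0 D = Ioc 0 (min r D) := by
      ext z
      simp only [mem_inter_iff, mem_Iic, mem_Ioc, le_min_iff]
      tauto
    rw [e1, Real.volume_Ioc, sub_zero]
    rcases le_or_gt D r with hr | hr
    · have : lengthUpTo E ⁻¹' Iic r ∩ E = E := inter_eq_right.2 fun z hz => by
        refine le_trans ?_ hr
        rw [hD, ← lengthUpTo_top hsub]
        exact lengthUpTo_mono hsub (hsub hz).2
      rw [this, min_eq_right hr, hD, ofReal_measureReal hfin]
    · rw [min_eq_left hr.le]
      rcases lt_or_ge r 0 with h0 | h0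
      · have : lengthUpTo E ⁻¹' Iic r ∩ E = ∅ := by
          ext z
          simp only [mem_inter_iff, mem_preimage, mem_Iic, mem_empty_iff_false, iff_false]
          exact fun h => absurd (h.1.trans_lt h0) (not_lt.2 measureReal_nonneg)
        rw [this, measure_empty, ENNReal.ofReal_of_nonpos h0.le]
      · have hr' : r ∈ Icc (lengthUpTo E 0) (lengthUpTo E K) := by
          rw [lengthUpTo_of_nonpos hsub le_rfl, lengthUpTo_top hsub]
          exact ⟨h0, hr.le⟩
        have hK : (0 : ℝ) ≤ K := by
          by_contra hn
          have hE0 : E ⊆ ∅ := by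
            rw [← Ioc_eq_empty (fun h : (0 : ℝ) < K => hn h.le)]
            exact hsub
          rw [hD, subset_empty_iff.1 hE0, measureReal_empty] at hr
          linarith
        -- Any x at which the length is r will do: by strict growth no point of E beyond x has
        -- length at most r.
        obtain ⟨x, -, hx⟩ := intermediate_value_Icc hK (continuous_lengthUpTo hsub).continuousOn hr'
        have : lengthUpTo E ⁻¹' Iic r ∩ E = E ∩ Iic x := by
          ext z
          simp only [mem_inter_iff, mem_preimage, mem_Iic]
          constructor
          · rintro ⟨h1, h2⟩
            refine ⟨h2, ?_⟩
            by_contra hn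
            have := lengthUpTo_lt hLC hsub h2 (not_le.1 hn)
            linarith
          · rintro ⟨h1, h2⟩
            exact ⟨hx ▸ lengthUpTo_mono hsub h2, h1⟩
        rw [this, ← hx, lengthUpTo, ofReal_measureReal
          (measure_ne_top_of_subset inter_subset_left hfin)]
  have h1 := congrArg (fun μ => μ B) key
  rw [Measure.map_apply hm hB, Measure.restrict_apply (hm hB), Measure.restrict_apply hB,
    inter_eq_left.2 hBE, inter_comm] at h1
  exact h1

/-- An interval `(0, d]` can be moved into a left-clopen set of sufficient measure. -/
theorem exists_packing (hE : MeasurableSet E) (hLC : LeftClopen E) (hsub : E ⊆ Ioc 0 K)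
    (hvol : d ≤ volume.real E) :
    ∃ φ : ℝ → ℝ, (∀ t ∈ Ioc 0 d, φ t ∈ E) ∧ InjOn φ (Ioc 0 d) ∧
      (∀ B ⊆ Ioc 0 d, MeasurableSet B → MeasurableSet (φ '' B) ∧ volume (φ '' B) = volume B) ∧
      ∀ r ≤ d, LeftClopen (φ '' Ioc 0 r) := by
  set m := lengthUpTo E with hm
  have hmono := lengthUpTo_mono hsub
  have hcont := continuous_lengthUpTo hsub
  -- The generalized inverse of the length function: φ t is the first point up to which E has length
  -- t.
  set φ : ℝ → ℝ := fun t => sInf {x | t ≤ m x} with hφ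
  have hbdd : ∀ t, 0 < t → ∀ x ∈ {x | t ≤ m x}, 0 ≤ x := fun t ht x hx => by
    by_contra hn
    have : m x = 0 := lengthUpTo_of_nonpos hsub (not_le.1 hn).le
    have h2 : t ≤ m x := hx
    linarith
  have hmem : ∀ t ∈ Ioc 0 d, t ≤ m (φ t) := fun t ht => by
    have hcl : IsClosed {x | t ≤ m x} := isClosed_le continuous_const hcont
    refine hcl.csInf_mem ⟨K, ?_⟩ ⟨0, fun x hx => hbdd t ht.1 x hx⟩
    show t ≤ m K
    rw [hm, lengthUpTo_top hsub]
    exact ht.2.trans hvol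
  have hleast : ∀ t ∈ Ioc 0 d, ∀ y, t ≤ m y → φ t ≤ y := fun t ht y hy =>
    csInf_le ⟨0, fun x hx => hbdd t ht.1 x hx⟩ hy
  have hmφ : ∀ t ∈ Ioc 0 d, m (φ t) = t := fun t ht => by
    refine le_antisymm ?_ (hmem t ht)
    refine le_of_tendsto (hcont.continuousWithinAt (s := Iio (φ t)) (x := φ t)).tendsto ?_
    filter_upwards [self_mem_nhdsWithin] with y hy
    by_contra hn
    exact absurd (hleast t ht y (not_le.1 hn).le) (not_le.2 hy)
  -- If φ t were outside E, so would be an interval to its left. The length would be constant there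
  -- and φ t not the first point.
  have hφE : ∀ t ∈ Ioc 0 d, φ t ∈ E := fun t ht => by
    by_contra hn
    obtain ⟨z, hz, h⟩ := hLC.exists_Ioc (φ t)
    have e : E ∩ Iic (φ t) = E ∩ Iic z := by
      ext y
      simp only [mem_inter_iff, mem_Iic]
      refine ⟨fun hy => ⟨hy.1, ?_⟩, fun hy => ⟨hy.1, hy.2.trans hz.le⟩⟩
      by_contra hyz
      exact hn ((h y ⟨not_le.1 hyz, hy.2⟩).1 hy.1)
    have e2 : m (φ t) = m z := by rw [hm, lengthUpTo, e, lengthUpTo]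
    exact absurd (hleast t ht z (e2 ▸ (hmφ t ht).ge)) (not_le.2 hz)
  -- Images become preimages under the continuous length function, which yields measurability,
  -- measure and left-clopenness.
  have himg : ∀ B ⊆ Ioc 0 d, φ '' B = E ∩ m ⁻¹' B := fun B hB => by
    ext x
    constructor
    · rintro ⟨t, ht, rfl⟩
      refine ⟨hφE t (hB ht), ?_⟩
      rw [mem_preimage, hmφ t (hB ht)]
      exact ht
    · rintro ⟨hx, hxB⟩
      refine ⟨m x, hxB, le_antisymm (hleast _ (hB hxB) x le_rfl) ?_⟩
      by_contra hn
      have := lengthUpTo_lt hLC hsub hx (not_le.1 hn)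
      rw [← hm, hmφ _ (hB hxB)] at this
      exact lt_irrefl _ this
  refine ⟨φ, hφE, fun t ht s hs h => ?_, fun B hB hBm => ?_, fun r hr => ?_⟩
  · rw [← hmφ t ht, h, hmφ s hs]
  · rw [himg B hB]
    exact ⟨hE.inter (hcont.measurable hBm), volume_inter_preimage_lengthUpTo hLC hsub hBm
      (hB.trans (Ioc_subset_Ioc_right hvol))⟩
  · rw [himg _ (Ioc_subset_Ioc_right hr)]
    intro x
    by_cases hx : x ∈ E
    · have h0 : 0 < m x := by
        have := lengthUpTo_lt hLC hsub hx (hsub hx).1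
        rwa [lengthUpTo_of_nonpos hsub le_rfl] at this
      have hc : Tendsto m (𝓝[≤] x) (𝓝 (m x)) := hcont.continuousWithinAt
      by_cases hxr : m x ≤ r
      · filter_upwards [hLC x, hc.eventually_const_lt h0, self_mem_nhdsWithin] with y h1 h2 h3
        exact ⟨fun _ => ⟨hx, h0, hxr⟩, fun _ => ⟨h1.2 hx, h2, (hmono h3).trans hxr⟩⟩
      · filter_upwards [hc.eventually_const_lt (not_le.1 hxr)] with y h1
        exact ⟨fun h => absurd h.2.2 h1.not_ge, fun h => absurd h.2.2 hxr⟩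
    · filter_upwards [hLC x] with y h1
      exact ⟨fun h => absurd (h1.1 h.1) hx, fun h => absurd h.1 hx⟩

end

/-- A knapsack assignment whose occupied regions are left-clopen. -/
structure IsPacked {Ω ι : Type*} (part : Ω → ι) (k : ι → ℕ) (S : Ω →₀ ℝ)
    (pos : Ω → ℝ → ℝ) : Prop extends IsStored part k S pos where
  leftClopen : ∀ u, ∀ r ≤ S u, LeftClopen (pos u '' Ioc 0 r)

section

variable {Ω ι : Type*} {part : Ω → ι} {k : ι → ℕ} {S S' : Ω →₀ ℝ} {pos : Ω → ℝ → ℝ}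

lemma isPacked_zero : IsPacked part k 0 pos where
  mem u t ht := absurd (ht.1.trans_le ht.2) (lt_irrefl _)
  injective u v _ t ht := absurd (ht.1.trans_le ht.2) (lt_irrefl _)
  measure u B hB _ := by
    have : B = ∅ := by simpa using hB
    simp [this]
  leftClopen u r hr := by
    rw [Ioc_eq_empty (by simpa using hr), image_empty]
    exact LeftClopen.empty

/-- The surviving pairs of other elements keep their points, and the mass bound leaves free length
at least S' u for the pairs of u. The free region is left-clopen because `IsPacked` asks this of
every initial segment of an element, and what survives of an element is an initial segment. -/
theorem IsPacked.exists_step (hp : IsPacked part k S pos) {u : Ω} (h0 : ∀ v, 0 ≤ S' v)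
    (hle : ∀ v, v ≠ u → S' v ≤ S v) (hmass : mass part (part u) S' ≤ k (part u)) :
    ∃ pos', IsPacked part k S' pos' ∧ ∀ v, v ≠ u → pos' v = pos v := by
  set W := (S'.support.filter fun v => part v = part u).erase u with hW
  have hWmem : ∀ {v}, v ∈ W → v ≠ u ∧ part v = part u := fun {v} hv => by
    rw [hW, Finset.mem_erase, Finset.mem_filter] at hv
    exact ⟨hv.1, hv.2.2⟩
  set G : Ω → Set ℝ := fun v => pos v '' Ioc 0 (S' v) with hG
  have hGm : ∀ v ∈ W, MeasurableSet (G v) ∧ volume (G v) = volume (Ioc 0 (S' v)) := fun v hv =>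
    hp.measure v _ (Ioc_subset_Ioc_right (hle v (hWmem hv).1)) measurableSet_Ioc
  set E := Ioc 0 (k (part u) : ℝ) \ ⋃ v ∈ W, G v with hE
  have hUm : MeasurableSet (⋃ v ∈ W, G v) := Finset.measurableSet_biUnion W fun v hv => (hGm v hv).1
  have hEm : MeasurableSet E := measurableSet_Ioc.diff hUm
  have hELC : LeftClopen E := (LeftClopen.Ioc _ _).diff (LeftClopen.biUnion W fun v hv =>
    hp.leftClopen v _ (hle v (hWmem hv).1))
  have hEsub : E ⊆ Ioc 0 (k (part u) : ℝ) := sdiff_subset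
  have hvolU : volume.real (⋃ v ∈ W, G v) ≤ ∑ v ∈ W, S' v := by
    refine (measureReal_biUnion_finset_le _ _).trans (Finset.sum_le_sum fun v hv => ?_)
    rw [measureReal_def, (hGm v hv).2, ← measureReal_def, Real.volume_real_Ioc_of_le (h0 v),
      sub_zero]
  have hvol : S' u ≤ volume.real E := by
    have h1 : volume.real (Ioc 0 (k (part u) : ℝ))
        ≤ volume.real E + volume.real (⋃ v ∈ W, G v) := by
      refine (measureReal_mono ?_ ?_).trans (measureReal_union_le _ _)
      · rw [hE, sdiff_union_self]
        exact subset_union_left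
      · refine measure_union_ne_top (volume_ne_top_of_subset_Ioc hEsub) ?_
        refine (measure_biUnion_lt_top W.finite_toSet fun v hv => ?_).ne
        rw [(hGm v hv).2]
        exact measure_Ioc_lt_top
    rw [Real.volume_real_Ioc_of_le (Nat.cast_nonneg _), sub_zero] at h1
    have h2 : S' u + ∑ v ∈ W, S' v ≤ k (part u) := by
      refine le_trans (le_of_eq ?_) hmass
      rw [mass, hW]
      by_cases hu : u ∈ S'.support.filter fun v => part v = part u
      · exact Finset.add_sum_erase _ _ hu
      · rw [Finset.erase_eq_of_notMem hu]
        have : S' u = 0 := by simpa using hu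
        rw [this, zero_add]
    linarith
  obtain ⟨φ, hφE, hφinj, hφvol, hφLC⟩ := exists_packing hEm hELC hEsub hvol
  have hcross : ∀ v, v ≠ u → part v = part u → ∀ t ∈ Ioc 0 (S' u), ∀ τ ∈ Ioc 0 (S' v),
      φ t ≠ pos v τ := fun v hvu hv t ht τ hτ h => by
    refine (hφE t ht).2 (mem_biUnion (x := v) ?_ ⟨τ, hτ, h.symm⟩)
    simp only [hW, Finset.mem_coe, Finset.mem_erase, Finset.mem_filter, Finsupp.mem_support_iff]
    exact ⟨hvu, (hτ.1.trans_le hτ.2).ne', hv⟩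
  have hsub : ∀ v, v ≠ u → Ioc 0 (S' v) ⊆ Ioc 0 (S v) := fun v hv =>
    Ioc_subset_Ioc_right (hle v hv)
  refine ⟨Function.update pos u φ, ⟨⟨fun v t ht => ?_, fun v v' hvv t ht τ hτ h => ?_,
    fun v B hB hBm => ?_⟩, fun v r hr => ?_⟩, fun v hv => Function.update_of_ne hv _ _⟩
  · by_cases hv : v = u
    · subst hv
      rw [Function.update_self]
      exact hEsub (hφE t ht)
    · rw [Function.update_of_ne hv]
      exact hp.mem v t (hsub v hv ht)
  · by_cases hv : v = u
    · subst hv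
      by_cases hv' : v' = v
      · subst hv'
        rw [Function.update_self] at h
        exact ⟨rfl, hφinj ht hτ h⟩
      · rw [Function.update_self, Function.update_of_ne hv'] at h
        exact absurd h (hcross v' hv' hvv.symm t ht τ hτ)
    · by_cases hv' : v' = u
      · subst hv'
        rw [Function.update_self, Function.update_of_ne hv] at h
        exact absurd h.symm (hcross v hv hvv τ hτ t ht)
      · rw [Function.update_of_ne hv, Function.update_of_ne hv'] at h
        exact hp.injective v v' hvv t (hsub v hv ht) τ (hsub v' hv' hτ) h
  · by_cases hv : v = u
    · subst hv
      rw [Function.update_self]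
      exact hφvol B hB hBm
    · rw [Function.update_of_ne hv]
      exact hp.measure v B (hB.trans (hsub v hv)) hBm
  · by_cases hv : v = u
    · subst hv
      rw [Function.update_self]
      exact hφLC r hr
    · rw [Function.update_of_ne hv]
      exact hp.leftClopen v r (hr.trans (hle v hv))

end

end OnlineSubmodular

end

noncomputable section

namespace OnlineSubmodular

/-! ### Rounding -/

open MeasureTheory ProbabilityTheory

variable {Ω ι : Type*}

lemma mean_zero (U : Finset Ω) (g : Finset Ω → ℝ) : mean U (fun _ => 0) g = g ∅ := by
  induction U using Finset.induction_on with
  | empty => simp [mean]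
  | insert a U ha ih => rw [mean_insert ha, ih]; simp

section

variable {Z : Type*} [MeasurableSpace Z] {U : Finset Ω} {ρ : Z → Finset Ω}

lemma measurableSet_eq_of_mem (hU : ∀ z, ρ z ⊆ U) (hm : ∀ u ∈ U, MeasurableSet {z | u ∈ ρ z})
    (X : Finset Ω) : MeasurableSet {z | ρ z = X} := by
  by_cases hX : X ⊆ U
  · have : {z | ρ z = X} = ⋂ u ∈ U, {z | u ∈ ρ z ↔ u ∈ X} := by
      ext z
      simp only [Set.mem_ofPred_eq, Set.mem_iInter]
      refine ⟨fun h u _ => by rw [h], fun h => Finset.ext fun u => ?_⟩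
      by_cases hu : u ∈ U
      · exact h u hu
      · exact ⟨fun h' => absurd (hU z h') hu, fun h' => absurd (hX h') hu⟩
    rw [this]
    refine Finset.measurableSet_biInter U fun u hu => ?_
    by_cases huX : u ∈ X
    · simpa [huX] using hm u hu
    · simp only [huX, iff_false]
      exact (hm u hu).compl
  · have : {z | ρ z = X} = ∅ := by
      ext z
      simp only [Set.mem_ofPred_eq, Set.mem_empty_iff_false, iff_false]
      exact fun h => hX (h ▸ hU z)
    rw [this]
    exact MeasurableSet.empty

lemma measurable_comp_of_mem (hU : ∀ z, ρ z ⊆ U) (hm : ∀ u ∈ U, MeasurableSet {z | u ∈ ρ z})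
    (g : Finset Ω → ℝ) : Measurable fun z => g (ρ z) := by
  intro T _
  have : (fun z => g (ρ z)) ⁻¹' T = ⋃ X ∈ U.powerset.filter (fun X => g X ∈ T), {z | ρ z = X} := by
    ext z
    simp only [Set.mem_preimage, Finset.mem_filter, Finset.mem_powerset, Set.mem_iUnion,
      Set.mem_ofPred_eq, exists_prop]
    exact ⟨fun h => ⟨ρ z, ⟨hU z, h⟩, rfl⟩, fun ⟨X, h, e⟩ => e ▸ h.2⟩
  rw [this]
  exact Finset.measurableSet_biUnion _ fun X _ => measurableSet_eq_of_mem hU hm X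

lemma integrable_comp_of_mem {μ : Measure Z} [IsFiniteMeasure μ] (hU : ∀ z, ρ z ⊆ U)
    (hm : ∀ u ∈ U, MeasurableSet {z | u ∈ ρ z}) (g : Finset Ω → ℝ) :
    Integrable (fun z => g (ρ z)) μ := by
  refine Integrable.of_bound (measurable_comp_of_mem hU hm g).aestronglyMeasurable
    (∑ X ∈ U.powerset, |g X|) (Filter.Eventually.of_forall fun z => ?_)
  exact Finset.single_le_sum (f := fun X => |g X|) (fun X _ => abs_nonneg _)
    (Finset.mem_powerset.2 (hU z))

end

/-- The elements of `U` of which the region contains one of the points. -/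
def hits {κ : Type*} (U : Finset Ω) (part : Ω → ι) (I : Ω → Set ℝ) (l : κ → ι) (z : κ → ℝ) :
    Finset Ω :=
  U.filter fun u => ∃ p, l p = part u ∧ z p ∈ I u

section

variable {κ : Type*} {U : Finset Ω} {part : Ω → ι} {I : Ω → Set ℝ} {l : κ → ι}

lemma hits_subset (z : κ → ℝ) : hits U part I l z ⊆ U := Finset.filter_subset _ _

lemma measurableSet_mem_hits [Finite κ] (hI : ∀ u ∈ U, MeasurableSet (I u)) :
    ∀ u ∈ U, MeasurableSet {z : κ → ℝ | u ∈ hits U part I l z} := by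
  intro u hu
  have : {z : κ → ℝ | u ∈ hits U part I l z}
      = ⋃ p : κ, {z | l p = part u} ∩ (fun z : κ → ℝ => z p) ⁻¹' I u := by
    ext z
    simp [hits, hu]
  rw [this]
  exact MeasurableSet.iUnion fun p =>
    (MeasurableSet.const _).inter (measurable_pi_apply p (hI u hu))

/-- The regions of the part of a are disjoint at `z a`, so the additional point brings in at most
one element and at most one indicator is nonzero. -/
lemma apply_hits_insert {g : Finset Ω → ℝ} {J : Finset κ} {a : κ} (z : κ → ℝ)
    (hdisj : ∀ u ∈ U, ∀ v ∈ U, part u = l a → part v = l a → z a ∈ I u → z a ∈ I v → u = v) :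
    g (hits U part I (fun p : ↥(insert a J) => l p) (fun p => z p))
      = g (hits U part I (fun p : J => l p) (fun p => z p))
        + ∑ u ∈ U.filter (fun u => part u = l a), (I u).indicator 1 (z a)
          * gain g u (hits U part I (fun p : J => l p) (fun p => z p)) := by
  set X := hits U part I (fun p : J => l p) (fun p => z p) with hX
  have hmem : ∀ v, v ∈ hits U part I (fun p : ↥(insert a J) => l p) (fun p => z p)
      ↔ (v ∈ U ∧ l a = part v ∧ z a ∈ I v) ∨ v ∈ X := by
    intro v
    simp only [hX, hits, Finset.mem_filter, Subtype.exists, Finset.mem_insert]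
    constructor
    · rintro ⟨hv, p, rfl | hp, h⟩
      · exact Or.inl ⟨hv, h⟩
      · exact Or.inr ⟨hv, p, hp, h⟩
    · rintro (⟨hv, h⟩ | ⟨hv, p, hp, h⟩)
      · exact ⟨hv, a, Or.inl rfl, h⟩
      · exact ⟨hv, p, Or.inr hp, h⟩
  by_cases h : ∃ u ∈ U, part u = l a ∧ z a ∈ I u
  · obtain ⟨u, hu, hpu, hzu⟩ := h
    have e : hits U part I (fun p : ↥(insert a J) => l p) (fun p => z p) = insert u X := by
      ext v
      rw [hmem, Finset.mem_insert]
      refine or_congr_left ⟨fun ⟨h1, h2, h3⟩ => hdisj v h1 u hu h2.symm hpu h3 hzu, ?_⟩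
      rintro rfl
      exact ⟨hu, hpu.symm, hzu⟩
    rw [e, Finset.sum_eq_single_of_mem u (by simp [hu, hpu]) fun v hv hvu => ?_]
    · simp [hzu, gain]
    · rw [Finset.mem_filter] at hv
      rw [Set.indicator_of_notMem (fun hzv => hvu (hdisj v hv.1 u hu hv.2 hpu hzv hzu)), zero_mul]
  · push Not at h
    have e : hits U part I (fun p : ↥(insert a J) => l p) (fun p => z p) = X := by
      ext v
      rw [hmem]
      exact ⟨fun h' => h'.elim (fun ⟨h1, h2, h3⟩ => absurd h3 (h v h1 h2.symm)) id, Or.inr⟩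
    rw [e, Finset.sum_eq_zero fun v hv => ?_, add_zero]
    rw [Finset.mem_filter] at hv
    rw [Set.indicator_of_notMem (h v hv.1 hv.2), zero_mul]

/-- Independent points, each of which hits at most one of the disjoint regions of its part, are
worth at least what independent sampling with the same rates is. -/
theorem mean_le_integral_hits [Fintype κ] {μ : κ → Measure ℝ} [∀ p, IsProbabilityMeasure (μ p)]
    (hI : ∀ u ∈ U, MeasurableSet (I u))
    (hdisj : ∀ u ∈ U, ∀ v ∈ U, part u = part v → u ≠ v → Disjoint (I u) (I v))
    {y : Ω → ℝ} (hμ : ∀ p, ∀ u ∈ U, part u = l p → (μ p).real (I u) = y u)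
    (J : Finset κ) {g : Finset Ω → ℝ} (hg : IsMonotoneSubmodular g) :
    mean U (fun u => ∑ p ∈ J, if part u = l p then y u else 0) g
      ≤ ∫ z, g (hits U part I (fun p : J => l p) (fun p => z p)) ∂(Measure.pi μ) := by
  -- The function g varies, because the hypothesis is used for g and for each R ↦ g ({u} ∪ R).
  induction J using Finset.induction_on generalizing g with
  | empty =>
    have : ∀ z : κ → ℝ, hits U part I (fun p : (∅ : Finset κ) => l p) (fun p => z p) = ∅ := by
      intro z
      simp [hits]
    simp only [this, Finset.sum_empty, mean_zero]
    simp
  | insert a J ha ih =>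
    set X : (κ → ℝ) → Finset Ω := fun z => hits U part I (fun p : J => l p) (fun p => z p) with hX
    set xJ : Ω → ℝ := fun u => ∑ p ∈ J, if part u = l p then y u else 0 with hxJ
    set Ua := U.filter (fun u => part u = l a) with hUa
    set q : Ω → ℝ := fun u => if part u = l a then y u else 0 with hq
    have hUaU : ∀ {u}, u ∈ Ua → u ∈ U ∧ part u = l a := fun {u} hu => by
      rwa [hUa, Finset.mem_filter] at hu
    have hq0 : ∀ u ∈ U, 0 ≤ q u := fun u hu => by
      simp only [hq]
      split_ifs with h
      · rw [← hμ a u hu h]; exact measureReal_nonneg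
      · exact le_rfl
    have hxJ0 : ∀ u ∈ U, 0 ≤ xJ u := fun u hu => Finset.sum_nonneg fun p _ => by
      split_ifs with h
      · rw [← hμ p u hu h]; exact measureReal_nonneg
      · exact le_rfl
    have hXU : ∀ z, X z ⊆ U := fun z => hits_subset _
    have hXm : ∀ u ∈ U, MeasurableSet {z | u ∈ X z} := fun u hu =>
      (measurable_pi_lambda (fun (z : κ → ℝ) (p : J) => z p) fun p => measurable_pi_apply _)
        (measurableSet_mem_hits (l := fun p : J => l p) hI u hu)
    have hint : ∀ g' : Finset Ω → ℝ, Integrable (fun z => g' (X z)) (Measure.pi μ) := fun g' =>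
      integrable_comp_of_mem hXU hXm g'
    -- The new point is independent of X, which depends only on the points in J.
    have hindep : ∀ u ∈ Ua, ∫ z, (I u).indicator 1 (z a) * gain g u (X z) ∂(Measure.pi μ)
        = y u * ∫ z, gain g u (X z) ∂(Measure.pi μ) := by
      intro u hu
      obtain ⟨huU, hup⟩ := hUaU hu
      have h1 := (iIndepFun_pi (μ := μ) (X := fun _ x => x) fun _ => aemeasurable_id).indepFun_finset
        {a} J (Finset.disjoint_singleton_left.2 ha) fun i => measurable_pi_apply i
      have hφ : Measurable fun w : ({a} : Finset κ) → ℝ =>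
          (I u).indicator (1 : ℝ → ℝ) (w ⟨a, Finset.mem_singleton_self a⟩) :=
        (measurable_one.indicator (hI u huU)).comp (measurable_pi_apply _)
      have hψ : Measurable fun w : J → ℝ => gain g u (hits U part I (fun p : J => l p) w) :=
        measurable_comp_of_mem (fun w => hits_subset w) (measurableSet_mem_hits hI) _
      have h2 := h1.comp hφ hψ
      have h3 : ∫ z : κ → ℝ, (I u).indicator (1 : ℝ → ℝ) (z a) ∂(Measure.pi μ) = y u := by
        have hf : AEStronglyMeasurable ((I u).indicator (1 : ℝ → ℝ))
            (Measure.map (Function.eval a) (Measure.pi μ)) :=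
          (measurable_one.indicator (hI u huU)).aestronglyMeasurable
        have h4 := integral_map (measurePreserving_eval μ a).aemeasurable hf
        rw [(measurePreserving_eval μ a).map_eq, integral_indicator_one (hI u huU), hμ a u huU hup]
          at h4
        exact h4.symm
      rw [← h3]
      exact h2.integral_fun_mul_eq_mul_integral
        ((measurable_one.indicator (hI u huU)).comp (measurable_pi_apply a)).aestronglyMeasurable
        (measurable_comp_of_mem hXU hXm (gain g u)).aestronglyMeasurable
    have hi1 : ∀ u ∈ Ua, Integrable (fun z => (I u).indicator 1 (z a) * gain g u (X z))
        (Measure.pi μ) := fun u hu => by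
      refine (hint (gain g u)).bdd_mul (c := 1)
        ((measurable_one.indicator (hI u (hUaU hu).1)).comp
          (measurable_pi_apply a)).aestronglyMeasurable (Filter.Eventually.of_forall fun z => ?_)
      simp only [Set.indicator_apply]
      split_ifs <;> simp
    have hE : ∫ z, g (hits U part I (fun p : ↥(insert a J) => l p) (fun p => z p)) ∂(Measure.pi μ)
        = ∫ z, g (X z) ∂(Measure.pi μ) + ∑ u ∈ Ua, y u *
          (∫ z, g (insert u (X z)) ∂(Measure.pi μ) - ∫ z, g (X z) ∂(Measure.pi μ)) := by
      rw [integral_congr_ae (Filter.Eventually.of_forall fun z => apply_hits_insert z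
        fun u hu v hv h1 h2 h3 h4 => by
          by_contra hne
          exact Set.disjoint_left.1 (hdisj u hu v hv (h1.trans h2.symm) hne) h3 h4)]
      rw [integral_add (hint g) (integrable_finsetSum _ hi1), integral_finsetSum _ hi1]
      congr 1
      refine Finset.sum_congr rfl fun u hu => ?_
      rw [hindep u hu]
      unfold gain
      rw [integral_sub (hint fun R => g (insert u R)) (hint g)]
    have hsum1 : ∑ u ∈ Ua, y u ≤ 1 := by
      rw [Finset.sum_congr rfl fun u hu => (hμ a u (hUaU hu).1 (hUaU hu).2).symm,
        ← measureReal_biUnion_finset (fun u hu v hv huv => hdisj u (hUaU hu).1 v (hUaU hv).1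
          ((hUaU hu).2.trans (hUaU hv).2.symm) huv) fun u hu => hI u (hUaU hu).1]
      exact measureReal_le_one
    -- The sampling with all the rates is split: q comes from the new point, and G averages over the
    -- sampling that belongs to J.
    set G : Finset Ω → ℝ := fun B => mean U xJ (fun R => g (B ∪ R)) with hG
    have hGm : IsMonotoneSubmodular G := hg.mean_union U hxJ0
    have hGe : G ∅ ≤ ∫ z, g (X z) ∂(Measure.pi μ) := by
      simp only [hG, Finset.empty_union]
      exact ih hg
    have hGu : ∀ u, G {u} ≤ ∫ z, g (insert u (X z)) ∂(Measure.pi μ) := fun u => by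
      have := ih (hg.union_left {u})
      simpa only [hG, Finset.singleton_union] using this
    have hmain : mean U (fun u => ∑ p ∈ insert a J, if part u = l p then y u else 0) g
        = mean U q G := by
      rw [hG, mean_mean_union]
      refine mean_congr (fun u _ => ?_) fun _ _ => rfl
      rw [Finset.sum_insert ha]
    rw [hmain, hE]
    refine (hGm.mean_le_sum hq0).trans ?_
    have e1 : ∑ u ∈ U, q u * (G {u} - G ∅) = ∑ u ∈ Ua, y u * (G {u} - G ∅) := by
      rw [hUa, Finset.sum_filter]
      refine Finset.sum_congr rfl fun u _ => ?_
      simp only [hq]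
      split_ifs <;> simp
    have e2 : ∀ (α β : ℝ) (F : Ω → ℝ), α + ∑ u ∈ Ua, y u * (F u - β)
        = α - (∑ u ∈ Ua, y u) * β + ∑ u ∈ Ua, y u * F u := fun α β F => by
      simp only [mul_sub, Finset.sum_sub_distrib, Finset.sum_mul]
      ring
    rw [e1, e2, e2 _ _ fun u => ∫ z, g (insert u (X z)) ∂(Measure.pi μ)]
    have e3 : ∑ u ∈ Ua, y u * G {u} ≤ ∑ u ∈ Ua, y u * ∫ z, g (insert u (X z)) ∂(Measure.pi μ) :=
      Finset.sum_le_sum fun u hu => mul_le_mul_of_nonneg_left (hGu u) (by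
        rw [← hμ a u (hUaU hu).1 (hUaU hu).2]; exact measureReal_nonneg)
    -- Both sides are combinations with weights 1 - ∑ y and y u. The weights are nonnegative since
    -- the new point hits at most one region, so the comparisons `hGe` and `hGu` can be combined.
    nlinarith [mul_le_mul_of_nonneg_left hGe (sub_nonneg.2 hsum1)]

end

section

variable {part : Ω → ι} {k : ι → ℕ} {S : Ω →₀ ℝ} {pos : Ω → ℝ → ℝ}

lemma rounded_eq_hits (z : (Σ l, Fin (k l)) → ℝ) :
    rounded part k S pos z
      = hits S.support part (fun u => pos u '' Set.Ioc 0 (S u)) Sigma.fst z := by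
  ext u
  simp only [rounded, hits, Finset.mem_filter, and_congr_right_iff]
  intro _
  constructor
  · rintro ⟨t, ht, i, h⟩
    exact ⟨⟨part u, i⟩, rfl, t, ht, h⟩
  · rintro ⟨⟨_, i⟩, rfl, t, ht, h⟩
    exact ⟨t, ht, i, h⟩

lemma IsStored.measurableSet_rounded [Finite ι] (hp : IsStored part k S pos) (X : Finset Ω) :
    MeasurableSet {z | rounded part k S pos z = X} := by
  simp only [rounded_eq_hits]
  exact measurableSet_eq_of_mem (fun z => hits_subset z) (measurableSet_mem_hits fun u _ =>
    (hp.measure u _ subset_rfl measurableSet_Ioc).1) X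

/-- By injectivity of the storage map a point selects at most one element, and part l has only k l
points. -/
lemma IsStored.indep_rounded (hp : IsStored part k S pos) (z : (Σ l, Fin (k l)) → ℝ) :
    Indep part k (rounded part k S pos z) := by
  intro l
  have h : ∀ u ∈ (rounded part k S pos z).filter (fun u => part u = l),
      ∃ i : Fin (k l), ∃ t ∈ Set.Ioc 0 (S u), pos u t = z ⟨l, i⟩ := by
    intro u hu
    simp only [rounded, Finset.mem_filter] at hu
    obtain ⟨⟨_, t, ht, i, hi⟩, rfl⟩ := hu
    exact ⟨i, t, ht, hi⟩
  rcases Nat.eq_zero_or_pos (k l) with h0 | h0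
  · rw [Finset.eq_empty_of_forall_notMem fun u hu => Fin.elim0 (h0 ▸ (h u hu).choose)]
    simp
  · have : Nonempty (Fin (k l)) := ⟨⟨0, h0⟩⟩
    choose! i t ht hi using h
    have := Finset.card_le_card_of_injOn i (t := Finset.univ) (fun u _ => Finset.mem_univ _)
      fun u hu v hv huv => (hp.injective u v
        ((Finset.mem_filter.1 hu).2.trans (Finset.mem_filter.1 hv).2.symm) _ (ht u hu) _ (ht v hv)
        (by rw [hi u hu, hi v hv, huv])).1
    simpa using this

theorem IsStored.fhat_le_integral_rounded [Fintype ι] (hp : IsStored part k S pos) (hS : ∀ v, 0 ≤ S v)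
    (hk : ∀ u, 0 < k (part u)) {f : Finset Ω → ℝ} (hf : IsMonotoneSubmodular f) :
    fhat f S ≤ ∫ z, f (rounded part k S pos z) ∂(seedMeasure k) := by
  have hprob : ∀ p : Σ l, Fin (k l), IsProbabilityMeasure
      (volume[|Set.Ioc 0 (k p.1 : ℝ)]) := fun p => by
    have h0 : 0 < k p.1 := Fin.pos p.2
    refine cond_isProbabilityMeasure_of_finite ?_ measure_Ioc_lt_top.ne
    rw [Real.volume_Ioc]
    simpa using h0.ne'
  have hI : ∀ u ∈ S.support, MeasurableSet (pos u '' Set.Ioc 0 (S u)) := fun u _ =>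
    (hp.measure u _ subset_rfl measurableSet_Ioc).1
  have key := mean_le_integral_hits (U := S.support) (part := part)
    (I := fun u => pos u '' Set.Ioc 0 (S u)) (l := fun p : Σ l, Fin (k l) => p.1)
    (μ := fun p => volume[|Set.Ioc 0 (k p.1 : ℝ)]) hI
    (fun u _ v _ h huv => Set.disjoint_left.2 fun x => by
      rintro ⟨t, ht, rfl⟩ ⟨τ, hτ, h'⟩
      exact huv (hp.injective u v h t ht τ hτ h'.symm).1)
    -- Each of the `k (part u)` points contributes this rate, and the total is S u.
    (y := fun u => S u / k (part u)) (fun p u hu h => ?_) Finset.univ hf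
  · refine le_of_eq_of_le ?_ (key.trans_eq ?_)
    · rw [fhat_eq_mean subset_rfl]
      refine mean_congr (fun u _ => ?_) fun _ _ => rfl
      have hk0 : (k (part u) : ℝ) ≠ 0 := by exact_mod_cast (hk u).ne'
      rw [Fintype.sum_sigma, Finset.sum_eq_single (part u)]
      · simp
        field_simp
      · intro l _ hl
        simp [hl.symm]
      · simp
    · refine integral_congr_ae (Filter.Eventually.of_forall fun z => ?_)
      simp only [rounded_eq_hits]
      congr 1
      simp [hits]
  · obtain ⟨p1, p2⟩ := p
    simp only at h
    subst h
    have hsub : pos u '' Set.Ioc 0 (S u) ⊆ Set.Ioc 0 (k (part u) : ℝ) := by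
      rintro _ ⟨t, ht, rfl⟩
      exact hp.mem u t ht
    rw [measureReal_def, cond_apply measurableSet_Ioc, Set.inter_eq_right.2 hsub,
      (hp.measure u _ subset_rfl measurableSet_Ioc).2, Real.volume_Ioc, Real.volume_Ioc]
    simp only [sub_zero, ENNReal.toReal_mul, ENNReal.toReal_inv, ENNReal.toReal_ofReal (hS u),
      ENNReal.toReal_ofReal (Nat.cast_nonneg _)]
    rw [div_eq_inv_mul]

end

end OnlineSubmodular

end

noncomputable section

namespace OnlineSubmodular

/-! ### Draining a full part from its smallest value upwards -/

open Filter Topology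

variable {Ω : Type*}

/-- What remains of the amount `b` of an element of initial value `exp a` when all the pairs of
value less than `exp L` are dropped. -/
def drain (a b L : ℝ) : ℝ := min b (max 0 (a - L))

lemma drain_nonneg {b : ℝ} (hb : 0 ≤ b) (a L : ℝ) : 0 ≤ drain a b L :=
  le_min hb (le_max_left _ _)

lemma drain_le (a b L : ℝ) : drain a b L ≤ b := min_le_left _ _

lemma drain_antitone (a b : ℝ) : Antitone (drain a b) := fun _ _ h =>
  min_le_min_left _ (max_le_max_left _ (by linarith))

section

variable {V : Finset Ω} {a b : Ω → ℝ}

lemma exists_sum_drain_eq (hb : ∀ v ∈ V, 0 ≤ b v) {y : ℝ} (hy0 : 0 ≤ y) (hy : y ≤ ∑ v ∈ V, b v) :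
    ∃ L, ∑ v ∈ V, drain (a v) (b v) L = y := by
  have hc : Continuous fun L => ∑ v ∈ V, drain (a v) (b v) L := by
    unfold drain
    fun_prop
  set M := ∑ v ∈ V, (|a v| + b v) with hM
  have hMv : ∀ v ∈ V, |a v| + b v ≤ M := fun v hv =>
    Finset.single_le_sum (f := fun v => |a v| + b v)
      (fun w hw => add_nonneg (abs_nonneg _) (hb w hw)) hv
  have hM0 : 0 ≤ M := Finset.sum_nonneg fun w hw => add_nonneg (abs_nonneg _) (hb w hw)
  have h1 : ∑ v ∈ V, drain (a v) (b v) (-M) = ∑ v ∈ V, b v :=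
    Finset.sum_congr rfl fun v hv => min_eq_left (le_max_of_le_right (by
      linarith [hMv v hv, neg_abs_le (a v)]))
  have h2 : ∑ v ∈ V, drain (a v) (b v) M = 0 := Finset.sum_eq_zero fun v hv => by
    rw [drain, max_eq_left (by linarith [hMv v hv, le_abs_self (a v), hb v hv]),
      min_eq_right (hb v hv)]
  obtain ⟨L, -, hL⟩ := intermediate_value_Icc' (by linarith : -M ≤ M) hc.continuousOn
    (show y ∈ Set.Icc _ _ by rw [h1, h2]; exact ⟨hy0, hy⟩)
  exact ⟨L, hL⟩

/-- All amounts move in the same direction, so each moves by at most the total. Hence the amounts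
are determined by their sum and are Lipschitz in it, although the level L itself need not be unique.
-/
lemma abs_drain_sub_le {L L' : ℝ} {v : Ω} (hv : v ∈ V) :
    |drain (a v) (b v) L - drain (a v) (b v) L'|
      ≤ |∑ v ∈ V, drain (a v) (b v) L - ∑ v ∈ V, drain (a v) (b v) L'| := by
  wlog h : L' ≤ L generalizing L L'
  · rw [abs_sub_comm, abs_sub_comm (∑ v ∈ V, _)]
    exact this (not_le.1 h).le
  · rw [abs_sub_comm, abs_sub_comm (∑ v ∈ V, _), ← Finset.sum_sub_distrib,
      abs_of_nonneg (sub_nonneg.2 (drain_antitone _ _ h)),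
      abs_of_nonneg (Finset.sum_nonneg fun w _ => sub_nonneg.2 (drain_antitone _ _ h))]
    exact Finset.single_le_sum (f := fun v => drain (a v) (b v) L' - drain (a v) (b v) L)
      (fun w _ => sub_nonneg.2 (drain_antitone _ _ h)) hv

lemma drain_eq_of_sum_eq {L L' : ℝ}
    (h : ∑ v ∈ V, drain (a v) (b v) L = ∑ v ∈ V, drain (a v) (b v) L') {v : Ω} (hv : v ∈ V) :
    drain (a v) (b v) L = drain (a v) (b v) L' := by
  have := abs_drain_sub_le (a := a) (b := b) (L := L) (L' := L') hv
  rw [h, sub_self, abs_zero] at this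
  exact sub_eq_zero.1 (abs_nonpos_iff.1 this)

end

/-- The elements of positive amount with the smallest `a - z`. -/
def bottom (V : Finset Ω) (a z : Ω → ℝ) : Finset Ω :=
  V.filter fun v => 0 < z v ∧ ∀ x ∈ V, 0 < z x → a v - z v ≤ a x - z x

section

variable {V : Finset Ω} {a b : Ω → ℝ}

lemma bottom_nonempty {z : Ω → ℝ} (h : 0 < ∑ v ∈ V, z v) : (bottom V a z).Nonempty := by
  obtain ⟨w, hw, hw0⟩ := Finset.exists_lt_of_sum_lt (s := V) (f := fun _ => 0) (g := z) (by simpa)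
  obtain ⟨v, hv, hmin⟩ := Finset.exists_min_image (V.filter fun v => 0 < z v)
    (fun v => a v - z v) ⟨w, Finset.mem_filter.2 ⟨hw, hw0⟩⟩
  rw [Finset.mem_filter] at hv
  exact ⟨v, Finset.mem_filter.2 ⟨hv.1, hv.2, fun x hx hx0 =>
    hmin x (Finset.mem_filter.2 ⟨hx, hx0⟩)⟩⟩

/-- Raising the water level a little shrinks the bottom elements at equal speed. -/
lemma exists_drain_shift {L : ℝ} (hb : ∀ v ∈ V, 0 ≤ b v) {z : Ω → ℝ}
    (hz : ∀ v ∈ V, z v = drain (a v) (b v) L) (hT : (bottom V a z).Nonempty) :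
    ∃ L', ∀ᶠ ε in 𝓝[≥] (0 : ℝ), ∀ v ∈ V,
      drain (a v) (b v) (L' + ε) = if v ∈ bottom V a z then z v - ε else z v := by
  obtain ⟨w, hw⟩ := hT
  have hw' := hw
  rw [bottom, Finset.mem_filter] at hw'
  obtain ⟨hwV, hw0, hwmin⟩ := hw'
  have hpos : ∀ v ∈ V, 0 < z v → z v ≤ a v - L := fun v hv h => by
    have h1 : z v ≤ max 0 (a v - L) := by rw [hz v hv]; exact min_le_right _ _
    rcases le_max_iff.1 h1 with h2 | h2
    · linarith
    · exact h2
  have hLL : L ≤ a w - z w := by linarith [hpos w hwV hw0]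
  -- The highest level that leaves z unchanged. It may exceed L when no remaining value lies between
  -- the two.
  refine ⟨a w - z w, (eventually_all_finset V).2 fun v hv => ?_⟩
  by_cases hvT : v ∈ bottom V a z
  · have hvT' := hvT
    rw [bottom, Finset.mem_filter] at hvT'
    obtain ⟨-, hv0, hvmin⟩ := hvT'
    have e : a w - z w = a v - z v := le_antisymm (hwmin v hv hv0) (hvmin w hwV hw0)
    have h1 : ∀ᶠ ε in 𝓝[≥] (0 : ℝ), ε < z v := (gt_mem_nhds hv0).filter_mono nhdsWithin_le_nhds
    filter_upwards [h1, self_mem_nhdsWithin] with ε hε hε0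
    have hε0' : 0 ≤ ε := hε0
    have hzb : z v ≤ b v := by rw [hz v hv]; exact drain_le _ _ _
    rw [if_pos hvT, drain, e, max_eq_right (by linarith), min_eq_right (by linarith)]
    ring
  · simp only [if_neg hvT]
    rcases (show 0 ≤ z v by rw [hz v hv]; exact drain_nonneg (hb v hv) _ _).eq_or_lt with h0 | h0
    · filter_upwards [self_mem_nhdsWithin] with ε hε0
      have hε0' : 0 ≤ ε := hε0
      refine le_antisymm ?_ (h0 ▸ drain_nonneg (hb v hv) _ _)
      rw [hz v hv]
      exact drain_antitone _ _ (by linarith)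
    · have hlt : a w - z w < a v - z v := by
        by_contra hn
        refine hvT (Finset.mem_filter.2 ⟨hv, h0, fun x hx hx0 => ?_⟩)
        exact (not_lt.1 hn).trans (hwmin x hx hx0)
      -- A partly drained element would sit exactly at level L ≤ a w - z w and so belong to the
      -- bottom.
      have hzb : z v = b v := by
        by_contra hn
        have h1 : z v = min (b v) (max 0 (a v - L)) := hz v hv
        rcases min_choice (b v) (max 0 (a v - L)) with h2 | h2
        · exact hn (h1.trans h2)
        · rw [h2] at h1
          rcases max_choice 0 (a v - L) with h3 | h3 <;> rw [h3] at h1 <;> linarith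
      have h1 : ∀ᶠ ε in 𝓝[≥] (0 : ℝ), ε < (a v - z v) - (a w - z w) :=
        (gt_mem_nhds (by linarith)).filter_mono nhdsWithin_le_nhds
      filter_upwards [h1] with ε hε
      rw [drain, hzb]
      refine min_eq_left (le_max_of_le_right ?_)
      linarith

/-- The evolution of the other elements of a part of capacity `K` while a new element grows at unit
speed: nothing changes until the part is full; then the bottom elements shrink. -/
theorem exists_drain_path (hb : ∀ v ∈ V, 0 ≤ b v) {K : ℝ} (hbK : ∑ v ∈ V, b v ≤ K) :
    ∃ z : ℝ → Ω → ℝ,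
      (∀ t ≤ K, ∀ v ∈ V, 0 ≤ z t v ∧ z t v ≤ b v) ∧
      (∀ t ≤ K, ∑ v ∈ V, z t v = min (∑ v ∈ V, b v) (K - t)) ∧
      (∀ v ∈ V, z 0 v = b v) ∧
      (∀ v ∈ V, ContinuousOn (fun t => z t v) (Set.Iic K)) ∧
      (∀ t < K, ∑ v ∈ V, z t v + t < K → ∀ v ∈ V,
        HasDerivWithinAt (fun s => z s v) 0 (Set.Ici t) t) ∧
      (∀ t < K, ∑ v ∈ V, z t v + t = K → ∀ v ∈ V, HasDerivWithinAt (fun s => z s v)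
        (if v ∈ bottom V a (z t) then -(1 / (bottom V a (z t)).card) else 0) (Set.Ici t) t) := by
  have hB0 : 0 ≤ ∑ v ∈ V, b v := Finset.sum_nonneg hb
  -- While the arriving element has amount t, the others may keep K - t in total.
  have hex : ∀ t, ∃ L, t ≤ K → ∑ v ∈ V, drain (a v) (b v) L = min (∑ v ∈ V, b v) (K - t) := by
    intro t
    by_cases ht : t ≤ K
    · obtain ⟨L, hL⟩ := exists_sum_drain_eq (a := a) hb (le_min hB0 (sub_nonneg.2 ht))
        (min_le_left _ _)
      exact ⟨L, fun _ => hL⟩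
    · exact ⟨0, fun h => absurd h ht⟩
  choose L hL using hex
  have hfull : ∀ t ≤ K, ∑ v ∈ V, b v ≤ K - t → ∀ v ∈ V, drain (a v) (b v) (L t) = b v := by
    intro t ht h
    have h1 := hL t ht
    rw [min_eq_left h] at h1
    exact (Finset.sum_eq_sum_iff_of_le fun v _ => drain_le _ _ _).1 h1
  refine ⟨fun t v => drain (a v) (b v) (L t), fun t _ v hv => ⟨drain_nonneg (hb v hv) _ _,
    drain_le _ _ _⟩, hL, ?_, fun v hv => ?_, fun t ht h => ?_, fun t ht h v hv => ?_⟩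
  · exact hfull 0 (hB0.trans hbK) (by simpa using hbK)
  · refine LipschitzOnWith.continuousOn (K := 1) (LipschitzOnWith.of_dist_le_mul
      fun t ht s hs => ?_)
    rw [Real.dist_eq, Real.dist_eq, NNReal.coe_one, one_mul]
    refine (abs_drain_sub_le hv).trans ?_
    rw [hL t ht, hL s hs]
    refine (abs_min_sub_min_le_max _ _ _ _).trans ?_
    rw [sub_self, abs_zero, max_eq_right (abs_nonneg _), abs_sub_comm t s]
    exact le_of_eq (congrArg _ (by ring))
  · have hlt : ∑ v ∈ V, b v < K - t := by
      rw [hL t ht.le] at h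
      rcases min_choice (∑ v ∈ V, b v) (K - t) with h2 | h2 <;> rw [h2] at h <;> linarith
    intro v hv
    refine (hasDerivWithinAt_const t (Set.Ici t) (b v)).congr_of_eventuallyEq ?_
      (hfull t ht.le hlt.le v hv)
    have : ∀ᶠ s in 𝓝[≥] t, s < K - ∑ v ∈ V, b v :=
      (gt_mem_nhds (by linarith)).filter_mono nhdsWithin_le_nhds
    filter_upwards [this] with s hs
    exact hfull s (by linarith) (by linarith) v hv
  · set z : Ω → ℝ := fun v => drain (a v) (b v) (L t) with hz
    set T := bottom V a z with hT
    have hsum : ∑ v ∈ V, z v = K - t := by linarith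
    have hge : K - t ≤ ∑ v ∈ V, b v := by
      rw [← hsum, hz, hL t ht.le]
      exact min_le_left _ _
    have hTne : T.Nonempty := bottom_nonempty (by rw [hsum]; linarith)
    have hT0 : (0 : ℝ) < T.card := by exact_mod_cast hTne.card_pos
    obtain ⟨L', hL'⟩ := exists_drain_shift hb (fun _ _ => rfl) hTne
    have htend : Tendsto (fun s => (s - t) / T.card) (𝓝[≥] t) (𝓝[≥] 0) := by
      refine tendsto_nhdsWithin_iff.2 ⟨?_, ?_⟩
      · have : Continuous fun s => (s - t) / T.card := by fun_prop
        have := this.continuousWithinAt (s := Set.Ici t) (x := t)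
        simpa [ContinuousWithinAt] using this
      · filter_upwards [self_mem_nhdsWithin] with s hs
        exact div_nonneg (sub_nonneg.2 hs) hT0.le
    have hev : ∀ᶠ s in 𝓝[≥] t, drain (a v) (b v) (L s)
        = if v ∈ T then z v - (s - t) / T.card else z v := by
      have hK : ∀ᶠ s in 𝓝[≥] t, s < K := (gt_mem_nhds ht).filter_mono nhdsWithin_le_nhds
      filter_upwards [htend.eventually hL', hK, self_mem_nhdsWithin] with s hs hsK hst
      have hst' : t ≤ s := hst
      rw [← hs v hv]
      -- The chosen level L s and the shifted level L' + (s - t) / |T| leave the same total K - s,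
      -- hence the same amounts.
      refine drain_eq_of_sum_eq ?_ hv
      rw [hL s hsK.le, min_eq_right (by linarith), Finset.sum_congr rfl hs]
      have e : ∀ v, (if v ∈ T then z v - (s - t) / T.card else z v)
          = z v - if v ∈ T then (s - t) / T.card else 0 := fun v => by split_ifs <;> simp
      have hTV : V.filter (fun v => v ∈ T) = T := by
        ext x
        rw [Finset.mem_filter, and_iff_right_iff_imp, hT, bottom, Finset.mem_filter]
        exact fun h => h.1
      rw [Finset.sum_congr rfl fun v _ => e v, Finset.sum_sub_distrib, hsum, ← Finset.sum_filter,
        hTV, Finset.sum_const, nsmul_eq_mul, mul_div_cancel₀ _ hT0.ne']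
      ring
    have hd : HasDerivWithinAt (fun s => if v ∈ T then z v - (s - t) / T.card else z v)
        (if v ∈ T then -(1 / (T.card : ℝ)) else 0) (Set.Ici t) t := by
      by_cases hvT : v ∈ T
      · simp only [if_pos hvT]
        exact (((hasDerivWithinAt_id t _).sub_const t).div_const _).const_sub _
      · simp only [if_neg hvT]
        exact hasDerivWithinAt_const _ _ _
    exact hd.congr_of_eventuallyEq hev (by simp [hz])

end

end OnlineSubmodular

end

noncomputable section

namespace OnlineSubmodular

/-! ### One round of the continuous algorithm -/

variable {Ω ι : Type*}

/-- `α w(x) - w(y)` on the elements of `V`, when `w v τ = c v * exp (-τ)`. -/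
def surplus (α : ℝ) (V : Finset Ω) (c x y : Ω → ℝ) : ℝ :=
  α * ∑ v ∈ V, c v * (1 - Real.exp (-x v)) - ∑ v ∈ V, c v * (1 - Real.exp (-y v))

lemma surplus_insert {α : ℝ} {V : Finset Ω} {u : Ω} {c x y : Ω → ℝ} (hx : x u = 0) (hy : y u = 0) :
    surplus α (insert u V) c x y = surplus α V c x y := by
  by_cases hu : u ∈ V
  · rw [Finset.insert_eq_self.2 hu]
  · simp [surplus, Finset.sum_insert hu, hx, hy]

lemma surplus_congr {α : ℝ} {V : Finset Ω} {c c' x x' y y' : Ω → ℝ} (hc : ∀ v ∈ V, c v = c' v)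
    (hx : ∀ v ∈ V, x v = x' v) (hy : ∀ v ∈ V, y v = y' v) :
    surplus α V c x y = surplus α V c' x' y' := by
  have h1 : ∀ v ∈ V, c v * (1 - Real.exp (-x v)) = c' v * (1 - Real.exp (-x' v)) :=
    fun v hv => by rw [hc v hv, hx v hv]
  have h2 : ∀ v ∈ V, c v * (1 - Real.exp (-y v)) = c' v * (1 - Real.exp (-y' v)) :=
    fun v hv => by rw [hc v hv, hy v hv]
  rw [surplus, surplus, Finset.sum_congr rfl h1, Finset.sum_congr rfl h2]

lemma potential_insert {a κ M : ℝ} {V : Finset Ω} {u : Ω} {c x : Ω → ℝ} (hx : x u = 0) :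
    potential a κ M (insert u V) c x = potential a κ M V c x := by
  by_cases hu : u ∈ V
  · rw [Finset.insert_eq_self.2 hu]
  · simp [potential, level, Finset.sum_insert hu, hx, layer_zero]

lemma potential_congr {a κ M : ℝ} {V : Finset Ω} {c c' x x' : Ω → ℝ} (hc : ∀ v ∈ V, c v = c' v)
    (hx : ∀ v ∈ V, x v = x' v) : potential a κ M V c x = potential a κ M V c' x' := by
  have : ∀ θ, level κ V c x θ = level κ V c' x' θ := fun θ => by
    unfold level
    rw [Finset.sum_congr rfl fun v hv => by rw [hc v hv, hx v hv]]
  simp only [potential, this]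

lemma mass_eq_sum {part : Ω → ι} {l : ι} {S : Ω →₀ ℝ} {U : Finset Ω} (h : S.support ⊆ U) :
    mass part l S = ∑ v ∈ U.filter (fun v => part v = l), S v :=
  Finset.sum_subset (Finset.filter_subset_filter _ h) fun v hv hv' => by
    simp only [Finset.mem_filter, not_and] at hv hv'
    by_contra h0
    exact hv' (Finsupp.mem_support_iff.2 h0) hv.2

lemma integral_const_mul_exp_neg (c b : ℝ) :
    ∫ τ in (0 : ℝ)..b, c * Real.exp (-τ) = c * (1 - Real.exp (-b)) := by
  rw [intervalIntegral.integral_const_mul, intervalIntegral.integral_comp_neg (fun x => Real.exp x),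
    integral_exp]
  simp

lemma weight_eq_sum {part : Ω → ι} {l : ι} {w : Ω → ℝ → ℝ} {c : Ω → ℝ}
    (hw : ∀ v τ, w v τ = c v * Real.exp (-τ)) {B : Ω →₀ ℝ} {U : Finset Ω} (h : B.support ⊆ U) :
    weight part l w B
      = ∑ v ∈ U.filter (fun v => part v = l), c v * (1 - Real.exp (-B v)) := by
  simp only [weight, hw, integral_const_mul_exp_neg]
  refine Finset.sum_subset (Finset.filter_subset_filter _ h) fun v hv hv' => ?_
  simp only [Finset.mem_filter, not_and] at hv hv'
  have h0 : B v = 0 := by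
    by_contra h0
    exact hv' (Finsupp.mem_support_iff.2 h0) hv.2
  simp [h0]

/-- The properties of the state `σ` after the arrivals `h`. -/
structure Invariant (f : Finset Ω → ℝ) (part : Ω → ι) (k : ι → ℕ) (α : ℝ) (h : List Ω)
    (σ : State Ω) : Prop where
  S_nonneg : ∀ v, 0 ≤ σ.S v
  S_le : ∀ v, σ.S v ≤ σ.A v
  support : σ.A.support ⊆ h.toFinset
  w_eq : ∀ v τ, σ.w v τ = σ.w v 0 * Real.exp (-τ)
  w_nonneg : ∀ v, 0 ≤ σ.w v 0
  w_pos : ∀ v, 0 < σ.S v → 0 < σ.w v 0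
  mass_le : ∀ l, mass part l σ.S ≤ k l
  potential_le : ∀ l M, 0 < k l → 0 ≤ M →
    (∀ v ∈ h.toFinset.filter (fun v => part v = l), σ.w v 0 ≤ M) →
    potential (α - 2) (k l) M (h.toFinset.filter fun v => part v = l) (fun v => σ.w v 0) σ.S
      ≤ 1 / k l * surplus α (h.toFinset.filter fun v => part v = l) (fun v => σ.w v 0) σ.S σ.A
  stopped : ∀ u ∈ h, σ.w u (σ.A u) ≤ 1 / k (part u) *
    surplus α (h.toFinset.filter fun v => part v = part u) (fun v => σ.w v 0) σ.S σ.A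
  marginal_le : ∀ u ∈ h, fhat (gain f u) σ.A ≤ σ.w u (σ.A u)
  fhat_A : fhat f σ.A = f ∅ + ∑ u ∈ h.toFinset, σ.w u 0 * (1 - Real.exp (-σ.A u))
  le_fhat : ∀ X : Ω →₀ ℝ, (∀ v, 0 ≤ X v) → (∀ v, X v ≤ σ.A v) →
    f ∅ + ∑ u ∈ h.toFinset, σ.w u 0 * (1 - Real.exp (-X u)) ≤ fhat f X

lemma invariant_nil (f : Finset Ω → ℝ) (part : Ω → ι) (k : ι → ℕ) (α : ℝ) :
    Invariant f part k α [] ⟨0, 0, fun _ _ => 0⟩ where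
  S_nonneg v := le_rfl
  S_le v := le_rfl
  support := by simp
  w_eq v τ := by simp
  w_nonneg v := le_rfl
  w_pos v h := absurd h (lt_irrefl _)
  mass_le l := by simp [mass]
  potential_le l M _ _ _ := by simp [potential, level, surplus]
  stopped u hu := by simp at hu
  marginal_le u hu := by simp at hu
  fhat_A := by simp [fhat_zero]
  le_fhat X h0 hX := by
    have : X = 0 := Finsupp.ext fun v => le_antisymm (hX v) (h0 v)
    simp [this, fhat_zero]

lemma nonpos_of_hasDerivWithinAt_of_le {g : ℝ → ℝ} {g' t d : ℝ} (htd : t < d)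
    (hg : HasDerivWithinAt g g' (Set.Ici t) t) (hle : ∀ s ∈ Set.Ioo t d, g s ≤ g t) : g' ≤ 0 := by
  have hslope := (hasDerivWithinAt_iff_tendsto_slope' (s := Set.Ioi t) (by simp)).1
    (hg.mono Set.Ioi_subset_Ici_self)
  refine le_of_tendsto hslope ?_
  filter_upwards [Ioo_mem_nhdsGT htd] with s hs
  rw [slope_def_field]
  exact div_nonpos_of_nonpos_of_nonneg (sub_nonpos.2 (hle s hs)) (sub_nonneg.2 hs.1.le)

lemma rate_nonpos (part : Ω → ι) (k : ι → ℕ) (l : ι) (w : Ω → ℝ → ℝ) (S : Ω →₀ ℝ) (v : Ω) :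
    rate part k l w S v ≤ 0 := by
  unfold rate
  split_ifs
  · exact neg_nonpos.2 (div_nonneg (inv_nonneg.2 (abs_nonneg _))
      (Finset.sum_nonneg fun _ _ => inv_nonneg.2 (abs_nonneg _)))
  · exact le_rfl

section

variable {f : Finset Ω → ℝ} {part : Ω → ι} {k : ι → ℕ} {α d : ℝ} {h : List Ω} {σ : State Ω}
  {u : Ω} {s : ℝ → Ω →₀ ℝ}

lemma State.value_self (f : Finset Ω → ℝ) (σ : State Ω) (u : Ω) (τ : ℝ) :
    σ.value f u u τ = fhat (gain f u) σ.A * Real.exp (-τ) := by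
  rw [State.value, Function.update_self, marginal_add_single]

lemma State.value_of_ne (f : Finset Ω → ℝ) (σ : State Ω) {u v : Ω} (h : v ≠ u) :
    σ.value f u v = σ.w v := by
  rw [State.value, Function.update_of_ne h]

namespace Invariant

lemma A_nonneg (hI : Invariant f part k α h σ) (v : Ω) : 0 ≤ σ.A v :=
  (hI.S_nonneg v).trans (hI.S_le v)

lemma A_eq_zero (hI : Invariant f part k α h σ) {v : Ω} (hv : v ∉ h) : σ.A v = 0 := by
  by_contra hn
  exact hv (List.mem_toFinset.1 (hI.support (Finsupp.mem_support_iff.2 hn)))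

lemma S_eq_zero (hI : Invariant f part k α h σ) {v : Ω} (hv : v ∉ h) : σ.S v = 0 :=
  le_antisymm ((hI.S_le v).trans_eq (hI.A_eq_zero hv)) (hI.S_nonneg v)

lemma value_eq (hI : Invariant f part k α h σ) (v : Ω) (τ : ℝ) :
    σ.value f u v τ = σ.value f u v 0 * Real.exp (-τ) := by
  by_cases hv : v = u
  · subst hv
    simp [State.value_self]
  · rw [State.value_of_ne f σ hv]
    exact hI.w_eq v τ

lemma value_nonneg (hI : Invariant f part k α h σ) (hf : IsMonotoneSubmodular f) (v : Ω) :
    0 ≤ σ.value f u v 0 := by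
  by_cases hv : v = u
  · subst hv
    rw [State.value_self]
    exact mul_nonneg (hf.fhat_gain_nonneg _ hI.A_nonneg) (Real.exp_pos _).le
  · rw [State.value_of_ne f σ hv]
    exact hI.w_nonneg v

/-- The potential is nonnegative. Any common bound M of the values will do, as it only truncates the
integral. -/
lemma surplus_nonneg (hI : Invariant f part k α h σ) (hα : 2 < α) {l : ι} (hl : 0 < k l) :
    0 ≤ 1 / (k l : ℝ) * surplus α (h.toFinset.filter fun v => part v = l) (fun v => σ.w v 0)
      σ.S σ.A := by
  obtain ⟨M, hM⟩ := ((h.toFinset.image fun v => σ.w v 0) ∪ {0}).bddAbove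
  have hM0 : 0 ≤ M := hM (by simp)
  refine le_trans ?_ (hI.potential_le l M hl hM0 fun v hv => hM ?_)
  · exact intervalIntegral.integral_nonneg hM0 fun θ _ =>
      integrand_nonneg (by linarith) (by exact_mod_cast hl) (fun v _ => hI.w_nonneg v) θ
  · rw [Finset.mem_filter] at hv
    simp only [Finset.coe_union, Finset.coe_image, Set.mem_union]
    exact Or.inl ⟨v, hv.1, rfl⟩

end Invariant

/-- The part of the arriving element `u`, among the arrived elements. -/
def arrivedPart (part : Ω → ι) (h : List Ω) (u : Ω) : Finset Ω :=
  (insert u h.toFinset).filter fun v => part v = part u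

/-- The weight of the pairs of earlier elements of the part of `u`. -/
def oldWeight (f : Finset Ω → ℝ) (part : Ω → ι) (h : List Ω) (σ : State Ω) (u : Ω) : ℝ :=
  ∑ v ∈ (arrivedPart part h u).erase u, σ.value f u v 0 * (1 - Real.exp (-σ.A v))

lemma mem_arrivedPart_self : u ∈ arrivedPart part h u := by simp [arrivedPart]

lemma arrivedPart_eq_insert :
    arrivedPart part h u = insert u (h.toFinset.filter fun v => part v = part u) := by
  rw [arrivedPart, Finset.filter_insert, if_pos rfl]

namespace Invariant

lemma worth_eq_surplus (hI : Invariant f part k α h σ) (hu : u ∉ h) (x : Ω → ℝ) (t : ℝ) :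
    worth α (oldWeight f part h σ u) (arrivedPart part h u) (fun v => σ.value f u v 0) u x t
      = surplus α (arrivedPart part h u) (fun v => σ.value f u v 0) x
        ⇑(σ.A + Finsupp.single u t) := by
  have hAu := hI.A_eq_zero hu
  have h1 : ∑ v ∈ arrivedPart part h u,
      σ.value f u v 0 * (1 - Real.exp (-(σ.A + Finsupp.single u t) v))
      = oldWeight f part h σ u + σ.value f u u 0 * (1 - Real.exp (-t)) := by
    rw [← Finset.sum_erase_add _ _ mem_arrivedPart_self, Finsupp.add_apply, Finsupp.single_eq_same,
      hAu, zero_add, oldWeight]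
    congr 1
    refine Finset.sum_congr rfl fun v hv => ?_
    rw [Finsupp.add_apply, Finsupp.single_eq_of_ne (Finset.ne_of_mem_erase hv), add_zero]
  rw [worth, surplus, h1]

lemma support_A_add_single (hI : Invariant f part k α h σ) (t : ℝ) :
    (σ.A + Finsupp.single u t).support ⊆ insert u h.toFinset :=
  Finsupp.support_add.trans (Finset.union_subset (hI.support.trans (Finset.subset_insert _ _))
    (Finsupp.support_single_subset.trans (by simp)))

lemma accepts_iff (hI : Invariant f part k α h σ) (hu : u ∉ h) {S : Ω →₀ ℝ}
    (hS : S.support ⊆ insert u h.toFinset) (t : ℝ) :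
    Accepts f part k α σ u S t ↔ 1 / (k (part u) : ℝ) * worth α (oldWeight f part h σ u)
      (arrivedPart part h u) (fun v => σ.value f u v 0) u S t < σ.value f u u 0 * Real.exp (-t) := by
  rw [hI.worth_eq_surplus hu, Accepts, weight_eq_sum (c := fun v => σ.value f u v 0) hI.value_eq hS,
    weight_eq_sum (c := fun v => σ.value f u v 0) hI.value_eq (hI.support_A_add_single t),
    hI.value_eq u t]
  rfl

/-- The acceptance threshold exceeds the potential at the beginning of a round. -/
lemma potential_le_worth_zero (hI : Invariant f part k α h σ) (hu : u ∉ h)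
    (hk : 0 < k (part u)) {M : ℝ} (hM0 : 0 ≤ M)
    (hM : ∀ v ∈ arrivedPart part h u, σ.value f u v 0 ≤ M) :
    potential (α - 2) (k (part u)) M (arrivedPart part h u) (fun v => σ.value f u v 0) σ.S
      ≤ 1 / k (part u) * worth α (oldWeight f part h σ u)
        (arrivedPart part h u) (fun v => σ.value f u v 0) u σ.S 0 := by
  have hc : ∀ v ∈ h.toFinset.filter (fun v => part v = part u), σ.value f u v 0 = σ.w v 0 := by
    intro v hv
    rw [State.value_of_ne]
    rintro rfl
    exact hu (List.mem_toFinset.1 (Finset.mem_filter.1 hv).1)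
  rw [hI.worth_eq_surplus hu, Finsupp.single_zero, add_zero, arrivedPart_eq_insert,
    surplus_insert (hI.S_eq_zero hu) (hI.A_eq_zero hu), potential_insert (hI.S_eq_zero hu),
    surplus_congr hc (fun _ _ => rfl) (fun _ _ => rfl), potential_congr hc (fun _ _ => rfl)]
  refine hI.potential_le _ M hk hM0 fun v hv => ?_
  rw [← hc v hv]
  exact hM v (by rw [arrivedPart_eq_insert]; exact Finset.mem_insert_of_mem hv)

end Invariant

lemma exists_value_bound (c : Ω → ℝ) (V : Finset Ω) : ∃ M, 0 ≤ M ∧ ∀ v ∈ V, c v ≤ M := by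
  obtain ⟨M, hM⟩ := ((V.image c) ∪ {0}).bddAbove
  refine ⟨M, hM (by simp), fun v hv => hM ?_⟩
  simp only [Finset.coe_union, Finset.coe_image, Set.mem_union]
  exact Or.inl ⟨v, hv, rfl⟩

namespace RoundPath

lemma le_start (hp : RoundPath f part k α σ u d s) {t : ℝ} (ht : t ∈ Set.Icc 0 d) {v : Ω}
    (hv : v ≠ u) : s t v ≤ σ.S v := by
  rw [← hp.start]
  exact image_le_of_deriv_right_le_deriv_boundary (hp.continuous v)
    (fun x hx => hp.evolves x hx v hv) le_rfl continuousOn_const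
    (fun x _ => hasDerivWithinAt_const x _ _) (fun x _ => rate_nonpos _ _ _ _ _ _) ht

lemma eq_start (hp : RoundPath f part k α σ u d s) {t : ℝ} (ht : t ∈ Set.Icc 0 d) {v : Ω}
    (hv : part v ≠ part u) : s t v = σ.S v := by
  rw [← hp.start]
  refine constant_of_has_deriv_right_zero (hp.continuous v) (fun x hx => ?_) t ht
  have := hp.evolves x hx v (fun e => hv (e ▸ rfl))
  rwa [rate, if_neg fun h' => hv (Finset.mem_filter.1 h'.2).2.1] at this

lemma support_subset (hp : RoundPath f part k α σ u d s) (hI : Invariant f part k α h σ)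
    {t : ℝ} (ht : t ∈ Set.Icc 0 d) : (s t).support ⊆ insert u h.toFinset := by
  intro v hv
  by_contra hn
  rw [Finset.mem_insert, List.mem_toFinset, not_or] at hn
  refine Finsupp.mem_support_iff.1 hv (le_antisymm ?_ (hp.nonneg t ht v))
  exact (hp.le_start ht hn.1).trans_eq (hI.S_eq_zero hn.2)

lemma mass_eq (hp : RoundPath f part k α σ u d s) (hI : Invariant f part k α h σ)
    {t : ℝ} (ht : t ∈ Set.Icc 0 d) :
    mass part (part u) (s t) = ∑ v ∈ arrivedPart part h u, s t v :=
  mass_eq_sum (hp.support_subset hI ht)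

/-- The prescribed rates do not exclude u from the set of minimizers, nor a vanishing η. Feasibility
does the work: a full part cannot gain mass, which forces the rates of the other elements to sum to
-1. -/
lemma isVelocity (hp : RoundPath f part k α σ u d s) (hI : Invariant f part k α h σ)
    (hf : IsMonotoneSubmodular f) {t : ℝ} (ht : t ∈ Set.Ico 0 d) :
    ∃ r : Ω → ℝ, IsVelocity (k (part u)) (arrivedPart part h u) u (fun v => σ.value f u v 0)
      (s t) r ∧ ∀ v ∈ arrivedPart part h u,
        HasDerivWithinAt (fun x => s x v) (r v) (Set.Ici t) t := by
  have ht' : t ∈ Set.Icc 0 d := ⟨ht.1, ht.2.le⟩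
  set V := arrivedPart part h u with hV
  set T := argminSet part (part u) (σ.value f u) (s t) with hT
  set e : Ω → ℝ := fun v => |deriv (σ.value f u v) (s t v)|⁻¹ with he
  set r : Ω → ℝ := fun v => if v = u then 1 else rate part k (part u) (σ.value f u) (s t) v with hr
  have hder : ∀ v ∈ V, HasDerivWithinAt (fun x => s x v) (r v) (Set.Ici t) t := by
    intro v _
    by_cases hv : v = u
    · subst hv
      simp only [hr, if_pos]
      refine (hasDerivWithinAt_id t _).congr_of_eventuallyEq ?_ (hp.clock t ht')
      filter_upwards [Ico_mem_nhdsGE ht.2] with x hx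
      exact hp.clock x ⟨ht.1.trans hx.1, hx.2.le⟩
    · simp only [hr, if_neg hv]
      exact hp.evolves t ht v hv
  refine ⟨r, ⟨by simp [hr], ?_⟩, hder⟩
  have hrv : ∀ v ∈ V.erase u, r v = rate part k (part u) (σ.value f u) (s t) v := fun v hv => by
    simp only [hr, if_neg (Finset.ne_of_mem_erase hv)]
  by_cases hfull : mass part (part u) (s t) = k (part u)
  swap
  · left
    intro v hv
    rw [hrv v hv, rate, if_neg fun h' => hfull h'.1]
  right
  have hsum_le : ∑ v ∈ V, r v ≤ 0 := by
    refine nonpos_of_hasDerivWithinAt_of_le ht.2 (HasDerivWithinAt.fun_sum hder) fun x hx => ?_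
    have hx' : x ∈ Set.Icc 0 d := ⟨ht.1.trans hx.1.le, hx.2.le⟩
    rw [← hp.mass_eq hI hx', ← hp.mass_eq hI ht', hfull]
    exact hp.feasible x hx' _
  rw [← Finset.add_sum_erase _ _ (mem_arrivedPart_self : u ∈ V)] at hsum_le
  have hru : r u = 1 := by simp [hr]
  have hrT : ∀ v ∈ V.erase u, r v = if v ∈ T then -(e v / ∑ x ∈ T, e x) else 0 := fun v hv => by
    rw [hrv v hv, rate]
    simp only [hfull, true_and, hT, he]
  have he0 : ∀ v, 0 ≤ e v := fun v => inv_nonneg.2 (abs_nonneg _)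
  have hTV : ∀ v ∈ T, v ∈ V := fun v hv => by
    rw [hT, argminSet, Finset.mem_filter] at hv
    exact Finset.mem_filter.2 ⟨hp.support_subset hI ht' hv.1, hv.2.1⟩
  have hsumr : ∑ v ∈ V.erase u, r v = -((∑ v ∈ T.erase u, e v) / ∑ x ∈ T, e x) := by
    rw [Finset.sum_congr rfl hrT, ← Finset.sum_filter, Finset.sum_neg_distrib, Finset.sum_div]
    congr 2
    ext v
    simp only [Finset.mem_filter, Finset.mem_erase]
    exact ⟨fun h' => ⟨h'.1.1, h'.2⟩, fun h' => ⟨⟨h'.1, hTV v h'.2⟩, h'.2⟩⟩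
  have hle : ∑ v ∈ T.erase u, e v ≤ ∑ x ∈ T, e x :=
    Finset.sum_le_sum_of_subset_of_nonneg (Finset.erase_subset _ _) fun v _ _ => he0 v
  have hH0 : 0 ≤ ∑ x ∈ T, e x := Finset.sum_nonneg fun v _ => he0 v
  -- The new element grows at rate 1 while the mass is at its maximum, so the others lose at least
  -- 1. This also rules out a zero denominator, where the quotient would be 0.
  have hge1 : 1 ≤ (∑ v ∈ T.erase u, e v) / ∑ x ∈ T, e x := by
    rw [hru, hsumr] at hsum_le
    linarith
  have hH : 0 < ∑ x ∈ T, e x := by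
    rcases hH0.eq_or_lt with h0 | h0
    · rw [← h0, div_zero] at hge1
      linarith
    · exact h0
  have hone : (∑ v ∈ T.erase u, e v) / ∑ x ∈ T, e x = 1 :=
    le_antisymm ((div_le_one hH).2 hle) hge1
  obtain ⟨w, hw⟩ : T.Nonempty := by
    by_contra hn
    rw [Finset.not_nonempty_iff_eq_empty.1 hn] at hH
    simp at hH
  have hmin : ∀ v ∈ T, ∀ x, part x = part u → 0 < s t x →
      σ.value f u v 0 * Real.exp (-s t v) ≤ σ.value f u x 0 * Real.exp (-s t x) := by
    intro v hv x hx hx0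
    rw [hT, argminSet, Finset.mem_filter] at hv
    rw [← hI.value_eq, ← hI.value_eq]
    exact hv.2.2.2 x (s t x) hx hx0 le_rfl
  have hTp : ∀ v ∈ T, part v = part u ∧ 0 < s t v := fun v hv => by
    rw [hT, argminSet, Finset.mem_filter] at hv
    exact ⟨hv.2.1, hv.2.2.1⟩
  refine ⟨σ.value f u w 0 * Real.exp (-s t w),
    mul_nonneg (hI.value_nonneg hf w) (Real.exp_pos _).le, ?_, fun v hv hv0 => ?_,
    fun v hv hv0 => ?_, ?_⟩
  · rw [← hp.mass_eq hI ht', hfull]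
  · have hvT : v ∈ T := by
      by_contra hn
      exact hv0 (by rw [hrT v hv, if_neg hn])
    exact le_antisymm (hmin v hvT w (hTp w hw).1 (hTp w hw).2)
      (hmin w hw v (hTp v hvT).1 (hTp v hvT).2)
  · exact hmin w hw v (Finset.mem_filter.1 (Finset.mem_of_mem_erase hv)).2 hv0
  · rw [hsumr, hone]

lemma flow (hp : RoundPath f part k α σ u d s) (hI : Invariant f part k α h σ)
    (hf : IsMonotoneSubmodular f) (hu : u ∉ h) :
    Flow α (k (part u)) (oldWeight f part h σ u) d (arrivedPart part h u) u
      (fun v => σ.value f u v 0) (fun t v => s t v) where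
  mem := mem_arrivedPart_self
  c_nonneg v _ := hI.value_nonneg hf v
  clock := hp.clock
  nonneg t ht v _ := hp.nonneg t ht v
  continuousOn := hp.continuous
  accepts t ht := (hI.accepts_iff hu (hp.support_subset hI ⟨ht.1, ht.2.le⟩) t).1 (hp.accepts t ht)
  evolves _ ht := hp.isVelocity hI hf ht

end RoundPath

/-- The invariant is preserved by a round. -/
theorem Invariant.step (hI : Invariant f part k α h σ) (hf : IsMonotoneSubmodular f)
    (hα : 3 < α) (he : α = Real.exp (α - 2)) (hk : ∀ v, 0 < k (part v)) (hu : u ∉ h)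
    {σ' : State Ω} (hr : Round f part k α σ u σ') : Invariant f part k α (h ++ [u]) σ' := by
  obtain ⟨d, s, hp, rfl⟩ := hr
  have hd : d ∈ Set.Icc 0 d := ⟨hp.length_nonneg, le_rfl⟩
  have hκ : (0 : ℝ) < k (part u) := by exact_mod_cast hk u
  have hflow := hp.flow hI hf hu
  have hlist : (h ++ [u]).toFinset = insert u h.toFinset := by
    ext v
    simp
  have hu' : u ∉ h.toFinset := by rwa [List.mem_toFinset]
  have hAu := hI.A_eq_zero hu
  have hAv : ∀ v, v ≠ u → (σ.A + Finsupp.single u d) v = σ.A v := fun v hv => by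
    rw [Finsupp.add_apply, Finsupp.single_eq_of_ne hv, add_zero]
  have hAu' : (σ.A + Finsupp.single u d) u = d := by simp [hAu]
  have hne : ∀ v ∈ h, v ≠ u := fun v hv e => hu (e ▸ hv)
  have hflow0 : ∀ M, 0 ≤ M → (∀ v ∈ arrivedPart part h u, σ.value f u v 0 ≤ M) →
      potential (α - 2) (k (part u)) M (arrivedPart part h u) (fun v => σ.value f u v 0)
        (fun v => s 0 v) ≤ 1 / k (part u) * worth α (oldWeight f part h σ u)
        (arrivedPart part h u) (fun v => σ.value f u v 0) u (fun v => s 0 v) 0 := by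
    rw [hp.start]
    exact fun M hM0 hM => hI.potential_le_worth_zero hu (hk u) hM0 hM
  have hother : ∀ l, l ≠ part u → (insert u h.toFinset).filter (fun v => part v = l)
      = h.toFinset.filter fun v => part v = l := fun l hl => by
    rw [Finset.filter_insert, if_neg hl.symm]
  have hmem : ∀ {l v}, v ∈ h.toFinset.filter (fun v => part v = l) → v ∈ h ∧ part v = l :=
    fun {l v} hv => by rwa [Finset.mem_filter, List.mem_toFinset] at hv
  have hsur : ∀ l, l ≠ part u → surplus α (h.toFinset.filter fun v => part v = l)
        (fun v => σ.value f u v 0) (s d) ⇑(σ.A + Finsupp.single u d)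
      = surplus α (h.toFinset.filter fun v => part v = l) (fun v => σ.w v 0) σ.S σ.A :=
    fun l hl => surplus_congr
      (fun v hv => by rw [State.value_of_ne f σ (hne v (hmem hv).1)])
      (fun v hv => hp.eq_start hd ((hmem hv).2.trans_ne hl))
      (fun v hv => hAv v (hne v (hmem hv).1))
  have hpart : (insert u h.toFinset).filter (fun v => part v = part u) = arrivedPart part h u := rfl
  refine ⟨hp.nonneg d hd, fun v => ?_, ?_, hI.value_eq, hI.value_nonneg hf, fun v hv => ?_,
    hp.feasible d hd, fun l M hl hM0 hM => ?_, fun v hv => ?_, fun v hv => ?_, ?_,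
    fun X hX0 hX => ?_⟩
  · by_cases hv : v = u
    · subst hv
      simp only [hAu']
      exact (hp.clock d hd).le
    · simp only [hAv v hv]
      exact (hp.le_start hd hv).trans (hI.S_le v)
  · rw [hlist]
    exact hI.support_A_add_single d
  · simp only at hv ⊢
    by_cases hvu : v = u
    · subst hvu
      rw [hp.clock d hd] at hv
      -- A positive amount of u means acceptance at t = 0, so its initial value exceeds a threshold
      -- that is nonnegative.
      have h1 := hflow.accepts 0 ⟨le_rfl, hv⟩
      rw [hI.worth_eq_surplus hu, hp.start, Finsupp.single_zero, add_zero, arrivedPart_eq_insert,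
        surplus_insert (hI.S_eq_zero hu) hAu, neg_zero, Real.exp_zero, mul_one] at h1
      rw [surplus_congr (c' := fun v => σ.w v 0)
        (fun v hv => by rw [State.value_of_ne f σ (hne v (hmem hv).1)]) (fun _ _ => rfl)
        (fun _ _ => rfl)] at h1
      exact (hI.surplus_nonneg (by linarith) (hk v)).trans_lt h1
    · rw [State.value_of_ne f σ hvu]
      exact hI.w_pos v (hv.trans_le (hp.le_start hd hvu))
  · simp only [hlist] at hM ⊢
    by_cases hlu : l = part u
    · subst hlu
      rw [hpart] at hM ⊢
      have := hflow.potential_le hα he hκ hM (hflow0 M hM0 hM) d hd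
      rw [hI.worth_eq_surplus hu] at this
      exact this
    · rw [hother l hlu] at hM ⊢
      rw [hsur l hlu, potential_congr (c' := fun v => σ.w v 0) (x' := σ.S)
        (fun v hv => by rw [State.value_of_ne f σ (hne v (hmem hv).1)])
        (fun v hv => hp.eq_start hd ((hmem hv).2.trans_ne hlu))]
      refine hI.potential_le l M hl hM0 fun v hv => ?_
      have := hM v hv
      rwa [State.value_of_ne f σ (hne v (hmem hv).1)] at this
  · simp only [hlist]
    by_cases hvu : v = u
    · subst hvu
      have := hp.stops
      rw [hI.accepts_iff hu (hp.support_subset hI hd), not_lt, hI.worth_eq_surplus hu,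
        ← hI.value_eq] at this
      rw [hAu']
      exact this
    · have hvh : v ∈ h := by simpa [hvu] using hv
      rw [hAv v hvu, State.value_of_ne f σ hvu]
      refine (hI.stopped v hvh).trans ?_
      by_cases hpv : part v = part u
      · rw [hpv, hpart]
        obtain ⟨M, hM0, hM⟩ := exists_value_bound (fun v => σ.value f u v 0)
          (arrivedPart part h u)
        -- An old element of the same part stopped at a threshold that has not decreased since.
        have h1 := hflow.worth_mono hα he hκ hM (hflow0 M hM0 hM) d hd
        rw [hI.worth_eq_surplus hu, hI.worth_eq_surplus hu, hp.start, Finsupp.single_zero,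
          add_zero] at h1
        rw [show surplus α (h.toFinset.filter fun v => part v = part u) (fun v => σ.w v 0) σ.S σ.A
          = surplus α (arrivedPart part h u) (fun v => σ.value f u v 0) σ.S σ.A by
            rw [arrivedPart_eq_insert, surplus_insert (hI.S_eq_zero hu) hAu]
            exact surplus_congr
              (fun v hv => by rw [State.value_of_ne f σ (hne v (hmem hv).1)]) (fun _ _ => rfl)
              (fun _ _ => rfl)]
        exact mul_le_mul_of_nonneg_left h1 (by positivity)
      · rw [hother _ hpv, hsur _ hpv]
  · by_cases hvu : v = u
    · subst hvu
      simp only [fhat_gain_add_single, State.value_self, hAu']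
      rw [mul_comm]
    · have hvh : v ∈ h := by simpa [hvu] using hv
      simp only [hAv v hvu, State.value_of_ne f σ hvu]
      -- Growth of A only lowers the marginals of older elements, by submodularity.
      refine (fhat_anti (hf.gain_antitone v) hI.A_nonneg fun x => ?_).trans (hI.marginal_le v hvh)
      by_cases hx : x = u
      · subst hx
        rw [hAu', hAu]
        exact hp.length_nonneg
      · rw [hAv x hx]
  · simp only [hlist]
    rw [fhat_add_single_gain, hI.fhat_A, Finset.sum_insert hu', hAu', State.value_self, neg_zero,
      Real.exp_zero, mul_one]
    have h1 : ∀ v ∈ h.toFinset,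
        σ.value f u v 0 * (1 - Real.exp (-(σ.A + Finsupp.single u d) v))
          = σ.w v 0 * (1 - Real.exp (-σ.A v)) := fun v hv => by
      rw [hAv v (hne v (List.mem_toFinset.1 hv)),
        State.value_of_ne f σ (hne v (List.mem_toFinset.1 hv))]
    rw [Finset.sum_congr rfl h1]
    ring
  · simp only [hlist] at hX ⊢
    have hY0 : ∀ v, 0 ≤ (X.erase u) v := fun v => by
      by_cases hv : v = u
      · simp [hv]
      · rw [Finsupp.erase_ne hv]
        exact hX0 v
    have hYA : ∀ v, (X.erase u) v ≤ σ.A v := fun v => by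
      by_cases hv : v = u
      · rw [hv, Finsupp.erase_same, hAu]
      · rw [Finsupp.erase_ne hv, ← hAv v hv]
        exact hX v
    have h1 := hI.le_fhat (X.erase u) hY0 hYA
    -- The value of u was measured at A, which dominates X without u, so its gain at the latter is
    -- at least as large.
    have h2 := fhat_anti (hf.gain_antitone u) hY0 hYA
    have h3 : fhat f X
        = fhat f (X.erase u) + (1 - Real.exp (-X u)) * fhat (gain f u) (X.erase u) := by
      rw [← fhat_add_single_gain, Finsupp.erase_add_single]
    rw [h3, Finset.sum_insert hu', State.value_self, neg_zero, Real.exp_zero, mul_one]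
    have h5 : ∀ v ∈ h.toFinset, σ.value f u v 0 * (1 - Real.exp (-X v))
        = σ.w v 0 * (1 - Real.exp (-(X.erase u) v)) := fun v hv => by
      rw [State.value_of_ne f σ (hne v (List.mem_toFinset.1 hv)),
        Finsupp.erase_ne (hne v (List.mem_toFinset.1 hv))]
    rw [Finset.sum_congr rfl h5]
    have h4 : Real.exp (-X u) ≤ 1 := Real.exp_le_one_iff.2 (by linarith [hX0 u])
    nlinarith [mul_le_mul_of_nonneg_left h2 (sub_nonneg.2 h4)]

end

end OnlineSubmodular

end

noncomputable section

namespace OnlineSubmodular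

/-! ### Existence of a round -/

variable {Ω ι : Type*}

section

variable {f : Finset Ω → ℝ} {part : Ω → ι} {k : ι → ℕ} {α : ℝ} {h : List Ω} {σ : State Ω}
  {u : Ω}

/-- The fractional solution in the round of `u`, when `S_u = t` and the other elements of the part
have the amounts `z`. -/
def roundState (part : Ω → ι) (h : List Ω) (σ : State Ω) (u : Ω) (t : ℝ) (z : Ω → ℝ) : Ω →₀ ℝ :=
  Finsupp.onFinset (insert u h.toFinset)
    (fun v => if v ∈ insert u h.toFinset then
      (if v = u then t else if part v = part u then z v else σ.S v) else 0)
    fun v hv => by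
      by_contra hn
      exact hv (if_neg hn)

lemma roundState_self (t : ℝ) (z : Ω → ℝ) : roundState part h σ u t z u = t := by
  simp [roundState]

lemma roundState_of_mem {t : ℝ} {z : Ω → ℝ} {v : Ω} (hv : v ∈ (arrivedPart part h u).erase u) :
    roundState part h σ u t z v = z v := by
  rw [Finset.mem_erase, arrivedPart, Finset.mem_filter] at hv
  rw [roundState, Finsupp.onFinset_apply, if_pos hv.2.1, if_neg hv.1, if_pos hv.2.2]

lemma roundState_of_notMem (hI : Invariant f part k α h σ) {t : ℝ} {z : Ω → ℝ} {v : Ω}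
    (hvu : v ≠ u) (hv : v ∉ (arrivedPart part h u).erase u) :
    roundState part h σ u t z v = σ.S v := by
  by_cases hvh : v ∈ h
  · have hp : part v ≠ part u := fun hp => hv (by
      rw [Finset.mem_erase, arrivedPart, Finset.mem_filter]
      exact ⟨hvu, by simp [hvh], hp⟩)
    simp [roundState, hvu, hp, hvh]
  · simp [roundState, hvu, hvh, hI.S_eq_zero hvh]

lemma support_roundState (t : ℝ) (z : Ω → ℝ) :
    (roundState part h σ u t z).support ⊆ insert u h.toFinset :=
  Finsupp.support_onFinset_subset

lemma mass_roundState (t : ℝ) (z : Ω → ℝ) :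
    mass part (part u) (roundState part h σ u t z)
      = t + ∑ v ∈ (arrivedPart part h u).erase u, z v := by
  rw [mass_eq_sum (support_roundState t z)]
  show ∑ v ∈ arrivedPart part h u, _ = _
  rw [← Finset.add_sum_erase _ _ mem_arrivedPart_self, roundState_self]
  congr 1
  exact Finset.sum_congr rfl fun v hv => roundState_of_mem hv

lemma continuousOn_worth_of_continuousOn {α B : ℝ} {V : Finset Ω} {c : Ω → ℝ} {I : Set ℝ}
    {x : ℝ → Ω → ℝ} (hx : ∀ v, ContinuousOn (fun t => x t v) I) :
    ContinuousOn (fun t => worth α B V c u (x t) t) I := by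
  unfold worth
  refine (continuousOn_const.mul (continuousOn_finsetSum _ fun v _ => ?_)).sub (by fun_prop)
  exact continuousOn_const.mul (continuousOn_const.sub (hx v).neg.rexp)

/-- In every reachable state the round of a new element can be carried out. -/
theorem Invariant.exists_round (hI : Invariant f part k α h σ) (hf : IsMonotoneSubmodular f)
    (hα : 3 < α) (he : α = Real.exp (α - 2)) (hk : 0 < k (part u)) (hu : u ∉ h) :
    ∃ σ', Round f part k α σ u σ' := by
  set V := arrivedPart part h u with hV
  set W := V.erase u with hW
  set c : Ω → ℝ := fun v => σ.value f u v 0 with hc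
  -- On the logarithmic scale the value of the pair (v, τ) is a v - τ, so draining by value is
  -- draining by the level of a v - z v. Elements with S v > 0 have c v > 0, and for the others log
  -- is irrelevant.
  set a : Ω → ℝ := fun v => Real.log (c v) with ha
  set K : ℝ := (k (part u) : ℝ) with hK
  have hκ : 0 < K := by rw [hK]; exact_mod_cast hk
  have hc0 : ∀ v, 0 ≤ c v := hI.value_nonneg hf
  have hcpos : ∀ v ∈ W, 0 < σ.S v → 0 < c v := fun v hv h0 => by
    simp only [hc, State.value_of_ne f σ (Finset.ne_of_mem_erase hv)]
    exact hI.w_pos v h0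
  have hSsupp : σ.S.support ⊆ insert u h.toFinset := fun v hv => by
    refine Finset.mem_insert_of_mem (List.mem_toFinset.2 ?_)
    by_contra hn
    exact Finsupp.mem_support_iff.1 hv (hI.S_eq_zero hn)
  have hSK : ∑ v ∈ W, σ.S v ≤ K := by
    have h1 := hI.mass_le (part u)
    rw [mass_eq_sum hSsupp] at h1
    change ∑ v ∈ V, σ.S v ≤ K at h1
    rwa [← Finset.add_sum_erase _ _ mem_arrivedPart_self, hI.S_eq_zero hu, zero_add] at h1
  obtain ⟨z, hz0, hzsum, hzstart, hzc, hzd0, hzd1⟩ :=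
    exists_drain_path (V := W) (a := a) (fun v _ => hI.S_nonneg v) hSK
  set s : ℝ → Ω →₀ ℝ := fun t => roundState part h σ u t (z t) with hs
  have hsu : ∀ t, s t u = t := fun t => roundState_self t _
  have hsW : ∀ t, ∀ v ∈ W, s t v = z t v := fun t v hv => roundState_of_mem hv
  have hsn : ∀ t v, v ≠ u → v ∉ W → s t v = σ.S v := fun t v h1 h2 =>
    roundState_of_notMem hI h1 h2
  have hssupp : ∀ t, (s t).support ⊆ insert u h.toFinset := fun t => support_roundState t _
  have hsmass : ∀ t, mass part (part u) (s t) = t + ∑ v ∈ W, z t v := fun t =>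
    mass_roundState t _
  have hVsum : ∀ t, ∑ v ∈ V, s t v = t + ∑ v ∈ W, z t v := fun t => by
    rw [← hsmass, mass_eq_sum (hssupp t)]
    rfl
  have hmass_le : ∀ t ≤ K, t + ∑ v ∈ W, z t v ≤ K := fun t ht => by
    rw [hzsum t ht]
    linarith [min_le_right (∑ v ∈ W, σ.S v) (K - t)]
  have hnonneg : ∀ t ∈ Set.Icc 0 K, ∀ v, 0 ≤ s t v := fun t ht v => by
    by_cases h1 : v = u
    · rw [h1, hsu]; exact ht.1
    · by_cases h2 : v ∈ W
      · rw [hsW t v h2]; exact (hz0 t ht.2 v h2).1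
      · rw [hsn t v h1 h2]; exact hI.S_nonneg v
  have hcont : ∀ v, ContinuousOn (fun t => s t v) (Set.Icc 0 K) := fun v => by
    by_cases h1 : v = u
    · simp only [h1, hsu]
      exact continuousOn_id
    · by_cases h2 : v ∈ W
      · simp only [hsW _ v h2]
        exact (hzc v h2).mono Set.Icc_subset_Iic_self
      · simp only [hsn _ v h1 h2]
        exact continuousOn_const
  have hstart : s 0 = σ.S := Finsupp.ext fun v => by
    by_cases h1 : v = u
    · rw [h1, hsu, hI.S_eq_zero hu]
    · by_cases h2 : v ∈ W
      · rw [hsW 0 v h2, hzstart v h2]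
      · exact hsn 0 v h1 h2
  have hexp : ∀ t ≤ K, ∀ v ∈ W, 0 < z t v →
      c v * Real.exp (-s t v) = Real.exp (a v - z t v) := fun t ht v hv h0 => by
    rw [hsW t v hv, sub_eq_add_neg, Real.exp_add,
      Real.exp_log (hcpos v hv (h0.trans_le (hz0 t ht v hv).2))]
  have hbot : ∀ t ≤ K, ∀ v ∈ bottom W a (z t), v ∈ W ∧ 0 < z t v ∧ ∀ x ∈ W, 0 < z t x →
      c v * Real.exp (-s t v) ≤ c x * Real.exp (-s t x) := fun t ht v hv => by
    rw [bottom, Finset.mem_filter] at hv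
    refine ⟨hv.1, hv.2.1, fun x hx hx0 => ?_⟩
    rw [hexp t ht v hv.1 hv.2.1, hexp t ht x hx hx0, Real.exp_le_exp]
    exact hv.2.2 x hx hx0
  have hbne : ∀ t < K, ∑ v ∈ W, z t v + t = K → (bottom W a (z t)).Nonempty := fun t ht h1 =>
    bottom_nonempty (by linarith)
  have hbW : ∀ t, W.filter (fun v => v ∈ bottom W a (z t)) = bottom W a (z t) := fun t => by
    ext v
    rw [Finset.mem_filter, and_iff_right_iff_imp, bottom, Finset.mem_filter]
    exact fun h => h.1
  set B := oldWeight f part h σ u with hB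
  -- The potential bound needs only `IsVelocity`, which tests minimality among the elements other
  -- than u. It is therefore available before the path is known to have the prescribed rates.
  have hflow : ∀ d ≤ K, (∀ t ∈ Set.Ico 0 d, 1 / K * worth α B V c u (s t) t
      < c u * Real.exp (-t)) → Flow α K B d V u c (fun t v => s t v) := by
    intro d hd hacc
    refine ⟨mem_arrivedPart_self, fun v _ => hc0 v, fun t _ => hsu t,
      fun t ht v _ => hnonneg t ⟨ht.1, ht.2.trans hd⟩ v,
      fun v => (hcont v).mono (Set.Icc_subset_Icc_right hd), hacc, fun t ht => ?_⟩
    have htK : t < K := ht.2.trans_le hd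
    have hdu : HasDerivWithinAt (fun x => s x u) 1 (Set.Ici t) t := by
      simp only [hsu]
      exact hasDerivWithinAt_id t _
    have hWd : ∀ v ∈ W, (fun x => s x v) = fun x => z x v := fun v hv => funext fun x => hsW x v hv
    rcases (hmass_le t htK.le).eq_or_lt with hfull | hfree
    · rw [add_comm] at hfull
      set T := bottom W a (z t) with hT
      obtain ⟨w, hw⟩ := hbne t htK hfull
      refine ⟨fun v => if v = u then 1 else if v ∈ T then -(1 / (T.card : ℝ)) else 0,
        ⟨if_pos rfl, Or.inr ⟨c w * Real.exp (-s t w), mul_nonneg (hc0 w) (Real.exp_pos _).le, ?_,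
          fun v hv hv0 => ?_, fun v hv hv0 => ?_, ?_⟩⟩, fun v hv => ?_⟩
      · rw [hVsum, add_comm, hfull]
      · have hvT : v ∈ T := by
          by_contra hn
          exact hv0 (by simp [Finset.ne_of_mem_erase hv, hn])
        exact le_antisymm ((hbot t htK.le v hvT).2.2 w (hbot t htK.le w hw).1
          (hbot t htK.le w hw).2.1) ((hbot t htK.le w hw).2.2 v hv (hbot t htK.le v hvT).2.1)
      · rw [hsW t v hv] at hv0
        exact (hbot t htK.le w hw).2.2 v hv hv0
      · have hT0 : (T.card : ℝ) ≠ 0 := by exact_mod_cast (Finset.card_pos.2 ⟨w, hw⟩).ne'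
        have e : ∀ v ∈ W, (if v = u then (1 : ℝ) else if v ∈ T then -(1 / (T.card : ℝ)) else 0)
            = if v ∈ T then -(1 / (T.card : ℝ)) else 0 := fun v hv =>
          if_neg (Finset.ne_of_mem_erase hv)
        rw [Finset.sum_congr rfl e, ← Finset.sum_filter, hbW t, ← hT, Finset.sum_const, nsmul_eq_mul]
        field_simp
      · by_cases hvu : v = u
        · subst hvu
          beta_reduce
          rw [if_pos rfl]
          exact hdu
        · have hvW : v ∈ W := Finset.mem_erase.2 ⟨hvu, hv⟩
          beta_reduce
          rw [if_neg hvu, hWd v hvW]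
          exact hzd1 t htK hfull v hvW
    · rw [add_comm] at hfree
      refine ⟨fun v => if v = u then 1 else 0,
        ⟨if_pos rfl, Or.inl fun v hv => if_neg (Finset.ne_of_mem_erase hv)⟩, fun v hv => ?_⟩
      by_cases hvu : v = u
      · subst hvu
        beta_reduce
        rw [if_pos rfl]
        exact hdu
      · have hvW : v ∈ W := Finset.mem_erase.2 ⟨hvu, hv⟩
        beta_reduce
        rw [if_neg hvu, hWd v hvW]
        exact hzd0 t htK hfree v hvW
  obtain ⟨M, hM0, hM⟩ := exists_value_bound c V
  have hinit : potential (α - 2) K M V c (s 0) ≤ 1 / K * worth α B V c u (s 0) 0 := by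
    rw [hstart]
    exact hI.potential_le_worth_zero hu hk hM0 hM
  have hpot : ∀ t ∈ Set.Icc 0 K, (∀ x ∈ Set.Icc 0 t, 1 / K * worth α B V c u (s x) x
      < c u * Real.exp (-x)) → potential (α - 2) K M V c (s t) < c u * Real.exp (-s t u) :=
    fun t ht hacc => by
      rw [hsu]
      exact ((hflow t ht.2 fun x hx => hacc x ⟨hx.1, hx.2.le⟩).potential_le hα he hκ hM hinit t
        ⟨ht.1, le_rfl⟩).trans_lt (hacc t ⟨ht.1, le_rfl⟩)
  -- The round ends at the first point of this closed set.
  set Stop := {t ∈ Set.Icc 0 K | c u * Real.exp (-t) ≤ 1 / K * worth α B V c u (s t) t} with hStop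
  have hclosed : IsClosed Stop := isClosed_Icc.isClosed_le (by fun_prop)
    (continuousOn_const.mul (continuousOn_worth_of_continuousOn hcont))
  have hne : Stop.Nonempty := by
    by_contra hn
    have hacc : ∀ t ∈ Set.Icc 0 K, 1 / K * worth α B V c u (s t) t < c u * Real.exp (-t) :=
      fun t ht => by
        by_contra h'
        exact hn ⟨t, ht, not_lt.1 h'⟩
    have hKmem : K ∈ Set.Icc 0 K := ⟨hκ.le, le_rfl⟩
    have hsumK : ∑ v ∈ W, z K v = 0 := by
      rw [hzsum K le_rfl, sub_self]
      exact min_eq_right (Finset.sum_nonneg fun v _ => hI.S_nonneg v)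
    have hzK := (Finset.sum_eq_zero_iff_of_nonneg fun v hv => (hz0 K le_rfl v hv).1).1 hsumK
    -- At time K everything else is drained and u fills the part by itself. Its own last value is
    -- then the minimum and would have to be less than itself.
    refine lt_irrefl _ (min_lt_of_potential_lt (m := c u * Real.exp (-s K u)) (by linarith) he hκ
      mem_arrivedPart_self (fun v _ => hc0 v) hM (fun v _ => hnonneg K hKmem v)
      (by rw [hVsum, hsumK, add_zero]) (fun v hv hv0 => ?_) (hpot K hKmem hacc))
    rw [hsW K v hv, hzK v hv] at hv0
    exact absurd hv0 (lt_irrefl _)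
  obtain ⟨d, hdmem, hdleast⟩ := (isCompact_Icc.of_isClosed_subset hclosed
    (Set.sep_subset _ _)).exists_isLeast hne
  have hdK : d ≤ K := hdmem.1.2
  have hacc : ∀ t ∈ Set.Ico 0 d, 1 / K * worth α B V c u (s t) t < c u * Real.exp (-t) :=
    fun t ht => by
      by_contra h'
      exact absurd (hdleast ⟨⟨ht.1, ht.2.le.trans hdK⟩, not_lt.1 h'⟩) (not_le.2 ht.2)
  refine ⟨_, d, s, ⟨hdmem.1.1, hstart, fun t _ => hsu t,
    fun t ht v => hnonneg t ⟨ht.1, ht.2.trans hdK⟩ v, fun t ht l => ?_,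
    fun v => (hcont v).mono (Set.Icc_subset_Icc_right hdK),
    fun t ht => (hI.accepts_iff hu (hssupp t) t).2 (hacc t ht), ?_, fun t ht v hvu => ?_⟩, rfl⟩
  · by_cases hl : l = part u
    · rw [hl, hsmass]
      exact hmass_le t (ht.2.trans hdK)
    · refine le_of_eq_of_le ?_ (hI.mass_le l)
      rw [mass_eq_sum (hssupp t), mass_eq_sum hSsupp]
      refine Finset.sum_congr rfl fun v hv => ?_
      have hvl := (Finset.mem_filter.1 hv).2
      refine hsn t v (fun e => hl (by rw [← hvl, e])) fun hvW => hl ?_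
      rw [← hvl]
      exact (Finset.mem_filter.1 (Finset.mem_of_mem_erase hvW)).2
  · rw [hI.accepts_iff hu (hssupp d), not_lt]
    exact hdmem.2
  · have htK : t < K := ht.2.trans_le hdK
    have htI : t ∈ Set.Icc 0 K := ⟨ht.1, htK.le⟩
    by_cases hvW : v ∈ W
    swap
    · have hr : rate part k (part u) (σ.value f u) (s t) v = 0 := by
        rw [rate, if_neg]
        rintro ⟨-, h2⟩
        rw [argminSet, Finset.mem_filter] at h2
        exact hvW (Finset.mem_erase.2 ⟨hvu, Finset.mem_filter.2 ⟨hssupp t h2.1, h2.2.1⟩⟩)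
      rw [hr]
      simp only [hsn _ v hvu hvW]
      exact hasDerivWithinAt_const _ _ _
    have hWd : (fun x => s x v) = fun x => z x v := funext fun x => hsW x v hvW
    rw [hWd]
    rcases (hmass_le t htK.le).eq_or_lt with hfull | hfree
    swap
    · rw [rate, if_neg fun h' => hfree.ne (by rw [← hsmass]; exact h'.1)]
      exact hzd0 t htK (by linarith) v hvW
    have hfull' : ∑ v ∈ W, z t v + t = K := by linarith
    obtain ⟨w, hw⟩ := hbne t htK hfull'
    obtain ⟨hwW, hw0, hwmin⟩ := hbot t htK.le w hw
    set m := c w * Real.exp (-s t w) with hm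
    have hm0 : 0 < m := by rw [hm, hexp t htK.le w hwW hw0]; exact Real.exp_pos _
    -- While pairs are accepted, u is never among the minimizers, so the bottom of the other
    -- elements is the whole set of minimizers.
    have hmu : m < c u * Real.exp (-s t u) := min_lt_of_potential_lt (M := M) (by linarith) he hκ
      mem_arrivedPart_self (fun v _ => hc0 v) hM (fun v _ => hnonneg t htI v)
      (by rw [hVsum, hfull]) (fun x hx hx0 => hwmin x hx (by rwa [hsW t x hx] at hx0))
      (hpot t htI fun x hx => hacc x ⟨hx.1, hx.2.trans_lt ht.2⟩)
    have hargmin : argminSet part (part u) (σ.value f u) (s t) = bottom W a (z t) := by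
      ext v
      rw [argminSet, Finset.mem_filter]
      constructor
      · rintro ⟨h1, h2, h3, h4⟩
        have hwS : 0 < s t w := by rwa [hsW t w hwW]
        have hvm : c v * Real.exp (-s t v) ≤ m := by
          rw [← hI.value_eq, hm, ← hI.value_eq]
          exact h4 w (s t w) (Finset.mem_filter.1 (Finset.mem_of_mem_erase hwW)).2 hwS le_rfl
        have hvu' : v ≠ u := by
          rintro rfl
          linarith
        have hvW' : v ∈ W := Finset.mem_erase.2 ⟨hvu', Finset.mem_filter.2 ⟨hssupp t h1, h2⟩⟩
        rw [hsW t v hvW'] at h3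
        refine Finset.mem_filter.2 ⟨hvW', h3, fun x hx hx0 => ?_⟩
        rw [← Real.exp_le_exp, ← hexp t htK.le v hvW' h3, ← hexp t htK.le x hx hx0]
        exact hvm.trans (hwmin x hx hx0)
      · intro hv
        obtain ⟨h1, h2, h3⟩ := hbot t htK.le v hv
        have h2' : 0 < s t v := by rwa [hsW t v h1]
        refine ⟨Finsupp.mem_support_iff.2 h2'.ne',
          (Finset.mem_filter.1 (Finset.mem_of_mem_erase h1)).2, h2', fun x τ hx hτ hτx => ?_⟩
        rw [hI.value_eq, hI.value_eq x]
        have hle : c v * Real.exp (-s t v) ≤ c x * Real.exp (-s t x) := by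
          by_cases hxu : x = u
          · rw [hxu]
            exact (h3 w hwW hw0).trans hmu.le
          · have hxW : x ∈ W := Finset.mem_erase.2 ⟨hxu, Finset.mem_filter.2
              ⟨hssupp t (Finsupp.mem_support_iff.2 (hτ.trans_le hτx).ne'), hx⟩⟩
            exact h3 x hxW (by rw [← hsW t x hxW]; exact hτ.trans_le hτx)
        exact hle.trans (mul_le_mul_of_nonneg_left (Real.exp_le_exp.2 (by linarith)) (hc0 x))
    -- For exponential values |w'| = w, so η equals the common minimum m and the prescribed rates
    -- are all 1 / |T|.
    have hderiv : ∀ x ∈ bottom W a (z t), |deriv (σ.value f u x) (s t x)|⁻¹ = m⁻¹ := by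
      intro x hx
      obtain ⟨h1, h2, h3⟩ := hbot t htK.le x hx
      have hd : HasDerivAt (σ.value f u x) (-(c x * Real.exp (-s t x))) (s t x) := by
        have e : σ.value f u x = fun τ => c x * Real.exp (-τ) := funext fun τ => hI.value_eq x τ
        rw [e]
        have := ((hasDerivAt_neg (s t x)).exp).const_mul (c x)
        simpa using this
      rw [hd.deriv, abs_neg, abs_of_nonneg (mul_nonneg (hc0 x) (Real.exp_pos _).le),
        le_antisymm (h3 w hwW hw0) (hwmin x h1 h2)]
    have hrate : rate part k (part u) (σ.value f u) (s t) v
        = if v ∈ bottom W a (z t) then -(1 / ((bottom W a (z t)).card : ℝ)) else 0 := by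
      rw [rate, hargmin, hsmass, hfull]
      simp only [hK, true_and]
      split_ifs with hv
      · have hT0 : ((bottom W a (z t)).card : ℝ) ≠ 0 := by
          exact_mod_cast (Finset.card_pos.2 ⟨w, hw⟩).ne'
        rw [hderiv v hv, Finset.sum_congr rfl hderiv, Finset.sum_const, nsmul_eq_mul]
        field_simp
      · rfl
    rw [hrate]
    exact hzd1 t htK hfull' v hvW

end

end OnlineSubmodular

end

noncomputable section

namespace OnlineSubmodular

/-! ### Runs of the algorithm -/

variable {Ω ι : Type*} {f : Finset Ω → ℝ} {part : Ω → ι} {k : ι → ℕ} {α : ℝ}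

lemma nodup_append_singleton {h : List Ω} {u : Ω} : (h ++ [u]).Nodup ↔ h.Nodup ∧ u ∉ h := by
  rw [← List.concat_eq_append, List.nodup_concat, and_comm]

theorem IsContinuousRun.invariant {C : List Ω → State Ω} (hC : IsContinuousRun f part k α C)
    (hf : IsMonotoneSubmodular f) (hα : 3 < α) (he : α = Real.exp (α - 2))
    (hk : ∀ v, 0 < k (part v)) (h : List Ω) (hn : h.Nodup) : Invariant f part k α h (C h) := by
  induction h using List.reverseRecOn with
  | nil =>
    rw [hC.init]
    exact invariant_nil f part k α
  | append_singleton h u ih =>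
    obtain ⟨hn', hu⟩ := nodup_append_singleton.1 hn
    exact (ih hn').step hf hα he hk hu (hC.round h u hn)

lemma Round.S_le {σ σ' : State Ω} {u v : Ω} (hr : Round f part k α σ u σ') (hv : v ≠ u) :
    σ'.S v ≤ σ.S v := by
  obtain ⟨d, s, hp, rfl⟩ := hr
  exact hp.le_start ⟨hp.length_nonneg, le_rfl⟩ hv

/-- The fractional solution is `α`-competitive. -/
theorem Invariant.le_mul_fhat [Fintype ι] {h : List Ω} {σ : State Ω}
    (hI : Invariant f part k α h σ) (hf : IsMonotoneSubmodular f) (hα : 2 < α)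
    (hk : ∀ v, 0 < k (part v)) {O : Finset Ω} (hO : O ⊆ h.toFinset) (hind : Indep part k O) :
    f O ≤ α * fhat f σ.S := by
  set F : ι → ℝ := fun l => surplus α (h.toFinset.filter fun v => part v = l)
    (fun v => σ.w v 0) σ.S σ.A with hF
  have hF0 : ∀ l, 0 ≤ F l := fun l => by
    rcases Nat.eq_zero_or_pos (k l) with h0 | h0
    · have : h.toFinset.filter (fun v => part v = l) = ∅ :=
        Finset.filter_eq_empty_iff.2 fun v _ hv => by
          have := hk v
          rw [hv] at this
          omega
      simp [hF, this, surplus]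
    · have h1 := hI.surplus_nonneg hα h0
      have h2 : (0 : ℝ) < 1 / k l := by positivity
      exact nonneg_of_mul_nonneg_right h1 h2
  have h1 := hf.le_fhat_add hI.A_nonneg O
  have h2 : ∑ u ∈ O, fhat (gain f u) σ.A ≤ ∑ u ∈ O, 1 / (k (part u) : ℝ) * F (part u) :=
    Finset.sum_le_sum fun u hu => by
      have huh := List.mem_toFinset.1 (hO hu)
      exact (hI.marginal_le u huh).trans (hI.stopped u huh)
  -- At most k l elements of O lie in part l, and each is charged a 1 / k l share of a nonnegative
  -- surplus.
  have h3 : ∑ u ∈ O, 1 / (k (part u) : ℝ) * F (part u) ≤ ∑ l, F l := by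
    rw [← Finset.sum_fiberwise O part]
    refine Finset.sum_le_sum fun l _ => ?_
    rw [Finset.sum_congr rfl (g := fun _ => 1 / (k l : ℝ) * F l) fun u hu => by
      rw [(Finset.mem_filter.1 hu).2], Finset.sum_const, nsmul_eq_mul]
    have hc : ((O.filter fun u => part u = l).card : ℝ) ≤ k l := by exact_mod_cast hind l
    rcases Nat.eq_zero_or_pos (k l) with h0 | h0
    · rw [h0] at hc ⊢
      simpa using hF0 l
    · have hk0 : (0 : ℝ) < k l := by exact_mod_cast h0
      rw [← mul_assoc, mul_one_div]
      exact mul_le_of_le_one_left (hF0 l) ((div_le_one hk0).2 hc)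
  have h4 : ∑ l, F l = α * ∑ v ∈ h.toFinset, σ.w v 0 * (1 - Real.exp (-σ.S v))
      - ∑ v ∈ h.toFinset, σ.w v 0 * (1 - Real.exp (-σ.A v)) := by
    simp only [hF, surplus, Finset.sum_sub_distrib, ← Finset.mul_sum]
    have e : ∀ g : Ω → ℝ, ∑ l, ∑ v ∈ h.toFinset.filter (fun v => part v = l), g v =
        ∑ v ∈ h.toFinset, g v := fun g => Finset.sum_fiberwise _ part g
    rw [e, e]
  have h5 := hI.le_fhat σ.S hI.S_nonneg hI.S_le
  have h6 := hI.fhat_A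
  have h7 := hf.nonneg ∅
  nlinarith

/-- The rounded algorithm is a randomized online algorithm. -/
theorem IsKnapsackRun.isRandomizedOnlineAlgorithm [Finite ι] {C : List Ω → State Ω}
    {pos : List Ω → Ω → ℝ → ℝ} (hpos : IsKnapsackRun part k C pos)
    (hC : IsContinuousRun f part k α C) :
    IsRandomizedOnlineAlgorithm part k (fun z h => rounded part k (C h).S (pos h) z) where
  init z := by simp [hC.init, rounded]
  step z h u hn v hv := by
    rw [Finset.mem_insert]
    refine or_iff_not_imp_left.2 fun hvu => ?_
    simp only [rounded, Finset.mem_filter, Finsupp.mem_support_iff] at hv ⊢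
    obtain ⟨-, t, ht, i, hi⟩ := hv
    have hle := (hC.round h u hn).S_le hvu
    rw [hpos.keep h u hn v hvu t ht] at hi
    exact ⟨(ht.1.trans_le (ht.2.trans hle)).ne', t, ⟨ht.1, ht.2.trans hle⟩, i, hi⟩
  indep z h hn := (hpos.stored h hn).indep_rounded z
  measurable h hn X := (hpos.stored h hn).measurableSet_rounded X

/-! ### Existence of a run that depends only on the arrived elements -/

lemma RoundPath.congr {g : Finset Ω → ℝ} {σ : State Ω} {u : Ω} {d : ℝ} {s : ℝ → Ω →₀ ℝ}
    (hv : σ.value f u = σ.value g u) (hp : RoundPath f part k α σ u d s) :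
    RoundPath g part k α σ u d s where
  length_nonneg := hp.length_nonneg
  start := hp.start
  clock := hp.clock
  nonneg := hp.nonneg
  feasible := hp.feasible
  continuous := hp.continuous
  accepts t ht := by
    have := hp.accepts t ht
    rwa [Accepts, hv] at this
  stops := by
    have := hp.stops
    rwa [Accepts, hv] at this
  evolves := hv ▸ hp.evolves

lemma Round.congr {g : Finset Ω → ℝ} {σ σ' : State Ω} {u : Ω} (hv : σ.value f u = σ.value g u)
    (hr : Round f part k α σ u σ') : Round g part k α σ u σ' := by
  obtain ⟨d, s, hp, rfl⟩ := hr
  exact ⟨d, s, hp.congr hv, by rw [hv]⟩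

lemma State.value_congr {g : Finset Ω → ℝ} {σ : State Ω} {u : Ω}
    (h : ∀ R ⊆ insert u σ.A.support, f R = g R) : σ.value f u = σ.value g u := by
  unfold State.value
  congr 1
  funext τ
  rw [marginal_add_single, marginal_add_single, fhat_congr fun R hR => ?_]
  rw [gain, gain, h _ (Finset.insert_subset_insert u hR),
    h R (hR.trans (Finset.subset_insert _ _))]

/-- The values of `f` on the elements seen so far. -/
def seen (f : Finset Ω → ℝ) (σ : State Ω) (u : Ω) (X : Finset Ω) : ℝ :=
  f (X ∩ insert u σ.A.support)

lemma State.value_seen (f : Finset Ω → ℝ) (σ : State Ω) (u : Ω) :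
    σ.value (seen f σ u) u = σ.value f u :=
  State.value_congr fun R hR => by rw [seen, Finset.inter_eq_left.2 hR]

/-- `p'` is the state of the algorithm and of the knapsack after the round of `u`. -/
def IsStep (part : Ω → ι) (k : ι → ℕ) (α : ℝ) (f : Finset Ω → ℝ)
    (p : State Ω × (Ω → ℝ → ℝ)) (u : Ω) (p' : State Ω × (Ω → ℝ → ℝ)) : Prop :=
  Round (seen f p.1 u) part k α p.1 u p'.1 ∧ IsPacked part k p'.1.S p'.2 ∧
    ∀ v, v ≠ u → p'.2 v = p.2 v

/-- A step that depends only on the values of `f` on the elements seen so far. -/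
def nextState (part : Ω → ι) (k : ι → ℕ) (α : ℝ) (f : Finset Ω → ℝ)
    (p : State Ω × (Ω → ℝ → ℝ)) (u : Ω) : State Ω × (Ω → ℝ → ℝ) :=
  if H : ∃ p', IsStep part k α f p u p' then H.choose else p

/-- The state after the arrivals `h`. -/
def runState (part : Ω → ι) (k : ι → ℕ) (α : ℝ) (f : Finset Ω → ℝ) (h : List Ω) :
    State Ω × (Ω → ℝ → ℝ) :=
  h.foldl (nextState part k α f) (⟨0, 0, fun _ _ => 0⟩, fun _ _ => 0)

lemma runState_append (h : List Ω) (u : Ω) :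
    runState part k α f (h ++ [u]) = nextState part k α f (runState part k α f h) u := by
  simp [runState]

lemma nextState_congr {g : Finset Ω → ℝ} {p : State Ω × (Ω → ℝ → ℝ)} {u : Ω}
    (h : ∀ R ⊆ insert u p.1.A.support, f R = g R) :
    nextState part k α f p u = nextState part k α g p u := by
  have : seen f p.1 u = seen g p.1 u := funext fun X => h _ Finset.inter_subset_right
  have e : IsStep part k α f p u = IsStep part k α g p u := by
    unfold IsStep
    rw [this]
  unfold nextState
  rw [e]

lemma Invariant.isStep_nextState {h : List Ω} {u : Ω} {p : State Ω × (Ω → ℝ → ℝ)}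
    (hI : Invariant f part k α h p.1) (hp : IsPacked part k p.1.S p.2)
    (hf : IsMonotoneSubmodular f) (hα : 3 < α) (he : α = Real.exp (α - 2))
    (hk : ∀ v, 0 < k (part v)) (hu : u ∉ h) :
    Round f part k α p.1 u (nextState part k α f p u).1 ∧
      IsPacked part k (nextState part k α f p u).1.S (nextState part k α f p u).2 ∧
      ∀ v, v ≠ u → (nextState part k α f p u).2 v = p.2 v := by
  have H : ∃ p', IsStep part k α f p u p' := by
    obtain ⟨σ', hr⟩ := hI.exists_round hf hα he (hk u) hu
    have hI' := hI.step hf hα he hk hu hr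
    obtain ⟨pos', h1, h2⟩ := hp.exists_step (S' := σ'.S) (u := u) hI'.S_nonneg
      (fun v hv => hr.S_le hv) (hI'.mass_le _)
    exact ⟨(σ', pos'), hr.congr (State.value_seen f p.1 u).symm, h1, h2⟩
  rw [nextState, dif_pos H]
  obtain ⟨h1, h2⟩ := H.choose_spec
  exact ⟨h1.congr (State.value_seen f p.1 u), h2⟩

lemma runState_invariant (hf : IsMonotoneSubmodular f) (hα : 3 < α) (he : α = Real.exp (α - 2))
    (hk : ∀ v, 0 < k (part v)) (h : List Ω) (hn : h.Nodup) :
    Invariant f part k α h (runState part k α f h).1 ∧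
      IsPacked part k (runState part k α f h).1.S (runState part k α f h).2 := by
  induction h using List.reverseRecOn with
  | nil => exact ⟨invariant_nil f part k α, isPacked_zero⟩
  | append_singleton h u ih =>
    obtain ⟨hn', hu⟩ := nodup_append_singleton.1 hn
    obtain ⟨hI, hp⟩ := ih hn'
    obtain ⟨h1, h2, -⟩ := hI.isStep_nextState hp hf hα he hk hu
    rw [runState_append]
    exact ⟨hI.step hf hα he hk hu h1, h2⟩

lemma runState_isContinuousRun (hf : IsMonotoneSubmodular f) (hα : 3 < α)
    (he : α = Real.exp (α - 2)) (hk : ∀ v, 0 < k (part v)) :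
    IsContinuousRun f part k α fun h => (runState part k α f h).1 where
  init := rfl
  round h u hn := by
    obtain ⟨hn', hu⟩ := nodup_append_singleton.1 hn
    obtain ⟨hI, hp⟩ := runState_invariant hf hα he hk h hn'
    rw [runState_append]
    exact (hI.isStep_nextState hp hf hα he hk hu).1

lemma runState_isKnapsackRun (hf : IsMonotoneSubmodular f) (hα : 3 < α)
    (he : α = Real.exp (α - 2)) (hk : ∀ v, 0 < k (part v)) :
    IsKnapsackRun part k (fun h => (runState part k α f h).1)
      fun h => (runState part k α f h).2 where
  stored h hn := (runState_invariant hf hα he hk h hn).2.toIsStored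
  keep h u hn v hv t _ := by
    obtain ⟨hn', hu⟩ := nodup_append_singleton.1 hn
    obtain ⟨hI, hp⟩ := runState_invariant hf hα he hk h hn'
    rw [runState_append, (hI.isStep_nextState hp hf hα he hk hu).2.2 v hv]

lemma runState_congr {g : Finset Ω → ℝ} (hf : IsMonotoneSubmodular f) (hα : 3 < α)
    (he : α = Real.exp (α - 2)) (hk : ∀ v, 0 < k (part v)) (h : List Ω) (hn : h.Nodup)
    (hfg : ∀ X ⊆ h.toFinset, f X = g X) :
    runState part k α f h = runState part k α g h := by
  induction h using List.reverseRecOn with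
  | nil => rfl
  | append_singleton h u ih =>
    obtain ⟨hn', hu⟩ := nodup_append_singleton.1 hn
    have hsub : insert u h.toFinset ⊆ (h ++ [u]).toFinset := fun v hv => by simpa using hv
    rw [runState_append, runState_append, ← ih hn' fun X hX =>
      hfg X (hX.trans ((Finset.subset_insert u _).trans hsub))]
    refine nextState_congr fun R hR => hfg R (hR.trans (Finset.Subset.trans ?_ hsub))
    exact Finset.insert_subset_insert u (runState_invariant hf hα he hk h hn').1.support

end OnlineSubmodular

end

theorem mainTheorem5 {Ω ι : Type*} [Fintype ι] (part : Ω → ι) (k : ι → ℕ)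
    (hk : ∀ u, 0 < k (part u)) :
    ∃ α : ℝ,
      -- the constant
      (1 < α ∧ α = Real.exp (α - 2)) ∧
      (∀ β : ℝ, 1 < β → β = Real.exp (β - 2) → β = α) ∧
      |1 / α - 0.3178| < 0.00005 ∧
      -- every run of the continuous algorithm, rounded in any admissible way, has the ratio
      (∀ f : Finset Ω → ℝ, OnlineSubmodular.IsMonotoneSubmodular f →
        ∀ C : List Ω → OnlineSubmodular.State Ω,
        OnlineSubmodular.IsContinuousRun f part k α C →
        (∀ h : List Ω, h.Nodup → ∀ O : Finset Ω, O ⊆ h.toFinset →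
          OnlineSubmodular.Indep part k O → f O ≤ α * OnlineSubmodular.fhat f (C h).S) ∧
        ∀ pos : List Ω → Ω → ℝ → ℝ, OnlineSubmodular.IsKnapsackRun part k C pos →
          OnlineSubmodular.IsRandomizedOnlineAlgorithm part k
            (fun z h => OnlineSubmodular.rounded part k (C h).S (pos h) z) ∧
          (∀ h : List Ω, h.Nodup → OnlineSubmodular.fhat f (C h).S ≤
            ∫ z, f (OnlineSubmodular.rounded part k (C h).S (pos h) z)
              ∂(OnlineSubmodular.seedMeasure k)) ∧
          OnlineSubmodular.HasCompetitiveRatio f part k (OnlineSubmodular.seedMeasure k)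
            (fun z h => OnlineSubmodular.rounded part k (C h).S (pos h) z) (1 / α)) ∧
      -- such runs exist, and can be chosen to use only the values of `f` on arrived elements
      (∃ (C : (Finset Ω → ℝ) → List Ω → OnlineSubmodular.State Ω)
          (pos : (Finset Ω → ℝ) → List Ω → Ω → ℝ → ℝ),
        (∀ f : Finset Ω → ℝ, OnlineSubmodular.IsMonotoneSubmodular f →
          OnlineSubmodular.IsContinuousRun f part k α (C f) ∧
          OnlineSubmodular.IsKnapsackRun part k (C f) (pos f)) ∧
        (∀ f g : Finset Ω → ℝ, OnlineSubmodular.IsMonotoneSubmodular f →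
          OnlineSubmodular.IsMonotoneSubmodular g → ∀ h : List Ω, h.Nodup →
          (∀ X : Finset Ω, X ⊆ h.toFinset → f X = g X) →
          C f h = C g h ∧ pos f h = pos g h)) := by
  obtain ⟨α, hlow, hhigh, he⟩ := OnlineSubmodular.exists_ratio_root
  have hα : 3 < α := by linarith
  have hα0 : 0 < α := by linarith
  refine ⟨α, ⟨by linarith, he⟩, fun β hβ hβe => ?_, ?_, fun f hf C hC => ?_, ?_⟩
  · rcases lt_trichotomy β α with hlt | heq | hgt
    · exact (OnlineSubmodular.ratio_root_unique hβ hβe hlt he).elim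
    · exact heq
    · exact (OnlineSubmodular.ratio_root_unique (by linarith) he hgt hβe).elim
  · rw [abs_lt]
    constructor
    · rw [lt_sub_iff_add_lt, lt_div_iff₀ hα0]
      linarith
    · rw [sub_lt_iff_lt_add, div_lt_iff₀ hα0]
      linarith
  · have hfrac : ∀ h : List Ω, h.Nodup → ∀ O : Finset Ω, O ⊆ h.toFinset →
        OnlineSubmodular.Indep part k O → f O ≤ α * OnlineSubmodular.fhat f (C h).S :=
      fun h hn O hO hind =>
        (hC.invariant hf hα he hk h hn).le_mul_fhat hf (by linarith) hk hO hind
    refine ⟨hfrac, fun pos hpos => ?_⟩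
    have hround : ∀ h : List Ω, h.Nodup → OnlineSubmodular.fhat f (C h).S ≤
        ∫ z, f (OnlineSubmodular.rounded part k (C h).S (pos h) z)
          ∂(OnlineSubmodular.seedMeasure k) := fun h hn =>
      (hpos.stored h hn).fhat_le_integral_rounded (hC.invariant hf hα he hk h hn).S_nonneg hk hf
    refine ⟨hpos.isRandomizedOnlineAlgorithm hC, hround, fun h hn O hO hind => ?_⟩
    refine le_trans ?_ (hround h hn)
    rw [one_div, inv_mul_le_iff₀ hα0]
    exact hfrac h hn O hO hind
  · refine ⟨fun f h => (OnlineSubmodular.runState part k α f h).1,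
      fun f h => (OnlineSubmodular.runState part k α f h).2, fun f hf =>
        ⟨OnlineSubmodular.runState_isContinuousRun hf hα he hk,
          OnlineSubmodular.runState_isKnapsackRun hf hα he hk⟩, fun f g hf _ h hn hfg => ?_⟩
    have e := OnlineSubmodular.runState_congr hf hα he hk h hn hfg
    exact ⟨congrArg Prod.fst e, congrArg Prod.snd e⟩
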